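/- **Notation.** Let $\alpha\in\mathbb R$. For $k\in\mathbb C^2$, $x\in\mathbb R^2$ put $kx=k_1x_1+k_2x_2$; for $k=(k_1,k_2)$ put $k_\perp=(-k_2,k_1)$. For $x\in\mathbb R^2\setminus\{0\}$ let $$g(x,k)=-\frac1{(2\pi)^2}\lim_{N\to+\infty}\int_{|\xi|\le N}\frac{e^{i\xi x}}{\xi^2+2k\xi}\,d\xi,\qquad k\in\mathbb C^2,\ \operatorname{Im}k\neq0,$$ and, for $k\in\mathbb R^2\setminus\{0\}$, $$g^+(x,k)=\lim_{\varepsilon\to0+}g(x,k+i\varepsilon k),\qquad g_\pm(x,k)=\lim_{\varepsilon\to0+}g(x,k\pm i\varepsilon k_\perp).$$ Let $\psi=e^{ikx}\mu$, $\psi^+=e^{ikx}\mu^+$, $\psi_\pm=e^{ikx}\mu_\pm$, where $$\mu(x,k)=1+\frac{\alpha\, g(x,k)}{1-\frac{\alpha}{2\pi}\ln(|\operatorname{Re}k|+|\operatorname{Im}k|)},\quad \mu^+(x,k)=1+\frac{\alpha\, g^+(x,k)}{1+\frac{\alpha}{4\pi}(\pi i-2\ln|k|)},\quad \mu_\pm(x,k)=1+\frac{\alpha\,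 g_\pm(x,k)}{1-\frac{\alpha}{2\pi}\ln|k|}$$ ($\operatorname{Im}k\ne0$, $k^2\in\mathbb R$ for $\mu$; $k\in\mathbb R^2\setminus\{0\}$ for $\mu^+,\mu_\pm$). Let $$a(k)=b(k)=\frac1{(2\pi)^2}\,\frac{\alpha}{1-\frac{\alpha}{2\pi}\ln(|\operatorname{Re}k|+|\operatorname{Im}k|)},$$ and, for $k,l\in\mathbb R^2$ with $k^2=l^2>0$, $$f(k,l)=\frac1{(2\pi)^2}\,\frac{\alpha}{1+\frac{\alpha}{4\pi}(\pi i-2\ln|k|)},\qquad h_\pm(k,l)=\frac1{(2\pi)^2}\,\frac{\alpha}{1-\frac{\alpha}{2\pi}\ln|k|}.$$ For $\lambda\ne0$ put $k_0^\pm(\lambda)=(\lambda,\pm i\lambda)$ and, for $E\neq0$, $k_E(\lambda)=\big((\tfrac1\lambda+\lambda)\tfrac{\sqrt E}2,\ (\tfrac1\lambda-\lambda)\tfrac{i\sqrt E}2\big)$, with $\sqrt E=i\sqrt{|E|}$ for $E<0$. Let $\chi_+(s)=1$ for $s>0$ and $\chi_+(s)=0$ for $s\le0$. Call $\lambda\neq0$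 *non-singular* for $k(\lambda)=k_E(\lambda)$ or $k_0^\pm(\lambda)$ if $1-\frac{\alpha}{2\pi}\ln(|\operatorname{Re}k(\lambda)|+|\operatorname{Im}k(\lambda)|)\ne0$. **Proposition 1.** Let $\alpha\in\mathbb R$ and $x\in\mathbb R^2$, $x\neq0$. Then the integrands in $g$ are integrable on every disc $|\xi|\le N$, all the limits defining $g,g^+,g_\pm$ exist, and: 1. (negative energy) If $E<0$, then at every non-singular $\lambda\ne0$ with $|\lambda|\neq1$ the function $\lambda\mapsto\psi(x,k_E(\lambda))$ is real-differentiable and $$\frac{\partial}{\partial\bar\lambda}\psi(x,k_E(\lambda))=\frac{\pi\,\mathrm{sign}(\lambda\bar\lambda-1)}{\bar\lambda}\,b(k_E(\lambda))\,\overline{\psi(x,k_E(\lambda))};$$ moreover both sides are locally integrable and the equation holds in the sense of distributions on the whole open set of non-singular $\lambda\neq0$, including its points with $|\lambda|=1$. 2. (zero energy) At every non-singular $\lambda\ne0$ (for $k_0^+$, resp. $k_0^-$) the function $\lambda\mapsto\psi(x,k_0^\pm(\lambda))$ is real-differentiable and $$\frac{\partial}{\partial\bar\lambda}\psi(x,k_0^\pm(\lambda))=\frac{\pi}{\bar\lambda}\,b(k_0^\pm(\lambda))\,\overline{\psi(x,k_0^\pm(\lambda))}.$$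 3. (positive energy) If $E>0$, the equation of item 1 holds, with real-differentiability, at every non-singular $\lambda\neq0$ with $|\lambda|\ne1$. 4. If $E>0$, $1-\frac{\alpha}{2\pi}\ln\sqrt E\neq0$ and $|\lambda|=1$, then (the integrand being integrable) $$\psi_\pm(x,k_E(\lambda))=\psi^+(x,k_E(\lambda))+\pi i\int_{|\lambda'|=1}h_\pm(k_E(\lambda),k_E(\lambda'))\,\chi_+\!\Big(\pm i\Big(\frac{\lambda}{\lambda'}-\frac{\lambda'}{\lambda}\Big)\Big)\psi^+(x,k_E(\lambda'))\,|d\lambda'|.$$ 5. If $E>0$, $1-\frac{\alpha}{2\pi}\ln\sqrt E\neq0$ and $|\lambda|=|\lambda'|=1$, then (the integrand being integrable) $$h_\pm(k_E(\lambda),k_E(\lambda'))-\pi i\int_{|\lambda''|=1}h_\pm(k_E(\lambda),k_E(\lambda''))\,\chi_+\!\Big(\pm i\Big(\frac{\lambda}{\lambda''}-\frac{\lambda''}{\lambda}\Big)\Big)f(k_E(\lambda''),k_E(\lambda'))\,|d\lambda''|=f(k_E(\lambda),k_E(\lambda')).$$ 6. As $\lambda\to\infty$, $\mu(x,k_E(\lambda))\to1$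 for every real $E\ne0$, and $\mu(x,k_0^\pm(\lambda))\to1$. -/

import Mathlib

open Filter Topology MeasureTheory
open scoped ContDiff

noncomputable section

namespace PointPotential

/-- The Euclidean plane `ℝ²` (variables `x`, `ξ`). -/
abbrev R2 := EuclideanSpace ℝ (Fin 2)

/-- The space `ℂ²` of spectral parameters `k`; `‖k‖` is its Hermitian norm, which is the
Euclidean length `|k|` when `k` is real. -/
abbrev C2 := EuclideanSpace ℂ (Fin 2)

/-- The real part `Re k`. -/
def reVec (k : C2) : R2 := !₂[(k 0).re, (k 1).re]

/-- The imaginary part `Im k`. -/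
def imVec (k : C2) : R2 := !₂[(k 0).im, (k 1).im]

/-- The quantity `|Re k| + |Im k|`. -/
def modSum (k : C2) : ℝ := ‖reVec k‖ + ‖imVec k‖

/-- The complex bilinear product `k x = k₁ x₁ + k₂ x₂` of `k ∈ ℂ²` and `x ∈ ℝ²`. -/
def bdot (k : C2) (x : R2) : ℂ := k 0 * (x 0 : ℂ) + k 1 * (x 1 : ℂ)

/-- The vector `k_⊥ = (-k₂, k₁)`. -/
def perp (k : C2) : C2 := !₂[-(k 1), k 0]

/-! ### The Green functions -/

/-- The integrand `exp(i ξ x) / (ξ² + 2 k ξ)`. -/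
def greenIntegrand (x : R2) (k : C2) (ξ : R2) : ℂ :=
  Complex.exp (Complex.I * ((inner ℝ ξ x : ℝ) : ℂ)) /
    (((‖ξ‖ ^ 2 : ℝ) : ℂ) + 2 * bdot k ξ)

/-- `-(1/2π)² ∫_{|ξ| ≤ N} exp(i ξ x) / (ξ² + 2 k ξ) dξ`. -/
def gTrunc (x : R2) (k : C2) (N : ℝ) : ℂ :=
  -(1 / (2 * (Real.pi : ℂ))) ^ 2 *
    ∫ ξ in Metric.closedBall (0 : R2) N, greenIntegrand x k ξ

/-- `g(x,k) = -(1/2π)² ∫_{ℝ²} exp(i ξ x) / (ξ² + 2 k ξ) dξ` for `Im k ≠ 0`. The integrand is not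
absolutely integrable at infinity; the integral is the limit of the integrals over `|ξ| ≤ N`. -/
def g (x : R2) (k : C2) : ℂ := limUnder atTop (gTrunc x k)

/-- `g⁺(x,k) = g(x, k + i0k)` for real `k ≠ 0`. -/
def gPlus (x : R2) (k : C2) : ℂ :=
  limUnder (𝓝[>] (0 : ℝ)) fun ε : ℝ => g x (k + ((ε : ℂ) * Complex.I) • k)

/-- `g_±(x,k) = g(x, k ± i0k_⊥)` for real `k ≠ 0`; the sign is `σ = ±1`. -/
def gPM (σ : ℝ) (x : R2) (k : C2) : ℂ :=
  limUnder (𝓝[>] (0 : ℝ)) fun ε : ℝ => g x (k + ((σ : ℂ) * (ε : ℂ) * Complex.I) • perp k)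

/-! ### The eigenfunctions and the scattering data -/

/-- The denominator `1 - (α/2π) ln s`; its zeros are the singularities in the spectral
parameter. -/
def den (α s : ℝ) : ℝ := 1 - α / (2 * Real.pi) * Real.log s

/-- The denominator `1 + (α/4π) (π i - 2 ln s)`. -/
def denPlus (α s : ℝ) : ℂ :=
  1 + (α : ℂ) / (4 * (Real.pi : ℂ)) *
    ((Real.pi : ℂ) * Complex.I - 2 * ((Real.log s : ℝ) : ℂ))

/-- `μ(x,k)`, for `Im k ≠ 0`, `k² ∈ ℝ`. -/
def mu (α : ℝ) (x : R2) (k : C2) : ℂ :=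
  1 + (α : ℂ) / ((den α (modSum k) : ℝ) : ℂ) * g x k

/-- The Faddeev eigenfunction `ψ(x,k) = exp(ikx) μ(x,k)`, for `Im k ≠ 0`, `k² ∈ ℝ`. -/
def psi (α : ℝ) (x : R2) (k : C2) : ℂ := Complex.exp (Complex.I * bdot k x) * mu α x k

/-- `μ⁺(x,k)`, for real `k ≠ 0`. -/
def muPlus (α : ℝ) (x : R2) (k : C2) : ℂ := 1 + (α : ℂ) / denPlus α ‖k‖ * gPlus x k

/-- The scattering eigenfunction `ψ⁺(x,k) = exp(ikx) μ⁺(x,k)`, for real `k ≠ 0`. -/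
def psiPlus (α : ℝ) (x : R2) (k : C2) : ℂ :=
  Complex.exp (Complex.I * bdot k x) * muPlus α x k

/-- `μ_±(x,k)`, for real `k ≠ 0`. -/
def muPM (α σ : ℝ) (x : R2) (k : C2) : ℂ :=
  1 + (α : ℂ) / ((den α ‖k‖ : ℝ) : ℂ) * gPM σ x k

/-- `ψ_±(x,k) = exp(ikx) μ_±(x,k)`, for real `k ≠ 0`. -/
def psiPM (α σ : ℝ) (x : R2) (k : C2) : ℂ :=
  Complex.exp (Complex.I * bdot k x) * muPM α σ x k

/-- The generalized scattering data `a(k)`, for `Im k ≠ 0`, `k² ∈ ℝ`. -/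
def aData (α : ℝ) (k : C2) : ℂ :=
  (1 / (2 * (Real.pi : ℂ))) ^ 2 * ((α : ℂ) / ((den α (modSum k) : ℝ) : ℂ))

/-- The generalized scattering data `b(k)`; for point potentials `b(k) = a(k)`. -/
def bData (α : ℝ) (k : C2) : ℂ := aData α k

/-- The scattering amplitude `f(k,l)`, for real `k`, `l` with `k² = l² > 0`
(it does not depend on `l`). -/
def fAmp (α : ℝ) (k _l : C2) : ℂ :=
  (1 / (2 * (Real.pi : ℂ))) ^ 2 * ((α : ℂ) / denPlus α ‖k‖)

/-- The generalized scattering data `h_±(k,l)`, for real `k`, `l` with `k² = l² > 0`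
(neither the sign nor `l` enters the formula). -/
def hPM (α _σ : ℝ) (k _l : C2) : ℂ :=
  (1 / (2 * (Real.pi : ℂ))) ^ 2 * ((α : ℂ) / ((den α ‖k‖ : ℝ) : ℂ))

/-! ### The fixed energy surfaces -/

/-- The square root of a real number `E`: `√E` for `E ≥ 0`, `i √|E|` for `E < 0`. -/
def sqrtC (E : ℝ) : ℂ :=
  if 0 ≤ E then ((Real.sqrt E : ℝ) : ℂ) else Complex.I * ((Real.sqrt (-E) : ℝ) : ℂ)

/-- The parametrization `k_E(z)` of `k² = E`, for `E ≠ 0`, `z ≠ 0`. -/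
def kE (E : ℝ) (z : ℂ) : C2 :=
  !₂[(1 / z + z) * (sqrtC E / 2), (1 / z - z) * (Complex.I * sqrtC E / 2)]

/-- The parametrizations `k_0^±(z) = (z, ± i z)` of the two components of `k² = 0`;
the sign is `σ = ±1`. -/
def kZero (σ : ℝ) (z : ℂ) : C2 := !₂[z, (σ : ℂ) * Complex.I * z]

/-! ### The `∂̄`-equation and integrals over the unit circle -/

/-- `∂F/∂z̄ = (∂F/∂x + i ∂F/∂y) / 2` for `z = x + i y`. -/
def dbar (F : ℂ → ℂ) (z : ℂ) : ℂ :=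
  (1 / 2) * (fderiv ℝ F z 1 + Complex.I * fderiv ℝ F z Complex.I)

/-- `F` is real-differentiable at `z` and `∂F/∂z̄ = w` there. -/
def HasDbarAt (F : ℂ → ℂ) (w z : ℂ) : Prop := DifferentiableAt ℝ F z ∧ dbar F z = w

/-- `∂F/∂z̄ = Q` in the open set `U` in the sense of distributions. -/
def WeakDbarOn (U : Set ℂ) (F Q : ℂ → ℂ) : Prop :=
  LocallyIntegrableOn F U ∧ LocallyIntegrableOn Q U ∧
    ∀ φ : ℂ → ℂ, ContDiff ℝ ∞ φ → HasCompactSupport φ → tsupport φ ⊆ U →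
      ∫ z, F z * dbar φ z = -∫ z, Q z * φ z

/-- The right-hand side of the `∂̄`-equation at nonzero energy `E`:
`(π sign(z z̄ - 1) / z̄) b(k_E(z)) conj(ψ(x, k_E(z)))`. -/
def dbarRHS (α : ℝ) (x : R2) (E : ℝ) (z : ℂ) : ℂ :=
  (Real.pi : ℂ) * ((Real.sign (‖z‖ ^ 2 - 1) : ℝ) : ℂ) / (starRingEnd ℂ) z *
    bData α (kE E z) * (starRingEnd ℂ) (psi α x (kE E z))

/-- `∫_{|z| = 1} F(z) |dz|`. -/
def arcIntegral (F : ℂ → ℂ) : ℂ := ∫ θ in (0 : ℝ)..(2 * Real.pi), F (circleMap 0 1 θ)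

/-- `χ₊(± i (z/w - w/z))` for `|z| = |w| = 1`, where `χ₊(s) = 1` for `s > 0` and `χ₊(s) = 0` for
`s ≤ 0`. The argument of `χ₊` is a real number there. -/
def chiArc (σ : ℝ) (z w : ℂ) : ℂ :=
  if 0 < ((σ : ℂ) * Complex.I * (z / w - w / z)).re then 1 else 0

end PointPotential

end

open PointPotential

noncomputable section

namespace PointPotential

/-! The proof rests on an explicit formula for G(x,k) = e^{ikx} g(x,k), called `faddeevG`. In a
frame with x₁ > 0, integrate over ξ₁ along the line ξ₂ = t. The poles are -k₁ ± i√W(t) with W(t) =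
t² + 2k₂t - k₁², and residues give `greenSlice`, which decays exponentially in t; thus g = -(1/4π) ∫
`greenSlice` dt (`greenSlice_spec`). The limit over discs is legitimate because the integrand
differs from e^{iξx}/(1+ξ²) by an absolutely integrable function, and the latter is controlled on
chords of the disc by integration by parts.

Multiplying by e^{ikx} and putting τ = t + Re k₂ leaves a line integrand that depends on Im k and k²
only (`exp_mul_greenSlice`). Combined with g(x,-k̄) = conj g(x,k), this shows that G is real when k²
is real (`conj_faddeevG`). In a frame with Im k₁ > 0 and Re k₂ > 0 a pole survives exactly when |τ|
> Re k₂, so G is -(1/2π) times the real part of a holomorphic ray integral starting at k₂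
(`faddeevG_eq_rayIntegral`). Along the energy curve this gives dG = ±(1/2π) Re(e^{ikx} dλ/λ), the
sign being that of |λ|² - 1 for `kE` and + at zero energy (`hasFDerivAt_faddeevG_kE`,
`hasFDerivAt_faddeevG_kZero`). Such a frame exists unless x is parallel to Im k; for λ on that
exceptional line the formula follows from the continuity of g (`continuousAt_g`) and a primitive of
the one-form.

On `kE` the modulus |Re k| + |Im k| equals √|E| max(|λ|, 1/|λ|), and on `kZero` it is 2|λ|, so its
logarithm has differential ± Re(dλ/λ) with the same sign. A differential Re(c dλ) has ∂̄-part c̄/2,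
and the product rule applied to ψ = e^{ikx} + (α/den) G yields the ∂̄-equation; the conjugate of ψ
appears because G and α/den are real (`hasDbarAt_psi`). At negative energy Im k never vanishes, so ψ
is continuous across |λ| = 1 and integration by parts leaves no boundary term
(`weakDbarOn_of_off_circle`).

For real k the poles with |τ| < |k| tend to the real axis, and the direction of approach decides
which of them count: always the outgoing one for g⁺, a selection depending on k for g_±
(`boundaryTerm`). The substitution τ = |k| sin φ turns the difference into an integral of plane
waves over a half circle (`gPM_eq`). Items 4 and 5 are then algebra based on two facts: the half
circle has length π, and the two denominators differ by iα/4 (`denPlus_eq`).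

At infinity g stays bounded at fixed energy (`exists_norm_g_le`), while α/den tends to 0. -/

/-! ### One-dimensional residue integrals by Fourier inversion -/

open Complex FourierTransform in
/-- The bounded fundamental solution of `d/dy - iσ`. -/
noncomputable def halfExp (σ : ℂ) (y : ℝ) : ℂ :=
  if 0 < σ.im then (Set.Ioi (0 : ℝ)).indicator (fun y : ℝ => Complex.exp (Complex.I * σ * y)) y
  else -(Set.Iic (0 : ℝ)).indicator (fun y : ℝ => Complex.exp (Complex.I * σ * y)) y

lemma integrable_halfExp {σ : ℂ} (hσ : σ.im ≠ 0) : Integrable (halfExp σ) := by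
  unfold halfExp
  split_ifs with h
  · exact (integrable_indicator_iff measurableSet_Ioi).2
      (integrableOn_exp_mul_complex_Ioi (by simpa using h) 0)
  · have h' : σ.im < 0 := lt_of_le_of_ne (not_lt.1 h) hσ
    exact ((integrable_indicator_iff measurableSet_Iic).2
      (integrableOn_exp_mul_complex_Iic (by simpa using h') 0)).neg

lemma integral_exp_mul_halfExp {σ : ℂ} (hσ : σ.im ≠ 0) (s : ℝ) :
    ∫ y : ℝ, Complex.exp (-(Complex.I * s * y)) * halfExp σ y
      = 1 / (Complex.I * ((s : ℂ) - σ)) := by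
  unfold halfExp
  have hne : (s : ℂ) - σ ≠ 0 := by
    intro h; apply hσ
    have := congrArg Complex.im h
    simpa using this
  split_ifs with h
  · have : ∀ y : ℝ, Complex.exp (-(Complex.I * s * y)) *
        (Set.Ioi (0 : ℝ)).indicator (fun y : ℝ => Complex.exp (Complex.I * σ * y)) y
        = (Set.Ioi (0 : ℝ)).indicator
          (fun y : ℝ => Complex.exp ((Complex.I * (σ - s)) * y)) y := by
      intro y
      by_cases hy : y ∈ Set.Ioi (0 : ℝ)
      · simp only [Set.indicator_of_mem hy, ← Complex.exp_add]; ring_nf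
      · simp [Set.indicator_of_notMem hy]
    simp_rw [this]
    rw [integral_indicator measurableSet_Ioi, integral_exp_mul_complex_Ioi (by simpa using h)]
    have : σ - s ≠ 0 := by rw [← neg_sub]; exact neg_ne_zero.2 hne
    simp
    field_simp
    rw [Complex.I_sq]
    ring
  · have h' : σ.im < 0 := lt_of_le_of_ne (not_lt.1 h) hσ
    have : ∀ y : ℝ, Complex.exp (-(Complex.I * s * y)) *
        (-(Set.Iic (0 : ℝ)).indicator (fun y : ℝ => Complex.exp (Complex.I * σ * y)) y)
        = -(Set.Iic (0 : ℝ)).indicator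
          (fun y : ℝ => Complex.exp ((Complex.I * (σ - s)) * y)) y := by
      intro y
      by_cases hy : y ∈ Set.Iic (0 : ℝ)
      · simp only [Set.indicator_of_mem hy, mul_neg, ← Complex.exp_add]; ring_nf
      · simp [Set.indicator_of_notMem hy]
    simp_rw [this]
    rw [integral_neg, integral_indicator measurableSet_Iic,
      integral_exp_mul_complex_Iic (by simpa using h')]
    have : σ - s ≠ 0 := by rw [← neg_sub]; exact neg_ne_zero.2 hne
    simp
    field_simp
    ring

/-- Use s² ≤ 2(s - Re σ)² + 2(Re σ)² and write the constant 1 + 2(Re σ)² as a multiple of (Im σ)².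
-/
lemma one_add_sq_le_mul_norm_sub_sq {σ : ℂ} (hσ : σ.im ≠ 0) (s : ℝ) :
    1 + s ^ 2 ≤ (2 + (1 + 2 * σ.re ^ 2) / σ.im ^ 2) * ‖(s : ℂ) - σ‖ ^ 2 := by
  have h2 : 0 < σ.im ^ 2 := by positivity
  rw [Complex.sq_norm, Complex.normSq_apply]
  simp only [Complex.sub_re, Complex.ofReal_re, Complex.sub_im, Complex.ofReal_im]
  have : (1 + 2 * σ.re ^ 2) / σ.im ^ 2 * (σ.im ^ 2) = 1 + 2 * σ.re ^ 2 := by field_simp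
  have h3 : 0 ≤ (1 + 2 * σ.re ^ 2) / σ.im ^ 2 := by positivity
  nlinarith [sq_nonneg (s - 2 * σ.re), mul_nonneg h3 (sq_nonneg (s - σ.re))]

/-- The smaller of the two distances, squared, is at most their product, and it already dominates a
multiple of 1 + s². -/
lemma integrable_inv_sub_mul_sub {σ τ : ℂ} (hσ : σ.im ≠ 0) (hτ : τ.im ≠ 0) :
    Integrable fun s : ℝ => 1 / (((s : ℂ) - σ) * ((s : ℂ) - τ)) := by
  set A := 2 + (1 + 2 * σ.re ^ 2) / σ.im ^ 2
  set B := 2 + (1 + 2 * τ.re ^ 2) / τ.im ^ 2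
  have hne : ∀ {σ : ℂ}, σ.im ≠ 0 → ∀ s : ℝ, (s : ℂ) - σ ≠ 0 := by
    intro σ hσ s h; apply hσ
    have := congrArg Complex.im h
    simpa using this
  refine (integrable_inv_one_add_sq.const_mul (A + B)).mono' ?_ (ae_of_all _ fun s => ?_)
  · refine Continuous.aestronglyMeasurable ?_
    exact continuous_const.div (by fun_prop) fun s => mul_ne_zero (hne hσ s) (hne hτ s)
  · have h1 := one_add_sq_le_mul_norm_sub_sq hσ s
    have h2 := one_add_sq_le_mul_norm_sub_sq hτ s
    change 1 + s ^ 2 ≤ A * _ at h1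
    change 1 + s ^ 2 ≤ B * _ at h2
    have p1 : 0 < ‖(s : ℂ) - σ‖ := norm_pos_iff.2 (hne hσ s)
    have p2 : 0 < ‖(s : ℂ) - τ‖ := norm_pos_iff.2 (hne hτ s)
    have hA : 0 ≤ A := by positivity
    have hB : 0 ≤ B := by positivity
    rw [norm_div, norm_mul, norm_one, ← div_eq_mul_inv, div_le_div_iff₀ (by positivity)
      (by positivity)]
    rcases le_total ‖(s : ℂ) - σ‖ ‖(s : ℂ) - τ‖ with h | h
    · nlinarith [mul_le_mul_of_nonneg_left h (mul_nonneg hA p1.le), mul_nonneg hB (mul_pos p1 p2).le]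
    · nlinarith [mul_le_mul_of_nonneg_left h (mul_nonneg hB p2.le), mul_nonneg hA (mul_pos p1 p2).le]

lemma norm_exp_I_mul_ofReal_mul (s r : ℝ) : ‖Complex.exp (Complex.I * s * r)‖ = 1 := by
  rw [mul_assoc, ← Complex.ofReal_mul, Complex.norm_exp_I_mul_ofReal]

lemma integrable_exp_div_sub_mul_sub {σ τ : ℂ} (hσ : σ.im ≠ 0) (hτ : τ.im ≠ 0) (r : ℝ) :
    Integrable fun s : ℝ => Complex.exp (Complex.I * s * r) / (((s : ℂ) - σ) * ((s : ℂ) - τ)) := by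
  have := (integrable_inv_sub_mul_sub hσ hτ).bdd_mul (c := 1)
    (f := fun s : ℝ => Complex.exp (Complex.I * s * r))
    (Continuous.aestronglyMeasurable (by fun_prop))
    (ae_of_all _ fun s => (norm_exp_I_mul_ofReal_mul s r).le)
  refine this.congr (ae_of_all _ fun s => ?_)
  simp [div_eq_mul_inv]

/-- The residue formula for a quadratic denominator. -/
lemma integral_exp_div_sub_mul_sub {σ τ : ℂ} (hσ : σ.im ≠ 0) (hτ : τ.im ≠ 0) (hne : σ ≠ τ)
    {r : ℝ} (hr : 0 < r) :
    ∫ s : ℝ, Complex.exp (Complex.I * s * r) / (((s : ℂ) - σ) * ((s : ℂ) - τ))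
      = 2 * Real.pi * Complex.I * ((if 0 < σ.im then Complex.exp (Complex.I * σ * r) / (σ - τ)
          else 0) + (if 0 < τ.im then Complex.exp (Complex.I * τ * r) / (τ - σ) else 0)) := by
  have hst : σ - τ ≠ 0 := sub_ne_zero.2 hne
  have hne' : ∀ {σ : ℂ}, σ.im ≠ 0 → ∀ s : ℝ, (s : ℂ) - σ ≠ 0 := by
    intro σ hσ s h; apply hσ
    have := congrArg Complex.im h
    simpa using this
  -- The transform of one `halfExp` decays only like 1/s. That of the difference decays like 1/s²,
  -- hence is integrable, and Fourier inversion applies at the continuity point r. At r > 0 only the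
  -- exponents in the upper half-plane contribute.
  set w : ℝ → ℂ := fun y => halfExp σ y - halfExp τ y with hw
  have hwi : Integrable w := (integrable_halfExp hσ).sub (integrable_halfExp hτ)
  have hF : ∀ s : ℝ, FourierTransform.fourier w s = -Complex.I * (σ - τ) *
      (1 / (((2 * Real.pi * s : ℝ) - σ) * ((2 * Real.pi * s : ℝ) - τ))) := by
    intro s
    rw [Real.fourier_real_eq_integral_exp_smul]
    have e1 := integral_exp_mul_halfExp hσ (2 * Real.pi * s)
    have e2 := integral_exp_mul_halfExp hτ (2 * Real.pi * s)
    have i1 : ∀ {σ : ℂ}, σ.im ≠ 0 → Integrable fun y : ℝ =>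
        Complex.exp (-(Complex.I * (2 * Real.pi * s : ℝ) * y)) * halfExp σ y := by
      intro σ hσ
      refine (integrable_halfExp hσ).bdd_mul (c := 1)
        (Continuous.aestronglyMeasurable (by fun_prop)) (ae_of_all _ fun y => ?_)
      have := norm_exp_I_mul_ofReal_mul (2 * Real.pi * s) (-y)
      rw [← this]; apply le_of_eq; congr 2; push_cast; ring
    have : ∀ y : ℝ, Complex.exp (((-2 * Real.pi * y * s : ℝ) : ℂ) * Complex.I) • w y =
        Complex.exp (-(Complex.I * (2 * Real.pi * s : ℝ) * y)) * halfExp σ y -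
        Complex.exp (-(Complex.I * (2 * Real.pi * s : ℝ) * y)) * halfExp τ y := by
      intro y
      rw [← mul_sub, smul_eq_mul]
      congr 2; push_cast; ring
    simp_rw [this]
    rw [integral_sub (i1 hσ) (i1 hτ), e1, e2]
    have h1 := hne' hσ (2 * Real.pi * s)
    have h2 := hne' hτ (2 * Real.pi * s)
    have hI := Complex.I_sq
    field_simp
    linear_combination (σ - τ) * hI
  have hFi : Integrable (FourierTransform.fourier w) := by
    have : FourierTransform.fourier w = fun s : ℝ => -Complex.I * (σ - τ) *
      (fun u : ℝ => (1 / (((u : ℂ) - σ) * ((u : ℂ) - τ)))) (2 * Real.pi * s) := funext hF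
    rw [this]
    exact ((integrable_inv_sub_mul_sub hσ hτ).comp_mul_left'
      (by positivity : (2 * Real.pi : ℝ) ≠ 0)).const_mul _
  have hwv : ∀ y : ℝ, 0 < y → w y = (if 0 < σ.im then Complex.exp (Complex.I * σ * y) else 0)
      - (if 0 < τ.im then Complex.exp (Complex.I * τ * y) else 0) := by
    intro y hy
    simp only [hw, halfExp, Set.indicator, Set.mem_Ioi, hy, if_true, Set.mem_Iic,
      not_le.2 hy, if_false, neg_zero]
  have hc : ContinuousAt w r := by
    have : ContinuousAt (fun y : ℝ => (if 0 < σ.im then Complex.exp (Complex.I * σ * y) else 0)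
      - (if 0 < τ.im then Complex.exp (Complex.I * τ * y) else 0)) r := by
      split_ifs <;> fun_prop
    refine this.congr ?_
    filter_upwards [lt_mem_nhds hr] with y hy
    exact (hwv y hy).symm
  have inv := hwi.fourierInv_fourier_eq hFi hc
  rw [Real.fourierInv_eq'] at inv
  have e : ∀ v : ℝ, Complex.exp (((2 * Real.pi * inner ℝ v r : ℝ) : ℂ) * Complex.I) •
      FourierTransform.fourier w v = (-Complex.I * (σ - τ)) * (fun u : ℝ =>
        Complex.exp (Complex.I * u * r) / (((u : ℂ) - σ) * ((u : ℂ) - τ))) (2 * Real.pi * v) := by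
    intro v
    rw [hF v]
    simp only [smul_eq_mul, div_eq_mul_inv, one_mul]
    have : ((2 * Real.pi * inner ℝ v r : ℝ) : ℂ) * Complex.I
      = Complex.I * ((2 * Real.pi * v : ℝ) : ℂ) * r := by
      simp [inner]; ring
    rw [this]; ring
  simp_rw [e] at inv
  rw [integral_const_mul, hwv r hr] at inv
  rw [Measure.integral_comp_mul_left (fun u : ℝ => Complex.exp (Complex.I * u * r) /
    (((u : ℂ) - σ) * ((u : ℂ) - τ))) (2 * Real.pi)] at inv
  have hpi : (Real.pi : ℂ) ≠ 0 := by exact_mod_cast Real.pi_ne_zero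
  rw [abs_of_pos (by positivity), Complex.real_smul] at inv
  push_cast at inv
  have hts : τ - σ = -(σ - τ) := by ring
  set J := ∫ s : ℝ, Complex.exp (Complex.I * s * r) / (((s : ℂ) - σ) * ((s : ℂ) - τ))
  have hI := Complex.I_sq
  have key : J = 2 * Real.pi * Complex.I * (((if 0 < σ.im then Complex.exp (Complex.I * σ * r)
      else 0) - (if 0 < τ.im then Complex.exp (Complex.I * τ * r) else 0)) / (σ - τ)) := by
    rw [← inv]; field_simp; linear_combination J * hI
  rw [key, hts]
  simp only [div_neg]
  split_ifs <;> ring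

/-! ### Rotations and reflections -/

/-- The rotation of the plane with cosine `c` and sine `s`. -/
noncomputable def rotR (c s : ℝ) (x : R2) : R2 := !₂[c * x 0 - s * x 1, s * x 0 + c * x 1]

/-- The rotation with cosine `c` and sine `s`, acting on `ℂ²`. -/
noncomputable def rotC (c s : ℝ) (k : C2) : C2 := !₂[c * k 0 - s * k 1, s * k 0 + c * k 1]

@[simp] lemma rotR_zero (c s : ℝ) (x : R2) : rotR c s x 0 = c * x 0 - s * x 1 := rfl
@[simp] lemma rotR_one (c s : ℝ) (x : R2) : rotR c s x 1 = s * x 0 + c * x 1 := rfl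
@[simp] lemma rotC_zero (c s : ℝ) (k : C2) : rotC c s k 0 = c * k 0 - s * k 1 := rfl
@[simp] lemma rotC_one (c s : ℝ) (k : C2) : rotC c s k 1 = s * k 0 + c * k 1 := rfl
@[simp] lemma reVec_zero (k : C2) : reVec k 0 = (k 0).re := rfl
@[simp] lemma reVec_one (k : C2) : reVec k 1 = (k 1).re := rfl
@[simp] lemma imVec_zero (k : C2) : imVec k 0 = (k 0).im := rfl
@[simp] lemma imVec_one (k : C2) : imVec k 1 = (k 1).im := rfl
@[simp] lemma perp_zero (k : C2) : perp k 0 = -k 1 := rfl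
@[simp] lemma perp_one (k : C2) : perp k 1 = k 0 := rfl

lemma R2.ext {x y : R2} (h0 : x 0 = y 0) (h1 : x 1 = y 1) : x = y := by
  ext i; fin_cases i <;> assumption

lemma C2.ext {x y : C2} (h0 : x 0 = y 0) (h1 : x 1 = y 1) : x = y := by
  ext i; fin_cases i <;> assumption

lemma R2.norm_sq (x : R2) : ‖x‖ ^ 2 = x 0 ^ 2 + x 1 ^ 2 := by
  rw [EuclideanSpace.norm_sq_eq]; simp [Fin.sum_univ_two]

lemma C2.norm_sq (k : C2) : ‖k‖ ^ 2 = ‖k 0‖ ^ 2 + ‖k 1‖ ^ 2 := by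
  rw [EuclideanSpace.norm_sq_eq]; simp [Fin.sum_univ_two]

lemma R2.inner_eq (x y : R2) : inner ℝ x y = x 0 * y 0 + x 1 * y 1 := by
  simp [PiLp.inner_apply, Fin.sum_univ_two, mul_comm]

lemma R2.ne_zero_iff {x : R2} : x ≠ 0 ↔ 0 < x 0 ^ 2 + x 1 ^ 2 := by
  rw [← R2.norm_sq, ← norm_pos_iff]
  exact ⟨fun h => by positivity, fun h => lt_of_le_of_ne (norm_nonneg x) fun e => by simp [← e] at h⟩

/-- `rotR` as an isometry. -/
noncomputable def rotEquiv {c s : ℝ} (h : c ^ 2 + s ^ 2 = 1) : R2 ≃ₗᵢ[ℝ] R2 where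
  toFun := rotR c s
  invFun := rotR c (-s)
  map_add' x y := by apply R2.ext <;> simp <;> ring
  map_smul' a x := by apply R2.ext <;> simp <;> ring
  left_inv x := by
    apply R2.ext <;> simp
    · linear_combination (x 0) * h
    · linear_combination (x 1) * h
  right_inv x := by
    apply R2.ext <;> simp
    · linear_combination (x 0) * h
    · linear_combination (x 1) * h
  norm_map' x := by
    rw [← abs_of_nonneg (norm_nonneg x), ← abs_of_nonneg (norm_nonneg (_ : R2)), ← sq_eq_sq_iff_abs_eq_abs]
    rw [R2.norm_sq, R2.norm_sq]
    simp
    linear_combination (x 0 ^ 2 + x 1 ^ 2) * h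

lemma rotEquiv_apply {c s : ℝ} (h : c ^ 2 + s ^ 2 = 1) (x : R2) : rotEquiv h x = rotR c s x := rfl

lemma norm_rotR {c s : ℝ} (h : c ^ 2 + s ^ 2 = 1) (x : R2) : ‖rotR c s x‖ = ‖x‖ :=
  (rotEquiv h).norm_map x

lemma rotR_ne_zero {c s : ℝ} (h : c ^ 2 + s ^ 2 = 1) {x : R2} (hx : x ≠ 0) : rotR c s x ≠ 0 := by
  rw [← norm_pos_iff, norm_rotR h, norm_pos_iff]; exact hx

lemma inner_rotR {c s : ℝ} (h : c ^ 2 + s ^ 2 = 1) (x y : R2) :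
    inner ℝ (rotR c s x) (rotR c s y) = inner ℝ x y := by
  simp only [R2.inner_eq, rotR_zero, rotR_one]
  linear_combination (x 0 * y 0 + x 1 * y 1) * h

lemma bdot_rot {c s : ℝ} (h : c ^ 2 + s ^ 2 = 1) (k : C2) (x : R2) :
    bdot (rotC c s k) (rotR c s x) = bdot k x := by
  have h' : (c : ℂ) ^ 2 + (s : ℂ) ^ 2 = 1 := by exact_mod_cast h
  simp only [bdot, rotC_zero, rotC_one, rotR_zero, rotR_one]
  push_cast
  linear_combination (k 0 * x 0 + k 1 * x 1) * h'

lemma imVec_rotC (c s : ℝ) (k : C2) : imVec (rotC c s k) = rotR c s (imVec k) := by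
  apply R2.ext <;> simp

lemma reVec_rotC (c s : ℝ) (k : C2) : reVec (rotC c s k) = rotR c s (reVec k) := by
  apply R2.ext <;> simp

lemma perp_rotC (c s : ℝ) (k : C2) : perp (rotC c s k) = rotC c s (perp k) := by
  apply C2.ext <;> simp <;> ring

lemma rotC_add (c s : ℝ) (k l : C2) : rotC c s (k + l) = rotC c s k + rotC c s l := by
  apply C2.ext <;> simp <;> ring

lemma rotC_smul (c s : ℝ) (a : ℂ) (k : C2) : rotC c s (a • k) = a • rotC c s k := by
  apply C2.ext <;> simp <;> ring

lemma norm_rotC {c s : ℝ} (h : c ^ 2 + s ^ 2 = 1) (k : C2) : ‖rotC c s k‖ = ‖k‖ := by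
  have e : ∀ k : C2, ‖k‖ ^ 2 = ‖reVec k‖ ^ 2 + ‖imVec k‖ ^ 2 := by
    intro k
    rw [C2.norm_sq, R2.norm_sq, R2.norm_sq, Complex.sq_norm, Complex.sq_norm, Complex.normSq_apply,
      Complex.normSq_apply]
    simp; ring
  rw [← abs_of_nonneg (norm_nonneg k), ← abs_of_nonneg (norm_nonneg (rotC c s k)),
    ← sq_eq_sq_iff_abs_eq_abs, e, e, imVec_rotC, reVec_rotC, norm_rotR h, norm_rotR h]

lemma sum_sq_rotC {c s : ℝ} (h : c ^ 2 + s ^ 2 = 1) (k : C2) :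
    rotC c s k 0 ^ 2 + rotC c s k 1 ^ 2 = k 0 ^ 2 + k 1 ^ 2 := by
  have h' : (c : ℂ) ^ 2 + (s : ℂ) ^ 2 = 1 := by exact_mod_cast h
  simp only [rotC_zero, rotC_one]
  linear_combination (k 0 ^ 2 + k 1 ^ 2) * h'

lemma greenIntegrand_rot {c s : ℝ} (h : c ^ 2 + s ^ 2 = 1) (x : R2) (k : C2) (ξ : R2) :
    greenIntegrand (rotR c s x) (rotC c s k) (rotR c s ξ) = greenIntegrand x k ξ := by
  simp only [greenIntegrand, inner_rotR h, norm_rotR h, bdot_rot h]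

lemma preimage_rot_closedBall {c s : ℝ} (h : c ^ 2 + s ^ 2 = 1) (N : ℝ) :
    (rotEquiv h) ⁻¹' Metric.closedBall (0 : R2) N = Metric.closedBall (0 : R2) N := by
  ext ξ; simp

lemma gTrunc_rot {c s : ℝ} (h : c ^ 2 + s ^ 2 = 1) (x : R2) (k : C2) (N : ℝ) :
    gTrunc (rotR c s x) (rotC c s k) N = gTrunc x k N := by
  unfold gTrunc
  congr 1
  rw [← (rotEquiv h).measurePreserving.setIntegral_preimage_emb
    (rotEquiv h).toHomeomorph.measurableEmbedding, preimage_rot_closedBall]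
  simp only [rotEquiv_apply, greenIntegrand_rot h]

lemma integrableOn_greenIntegrand_rot {c s : ℝ} (h : c ^ 2 + s ^ 2 = 1) {x : R2} {k : C2} {N : ℝ}
    (hi : IntegrableOn (greenIntegrand (rotR c s x) (rotC c s k)) (Metric.closedBall (0 : R2) N)) :
    IntegrableOn (greenIntegrand x k) (Metric.closedBall (0 : R2) N) := by
  rw [← (rotEquiv h).measurePreserving.integrableOn_comp_preimage
    (rotEquiv h).toHomeomorph.measurableEmbedding, preimage_rot_closedBall] at hi
  refine hi.congr_fun (fun ξ _ => ?_) measurableSet_closedBall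
  simp only [Function.comp, rotEquiv_apply, greenIntegrand_rot h]

lemma g_rot {c s : ℝ} (h : c ^ 2 + s ^ 2 = 1) (x : R2) (k : C2) :
    g (rotR c s x) (rotC c s k) = g x k := by
  unfold g
  rw [funext (gTrunc_rot h x k)]

/-- The reflection `k ↦ -k̄`. -/
noncomputable def negConj (k : C2) : C2 := !₂[-(starRingEnd ℂ) (k 0), -(starRingEnd ℂ) (k 1)]

@[simp] lemma negConj_zero (k : C2) : negConj k 0 = -(starRingEnd ℂ) (k 0) := rfl
@[simp] lemma negConj_one (k : C2) : negConj k 1 = -(starRingEnd ℂ) (k 1) := rfl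

lemma imVec_negConj (k : C2) : imVec (negConj k) = imVec k := by
  apply R2.ext <;> simp

/-- The substitution ξ ↦ -ξ turns the conjugate of the integrand at k into the integrand at -k̄. -/
lemma gTrunc_negConj (x : R2) (k : C2) (N : ℝ) :
    gTrunc x (negConj k) N = (starRingEnd ℂ) (gTrunc x k N) := by
  unfold gTrunc
  have hp : (LinearIsometryEquiv.neg ℝ (E := R2)) ⁻¹' Metric.closedBall (0 : R2) N =
      Metric.closedBall (0 : R2) N := by ext ξ; simp
  rw [← (LinearIsometryEquiv.neg ℝ (E := R2)).measurePreserving.setIntegral_preimage_emb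
    (LinearIsometryEquiv.neg ℝ (E := R2)).toHomeomorph.measurableEmbedding, hp, map_mul,
    ← integral_conj]
  congr 1
  · simp [map_ofNat]
  · congr 1; ext ξ
    simp only [greenIntegrand, LinearIsometryEquiv.coe_neg, bdot, map_div₀, ← Complex.exp_conj]
    simp [map_ofNat]

lemma exp_bdot_negConj (x : R2) (k : C2) : Complex.exp (Complex.I * bdot (negConj k) x) =
    (starRingEnd ℂ) (Complex.exp (Complex.I * bdot k x)) := by
  rw [← Complex.exp_conj]; simp [bdot]; congr 1; ring

/-- This rotation carries n to the positive first axis. The new coordinates are the scalar and cross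
products with n, up to the factor ‖n‖. -/
lemma exists_rot_pos (n : R2) (hn : n ≠ 0) : ∃ c s : ℝ, c ^ 2 + s ^ 2 = 1 ∧
    ∀ x : R2, ‖n‖ * rotR c s x 0 = n 0 * x 0 + n 1 * x 1 ∧
      ‖n‖ * rotR c s x 1 = n 0 * x 1 - n 1 * x 0 := by
  have h : 0 < ‖n‖ := norm_pos_iff.2 hn
  refine ⟨n 0 / ‖n‖, -(n 1) / ‖n‖, ?_, fun x => ?_⟩
  · field_simp; rw [R2.norm_sq]
  · simp only [rotR_zero, rotR_one]; constructor
    · field_simp; ring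
    · field_simp; ring

/-! ### Iterated integrals over the plane -/

/-- The coordinates `(s, t) ↦ (s, t)` of the plane. -/
noncomputable def planeEquiv : ℝ × ℝ ≃ᵐ R2 :=
  (MeasurableEquiv.finTwoArrow (α := ℝ)).symm.trans (MeasurableEquiv.toLp 2 (Fin 2 → ℝ))

lemma planeEquiv_apply (p : ℝ × ℝ) : planeEquiv p = !₂[p.1, p.2] := by
  apply R2.ext <;> rfl

lemma measurePreserving_planeEquiv : MeasurePreserving planeEquiv :=
  (volume_preserving_finTwoArrow ℝ).symm.trans (PiLp.volume_preserving_toLp (Fin 2))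

lemma integrable_comp_plane_iff {f : R2 → ℂ} :
    Integrable (fun p : ℝ × ℝ => f !₂[p.1, p.2]) ↔ Integrable f := by
  rw [← measurePreserving_planeEquiv.integrable_comp_emb planeEquiv.measurableEmbedding]
  simp only [Function.comp_def, planeEquiv_apply]

lemma integral_plane {f : R2 → ℂ} (hf : Integrable f) :
    ∫ ξ, f ξ = ∫ t : ℝ, ∫ s : ℝ, f !₂[s, t] := by
  rw [← measurePreserving_planeEquiv.integral_comp planeEquiv.measurableEmbedding]
  simp only [planeEquiv_apply]
  exact integral_prod_symm _ (integrable_comp_plane_iff.2 hf)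

lemma integrable_slice_integral {f : R2 → ℂ} (hf : Integrable f) :
    Integrable fun t : ℝ => ∫ s : ℝ, f !₂[s, t] :=
  (integrable_comp_plane_iff.2 hf).integral_prod_right

/-! ### Integrability of the Green integrand -/

/-- The singular profile `|u|^(-1/2)`, cut off to `[-1, 1]`. -/
noncomputable def invSqrtBump (u : ℝ) : ℝ := (Set.Ioc (-1 : ℝ) 1).indicator (fun u => |u| ^ (-(1 / 2) : ℝ)) u

lemma invSqrtBump_nonneg (u : ℝ) : 0 ≤ invSqrtBump u :=
  Set.indicator_nonneg (fun u _ => Real.rpow_nonneg (abs_nonneg u) _) u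

lemma intervalIntegrable_abs_rpow {a : ℝ} (ha : -1 < a) (T : ℝ) (hT : 0 ≤ T) :
    IntegrableOn (fun u : ℝ => |u| ^ a) (Set.Ioc (-T) T) := by
  have h0 : IntegrableOn (fun u : ℝ => |u| ^ a) (Set.Ioc 0 T) := by
    have := (intervalIntegral.intervalIntegrable_rpow' (a := 0) (b := T) ha).1
    refine this.congr_fun (fun u hu => ?_) measurableSet_Ioc
    simp [abs_of_pos hu.1]
  have h1 : IntegrableOn (fun u : ℝ => |u| ^ a) (Set.Ioc (-T) 0) := by
    have := ((integrableOn_Icc_iff_integrableOn_Ioc).2 h0)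
    have h2 : IntegrableOn (fun u : ℝ => |u| ^ a) (Set.Icc (-T) 0) := by
      have := this.comp_neg
      simpa using this
    exact h2.mono_set Set.Ioc_subset_Icc_self
  rw [← Set.Ioc_union_Ioc_eq_Ioc (neg_nonpos.2 hT) hT]
  exact h1.union h0

lemma integrable_invSqrtBump : Integrable invSqrtBump :=
  (integrable_indicator_iff measurableSet_Ioc).2
    (intervalIntegrable_abs_rpow (by norm_num) 1 zero_le_one)

lemma abs_rpow_le_one_add_invSqrtBump {u : ℝ} : |u| ^ (-(1 / 2) : ℝ) ≤ 1 + invSqrtBump u := by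
  by_cases h : u ∈ Set.Ioc (-1 : ℝ) 1
  · simp [invSqrtBump, Set.indicator_of_mem h]
  · have : 1 ≤ |u| := by
      rw [Set.mem_Ioc, not_and_or, not_lt, not_le] at h
      rcases h with h | h
      · rw [le_abs]; right; linarith
      · rw [le_abs]; left; linarith
    have := Real.rpow_le_one_of_one_le_of_nonpos this (by norm_num : (-(1 / 2) : ℝ) ≤ 0)
    linarith [invSqrtBump_nonneg u]

lemma abs_abs_sub_rpow_le {τ d : ℝ} :
    |(|τ| - d)| ^ (-(1 / 2) : ℝ) ≤ 2 + invSqrtBump (τ - d) + invSqrtBump (τ + d) := by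
  have a1 := abs_rpow_le_one_add_invSqrtBump (u := τ - d)
  have a2 := abs_rpow_le_one_add_invSqrtBump (u := τ + d)
  have n1 := invSqrtBump_nonneg (τ - d)
  have n2 := invSqrtBump_nonneg (τ + d)
  rcases abs_cases τ with ⟨h, _⟩ | ⟨h, _⟩
  · rw [h]; linarith
  · have : |(|τ| - d)| = |τ + d| := by rw [h, ← abs_neg]; congr 1; ring
    rw [this]; linarith

/-- For c ≥ 0 factor |τ² - c| and use |τ| + √c ≥ ||τ| - √c|. For c ≤ 0 the convention √c = 0 makes
the same formula hold, so no sign distinction is needed later. -/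
lemma quad_abs_lower (τ c : ℝ) : (|τ| - √c) ^ 2 ≤ |τ ^ 2 - c| := by
  rcases le_total 0 c with h | h
  · have hs := Real.sq_sqrt h
    have h0 := Real.sqrt_nonneg c
    have : |τ ^ 2 - c| = |(|τ| - √c)| * (|τ| + √c) := by
      rw [← abs_of_nonneg (by positivity : 0 ≤ |τ| + √c), ← abs_mul]
      congr 1
      rw [← sq_abs τ]; linear_combination hs
    rw [this, ← sq_abs, sq]
    refine mul_le_mul_of_nonneg_left ?_ (abs_nonneg _)
    rw [abs_le]; constructor <;> linarith [abs_nonneg τ]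
  · rw [Real.sqrt_eq_zero'.2 h, sub_zero, sq_abs, abs_of_nonneg (by nlinarith [sq_nonneg τ])]
    linarith

/-- Interpolation between real and imaginary part: 1/|z| = |z|^(-3/4) |z|^(-1/4). The first factor
is bounded through Im z, the second through Re z, whose quadratic zeros then cost only an exponent
-1/2. Both exponents are above -1, so each variable can be integrated. -/
lemma inv_norm_le_of_quad {z : ℂ} {τ c : ℝ} (hre : z.re = τ ^ 2 - c) (him : z.im ≠ 0)
    (h1 : τ ≠ √c) (h2 : τ ≠ -√c) :
    1 / ‖z‖ ≤ |z.im| ^ (-(3 / 4) : ℝ) * (2 + invSqrtBump (τ - √c) + invSqrtBump (τ + √c)) := by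
  have hz : 0 < ‖z‖ := norm_pos_iff.2 fun h => him (by simp [h])
  have hm : 0 < |(|τ| - √c)| := by
    rw [abs_pos, sub_ne_zero]
    rcases abs_cases τ with ⟨h, _⟩ | ⟨h, _⟩ <;> rw [h]
    · exact h1
    · intro e; exact h2 (by linarith)
  have e1 : 1 / ‖z‖ = ‖z‖ ^ (-(3 / 4) : ℝ) * ‖z‖ ^ (-(1 / 4) : ℝ) := by
    rw [← Real.rpow_add hz, one_div, ← Real.rpow_neg_one]; norm_num
  rw [e1]
  refine mul_le_mul ?_ ?_ (by positivity) (by positivity)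
  · exact Real.rpow_le_rpow_of_nonpos (abs_pos.2 him) (Complex.abs_im_le_norm z) (by norm_num)
  · refine le_trans ?_ abs_abs_sub_rpow_le
    have : |(|τ| - √c)| ^ (-(1 / 2) : ℝ) = (|(|τ| - √c)| ^ 2) ^ (-(1 / 4) : ℝ) := by
      rw [← Real.rpow_natCast, ← Real.rpow_mul hm.le]; norm_num
    rw [this]
    refine Real.rpow_le_rpow_of_nonpos (by positivity) ?_ (by norm_num)
    rw [sq_abs]
    exact (quad_abs_lower τ c).trans (by rw [← hre]; exact Complex.abs_re_le_norm z)

/-- The denominator `ξ² + 2kξ` in coordinates. -/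
noncomputable def symb (k : C2) (s t : ℝ) : ℂ := (s : ℂ) ^ 2 + (t : ℂ) ^ 2 + 2 * (k 0 * s + k 1 * t)

lemma symb_eq (k : C2) (ξ : R2) :
    (((‖ξ‖ ^ 2 : ℝ) : ℂ) + 2 * bdot k ξ) = symb k (ξ 0) (ξ 1) := by
  rw [R2.norm_sq]; simp only [symb, bdot]; push_cast; ring

lemma continuous_symb (k : C2) : Continuous fun p : ℝ × ℝ => symb k p.1 p.2 := by
  unfold symb; fun_prop

lemma symb_re (k : C2) (s t : ℝ) :
    (symb k s t).re = s ^ 2 + t ^ 2 + 2 * ((k 0).re * s + (k 1).re * t) := by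
  simp [symb, sq]

lemma symb_im (k : C2) (s t : ℝ) : (symb k s t).im = 2 * ((k 0).im * s + (k 1).im * t) := by
  simp [symb, sq]

/-- With Im k along the first axis, the imaginary part of the denominator is 2 (Im k₁) s,
independent of t, and for fixed s its real part is quadratic in t. The interpolated bound gives a
t-integral of order |s|^(-3/4), uniformly in the position of the zeros, and Tonelli applies. -/
lemma integrableOn_inv_symb_rect {k : C2} (h0 : (k 0).im ≠ 0) (h1 : (k 1).im = 0) {T : ℝ}
    (hT : 0 ≤ T) :
    Integrable (fun p : ℝ × ℝ => 1 / symb k p.1 p.2)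
      ((volume.restrict (Set.Ioc (-T) T)).prod (volume.restrict (Set.Ioc (-T) T))) := by
  have him : ∀ s t : ℝ, (symb k s t).im = 2 * (k 0).im * s := by
    intro s t; rw [symb_im, h1]; ring
  have hne : ∀ s t : ℝ, s ≠ 0 → (symb k s t).im ≠ 0 := by
    intro s t hs; rw [him]; exact mul_ne_zero (mul_ne_zero two_ne_zero h0) hs
  have hae : ∀ᵐ s : ℝ ∂(volume.restrict (Set.Ioc (-T) T)), s ≠ 0 :=
    ae_restrict_of_ae (by simp [ae_iff])
  have hcont : ∀ s : ℝ, s ≠ 0 → Continuous fun t : ℝ => 1 / symb k s t := by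
    intro s hs
    refine continuous_const.div (by unfold symb; fun_prop) fun t h => hne s t hs (by simp [h])
  have hint : ∀ s : ℝ, s ≠ 0 → IntegrableOn (fun t : ℝ => 1 / symb k s t) (Set.Ioc (-T) T) :=
    fun s hs => ((hcont s hs).continuousOn.integrableOn_Icc).mono_set Set.Ioc_subset_Icc_self
  rw [integrable_prod_iff]
  · refine ⟨?_, ?_⟩
    · filter_upwards [hae] with s hs
      exact hint s hs
    · set M := ∫ u, invSqrtBump u
      have hM : Integrable (fun s : ℝ => |2 * (k 0).im| ^ (-(3 / 4) : ℝ) * (4 * T + M + M) *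
          |s| ^ (-(3 / 4) : ℝ)) (volume.restrict (Set.Ioc (-T) T)) :=
        (intervalIntegrable_abs_rpow (by norm_num) T hT).const_mul _
      refine hM.mono' ?_ ?_
      · refine AEStronglyMeasurable.norm ?_ |>.integral_prod_right'
          (μ := volume.restrict (Set.Ioc (-T) T)) (f := fun p : ℝ × ℝ => ‖1 / symb k p.1 p.2‖)
        exact (Measurable.div measurable_const (continuous_symb k).measurable).aestronglyMeasurable
      · filter_upwards [hae] with s hs
        rw [Real.norm_of_nonneg (integral_nonneg fun t => norm_nonneg _)]
        -- Completing the square: the real part is (t + Re k₂)² - c.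
        set c : ℝ := (k 1).re ^ 2 - s ^ 2 - 2 * (k 0).re * s with hc
        have b1 : Integrable fun t : ℝ => invSqrtBump (t + (k 1).re - √c) := by
          have := integrable_invSqrtBump.comp_add_right ((k 1).re - √c)
          simpa [add_sub_assoc] using this
        have b2 : Integrable fun t : ℝ => invSqrtBump (t + (k 1).re + √c) := by
          have := integrable_invSqrtBump.comp_add_right ((k 1).re + √c)
          simpa [add_assoc] using this
        have e1 : ∫ t : ℝ, invSqrtBump (t + (k 1).re - √c) = M := by
          have := integral_add_right_eq_self (μ := volume) invSqrtBump ((k 1).re - √c)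
          simpa [add_sub_assoc] using this
        have e2 : ∫ t : ℝ, invSqrtBump (t + (k 1).re + √c) = M := by
          have := integral_add_right_eq_self (μ := volume) invSqrtBump ((k 1).re + √c)
          simpa [add_assoc] using this
        have hb : Integrable (fun t : ℝ => |2 * (k 0).im * s| ^ (-(3 / 4) : ℝ) *
            (2 + invSqrtBump (t + (k 1).re - √c) + invSqrtBump (t + (k 1).re + √c)))
            (volume.restrict (Set.Ioc (-T) T)) :=
          (((integrable_const _).add b1.restrict).add b2.restrict).const_mul _
        calc ∫ t in Set.Ioc (-T) T, ‖1 / symb k s t‖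
            ≤ ∫ t in Set.Ioc (-T) T, |2 * (k 0).im * s| ^ (-(3 / 4) : ℝ) *
              (2 + invSqrtBump (t + (k 1).re - √c) + invSqrtBump (t + (k 1).re + √c)) := by
              refine integral_mono_ae (hint s hs).norm hb (ae_restrict_of_ae ?_)
              have n1 : ∀ᵐ t : ℝ, t ≠ √c - (k 1).re := by simp [ae_iff]
              have n2 : ∀ᵐ t : ℝ, t ≠ -√c - (k 1).re := by simp [ae_iff]
              filter_upwards [n1, n2] with t ht1 ht2
              rw [norm_div, norm_one, ← him s t]
              refine inv_norm_le_of_quad (τ := t + (k 1).re) ?_ (hne s t hs) ?_ ?_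
              · rw [symb_re, hc]; ring
              · intro h; apply ht1; linarith
              · intro h; apply ht2; linarith
          _ = |2 * (k 0).im * s| ^ (-(3 / 4) : ℝ) * (4 * T +
              (∫ t in Set.Ioc (-T) T, invSqrtBump (t + (k 1).re - √c)) +
              ∫ t in Set.Ioc (-T) T, invSqrtBump (t + (k 1).re + √c)) := by
              have hc1 : Integrable (fun t : ℝ => (2 : ℝ) + invSqrtBump (t + (k 1).re - √c))
                  (volume.restrict (Set.Ioc (-T) T)) := (integrable_const _).add b1.restrict
              rw [integral_const_mul, integral_add hc1 b2.restrict,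
                integral_add (integrable_const _) b1.restrict]
              congr 3
              simp
              rw [max_eq_left (by linarith)]; ring
          _ ≤ |2 * (k 0).im * s| ^ (-(3 / 4) : ℝ) * (4 * T + M + M) := by
              refine mul_le_mul_of_nonneg_left ?_ (by positivity)
              have i1 := setIntegral_le_integral (s := Set.Ioc (-T) T) b1
                (ae_of_all _ fun t => invSqrtBump_nonneg _)
              have i2 := setIntegral_le_integral (s := Set.Ioc (-T) T) b2
                (ae_of_all _ fun t => invSqrtBump_nonneg _)
              rw [e1] at i1; rw [e2] at i2
              linarith
          _ = _ := by
              rw [abs_mul, Real.mul_rpow (abs_nonneg _) (abs_nonneg _)]; ring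
  · exact (Measurable.div measurable_const (continuous_symb k).measurable).aestronglyMeasurable

lemma greenIntegrand_eq (x : R2) (k : C2) (ξ : R2) : greenIntegrand x k ξ =
    Complex.exp (Complex.I * ((inner ℝ ξ x : ℝ) : ℂ)) / symb k (ξ 0) (ξ 1) := by
  rw [greenIntegrand, symb_eq]

lemma measurable_greenIntegrand (x : R2) (k : C2) : Measurable (greenIntegrand x k) := by
  unfold greenIntegrand bdot
  exact Measurable.div (Continuous.measurable (by fun_prop)) (Continuous.measurable (by fun_prop))

lemma integrableOn_greenIntegrand (x : R2) {k : C2} (hk : imVec k ≠ 0) (N : ℝ) :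
    IntegrableOn (greenIntegrand x k) (Metric.closedBall (0 : R2) N) := by
  obtain ⟨c, s, hcs, hrot⟩ := exists_rot_pos (imVec k) hk
  have hn := norm_pos_iff.2 hk
  refine integrableOn_greenIntegrand_rot hcs ?_
  set k' := rotC c s k
  set x' := rotR c s x
  have him : imVec k' = rotR c s (imVec k) := imVec_rotC c s k
  have h1 : (k' 1).im = 0 := by
    have := (hrot (imVec k)).2
    rw [← him, imVec_one] at this
    have h2 : ‖imVec k‖ * (k' 1).im = 0 := by rw [this]; ring
    exact (mul_eq_zero.1 h2).resolve_left hn.ne'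
  have h0 : (k' 0).im ≠ 0 := by
    have := (hrot (imVec k)).1
    rw [← him, imVec_zero, ← sq, ← sq, ← R2.norm_sq] at this
    intro h; rw [h] at this; nlinarith
  -- The margin 1 puts the ball inside a square that is open on its lower sides; the absolute value
  -- covers negative N.
  set T := |N| + 1
  rw [← measurePreserving_planeEquiv.integrableOn_comp_preimage planeEquiv.measurableEmbedding]
  have hsub : planeEquiv ⁻¹' Metric.closedBall (0 : R2) N ⊆
      Set.Ioc (-T) T ×ˢ Set.Ioc (-T) T := by
    intro p hp
    rw [Set.mem_preimage, mem_closedBall_zero_iff, planeEquiv_apply] at hp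
    have h := R2.norm_sq !₂[p.1, p.2]
    simp at h
    have hle : ‖!₂[p.1, p.2]‖ ≤ |N| := hp.trans (le_abs_self N)
    have h2 : ‖!₂[p.1, p.2]‖ ^ 2 ≤ |N| ^ 2 := by gcongr
    have a1 := abs_le_of_sq_le_sq' (by nlinarith [sq_nonneg p.2] : p.1 ^ 2 ≤ |N| ^ 2) (abs_nonneg N)
    have a2 := abs_le_of_sq_le_sq' (by nlinarith [sq_nonneg p.1] : p.2 ^ 2 ≤ |N| ^ 2) (abs_nonneg N)
    refine ⟨⟨?_, ?_⟩, ⟨?_, ?_⟩⟩ <;> simp only [T] <;> linarith [a1.1, a1.2, a2.1, a2.2]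
  refine IntegrableOn.mono_set ?_ hsub
  rw [IntegrableOn, Measure.volume_eq_prod, ← Measure.prod_restrict]
  refine ((integrableOn_inv_symb_rect h0 h1 (by positivity : 0 ≤ T)).norm).mono' ?_
    (ae_of_all _ fun p => ?_)
  · exact ((measurable_greenIntegrand x' k').comp planeEquiv.measurable).aestronglyMeasurable
  · rw [Function.comp, greenIntegrand_eq, norm_div, Complex.norm_exp_I_mul_ofReal,
      planeEquiv_apply, norm_div, norm_one]
    simp

/-- The comparison integrand `exp(iξx)/(1+ξ²)`. -/
noncomputable def refIntegrand (x : R2) (ξ : R2) : ℂ :=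
  Complex.exp (Complex.I * ((inner ℝ ξ x : ℝ) : ℂ)) / ((1 + ‖ξ‖ ^ 2 : ℝ) : ℂ)

lemma continuous_refIntegrand (x : R2) : Continuous (refIntegrand x) := by
  unfold refIntegrand
  refine Continuous.div (by fun_prop) (by fun_prop) fun ξ => ?_
  exact_mod_cast (by positivity : (1 + ‖ξ‖ ^ 2 : ℝ) ≠ 0)

lemma norm_bdot_le (k : C2) (ξ : R2) : ‖bdot k ξ‖ ≤ 2 * ‖k‖ * ‖ξ‖ := by
  unfold bdot
  have h0 := PiLp.norm_apply_le k 0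
  have h1 := PiLp.norm_apply_le k 1
  have g0 := PiLp.norm_apply_le ξ 0
  have g1 := PiLp.norm_apply_le ξ 1
  refine (norm_add_le _ _).trans ?_
  rw [norm_mul, norm_mul, Complex.norm_real, Complex.norm_real]
  have := mul_le_mul h0 g0 (norm_nonneg _) (norm_nonneg _)
  have := mul_le_mul h1 g1 (norm_nonneg _) (norm_nonneg _)
  linarith

/-- The leading terms ξ² cancel, leaving 1 - 2kξ over a denominator of order |ξ|⁴; the resulting
|ξ|^(-3) is integrable at infinity in the plane. Beyond 1 + 8‖k‖ the term 2kξ is at most half of ξ²,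
so the denominator is at least ξ²/2. -/
lemma norm_greenIntegrand_sub_ref_le (x : R2) (k : C2) {ξ : R2} (hξ : 1 + 8 * ‖k‖ ≤ ‖ξ‖) :
    ‖greenIntegrand x k ξ - refIntegrand x ξ‖ ≤ 16 * (1 + 4 * ‖k‖) * (1 + ‖ξ‖) ^ (-3 : ℝ) := by
  set n := ‖ξ‖
  set K := ‖k‖
  have hK : 0 ≤ K := norm_nonneg k
  have hn : 1 ≤ n := by linarith
  set B := bdot k ξ
  have hB : ‖B‖ ≤ 2 * K * n := norm_bdot_le k ξ
  set P : ℂ := ((n ^ 2 : ℝ) : ℂ) + 2 * B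
  have hP : n ^ 2 / 2 ≤ ‖P‖ := by
    have h1 : ‖((n ^ 2 : ℝ) : ℂ)‖ - ‖-(2 * B)‖ ≤ ‖P‖ := by
      have := norm_sub_norm_le ((n ^ 2 : ℝ) : ℂ) (-(2 * B))
      simpa [P] using this
    rw [norm_neg, norm_mul, Complex.norm_real, Real.norm_of_nonneg (sq_nonneg n)] at h1
    have : ‖(2 : ℂ)‖ = 2 := by simp
    rw [this] at h1
    nlinarith
  have hPpos : 0 < ‖P‖ := by nlinarith
  have hP0 : P ≠ 0 := norm_pos_iff.1 hPpos
  have hR0 : ((1 + n ^ 2 : ℝ) : ℂ) ≠ 0 := by exact_mod_cast (by positivity : (1 + n ^ 2 : ℝ) ≠ 0)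
  have e : greenIntegrand x k ξ - refIntegrand x ξ =
      Complex.exp (Complex.I * ((inner ℝ ξ x : ℝ) : ℂ)) *
        ((1 - 2 * B) / (P * ((1 + n ^ 2 : ℝ) : ℂ))) := by
    unfold greenIntegrand refIntegrand
    change _ / P - _ / ((1 + n ^ 2 : ℝ) : ℂ) = _
    field_simp
    simp only [P]; push_cast; ring
  rw [e, norm_mul, Complex.norm_exp_I_mul_ofReal, one_mul, norm_div, norm_mul, Complex.norm_real,
    Real.norm_of_nonneg (by positivity : (0 : ℝ) ≤ 1 + n ^ 2)]
  have h3 : (1 + n) ^ (-3 : ℝ) = 1 / (1 + n) ^ 3 := by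
    rw [Real.rpow_neg (by positivity), one_div]; norm_cast
  rw [h3, mul_one_div, div_le_div_iff₀ (by positivity) (by positivity)]
  have hnum : ‖1 - 2 * B‖ ≤ (1 + 4 * K) * n := by
    refine (norm_sub_le _ _).trans ?_
    rw [norm_one, norm_mul]
    have : ‖(2 : ℂ)‖ = 2 := by simp
    rw [this]; nlinarith
  have h8 : (1 + n) ^ 3 ≤ 8 * n ^ 3 := by
    have : (1 + n) ^ 3 ≤ (2 * n) ^ 3 := by gcongr; linarith
    nlinarith
  calc ‖1 - 2 * B‖ * (1 + n) ^ 3 ≤ ((1 + 4 * K) * n) * (8 * n ^ 3) := by gcongr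
    _ = 16 * (1 + 4 * K) * (n ^ 2 / 2 * n ^ 2) := by ring
    _ ≤ 16 * (1 + 4 * K) * (‖P‖ * (1 + n ^ 2)) := by
      gcongr
      linarith

lemma integrable_greenIntegrand_sub_ref (x : R2) {k : C2} (hk : imVec k ≠ 0) :
    Integrable fun ξ => greenIntegrand x k ξ - refIntegrand x ξ := by
  set R := 1 + 8 * ‖k‖
  rw [← integrableOn_univ, ← Set.union_compl_self (Metric.closedBall (0 : R2) R)]
  refine IntegrableOn.union ?_ ?_
  · exact (integrableOn_greenIntegrand x hk R).sub
      ((continuous_refIntegrand x).continuousOn.integrableOn_compact (isCompact_closedBall _ _))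
  · have h3 : Integrable fun ξ : R2 => 16 * (1 + 4 * ‖k‖) * (1 + ‖ξ‖) ^ (-3 : ℝ) :=
      (integrable_one_add_norm (by simp; norm_num)).const_mul _
    refine h3.integrableOn.mono' ?_ ?_
    · exact ((measurable_greenIntegrand x k).sub
        (continuous_refIntegrand x).measurable).aestronglyMeasurable
    · refine (ae_restrict_iff' measurableSet_closedBall.compl).2 (ae_of_all _ fun ξ hξ => ?_)
      refine norm_greenIntegrand_sub_ref_le x k ?_
      rw [Set.mem_compl_iff, mem_closedBall_zero_iff, not_le] at hξ
      exact hξ.le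

/-- Integrate by parts against the phase. Since 1/(a+s²) decreases, its variation and its boundary
values together contribute at most twice its value 1/a at 0. The bound is uniform in L, and with a =
1 + t² it is integrable in t. -/
lemma norm_integral_exp_div_le {a : ℝ} (ha : 0 < a) {r : ℝ} (hr : r ≠ 0) {L : ℝ} (hL : 0 ≤ L) :
    ‖∫ s in (0 : ℝ)..L, Complex.exp (Complex.I * ((s * r : ℝ) : ℂ)) / ((a + s ^ 2 : ℝ) : ℂ)‖
      ≤ 2 / (|r| * a) := by
  have hrC : (r : ℂ) ≠ 0 := by exact_mod_cast hr
  have hpos : ∀ s : ℝ, 0 < a + s ^ 2 := fun s => by positivity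
  set u : ℝ → ℝ := fun s => 1 / (a + s ^ 2) with hu
  set u' : ℝ → ℝ := fun s => -(2 * s) / (a + s ^ 2) ^ 2 with hu'
  set v : ℝ → ℂ := fun s => Complex.exp (Complex.I * ((s * r : ℝ) : ℂ)) / (Complex.I * r)
  have du : ∀ s, HasDerivAt u (u' s) s := by
    intro s
    have h1 : HasDerivAt (fun s : ℝ => a + s ^ 2) (2 * s) s := by
      simpa using (hasDerivAt_pow 2 s).const_add a
    have := (hasDerivAt_const s (1 : ℝ)).div h1 (hpos s).ne'
    refine this.congr_deriv ?_
    simp [hu']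
  have dv : ∀ s, HasDerivAt v (Complex.exp (Complex.I * ((s * r : ℝ) : ℂ))) s := by
    intro s
    have h1 : HasDerivAt (fun s : ℝ => Complex.I * ((s * r : ℝ) : ℂ)) (Complex.I * r) s := by
      have := ((hasDerivAt_mul_const (x := s) r).ofReal_comp).const_mul Complex.I
      simpa using this
    have := h1.cexp.div_const (Complex.I * r)
    refine this.congr_deriv ?_
    field_simp
  have cu' : Continuous u' := by
    refine Continuous.div (by fun_prop) (by fun_prop) fun s => ?_
    exact pow_ne_zero 2 (hpos s).ne'
  have nv : ∀ s, ‖v s‖ = 1 / |r| := by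
    intro s
    simp only [v]
    rw [norm_div, Complex.norm_exp_I_mul_ofReal, norm_mul, Complex.norm_I, Complex.norm_real,
      one_mul, Real.norm_eq_abs]
  have ibp := intervalIntegral.integral_mul_deriv_eq_deriv_mul (a := 0) (b := L)
    (u := fun s => (u s : ℂ)) (v := v) (u' := fun s => (u' s : ℂ))
    (fun s _ => (du s).ofReal_comp) (fun s _ => dv s)
    (Continuous.intervalIntegrable (by fun_prop) _ _)
    (Continuous.intervalIntegrable (by fun_prop) _ _)
  have e : (∫ s in (0 : ℝ)..L, Complex.exp (Complex.I * ((s * r : ℝ) : ℂ)) /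
      ((a + s ^ 2 : ℝ) : ℂ)) =
      ∫ s in (0 : ℝ)..L, (u s : ℂ) * Complex.exp (Complex.I * ((s * r : ℝ) : ℂ)) := by
    congr 1; ext s; simp only [u]; push_cast; ring
  rw [e, ibp]
  have hr' : 0 < |r| := abs_pos.2 hr
  have hup : ∀ s, 0 < u s := fun s => one_div_pos.2 (hpos s)
  have b1 : ‖(u L : ℂ) * v L - (u 0 : ℂ) * v 0‖ ≤ (u L + u 0) / |r| := by
    refine (norm_sub_le _ _).trans (le_of_eq ?_)
    rw [norm_mul, norm_mul, nv, nv, Complex.norm_real, Complex.norm_real,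
      Real.norm_of_nonneg (hup _).le, Real.norm_of_nonneg (hup _).le]; ring
  have b2 : ‖∫ s in (0 : ℝ)..L, (u' s : ℂ) * v s‖ ≤ (u 0 - u L) / |r| := by
    have h1 : ‖∫ s in (0 : ℝ)..L, (u' s : ℂ) * v s‖ ≤ ∫ s in (0 : ℝ)..L, -u' s * (1 / |r|) := by
      refine intervalIntegral.norm_integral_le_of_norm_le hL (ae_of_all _ fun s hs => ?_)
        (Continuous.intervalIntegrable (by fun_prop) _ _)
      rw [norm_mul, nv, Complex.norm_real, Real.norm_of_nonpos]
      exact div_nonpos_of_nonpos_of_nonneg (by linarith [hs.1]) (sq_nonneg _)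
    refine h1.trans (le_of_eq ?_)
    rw [intervalIntegral.integral_mul_const, intervalIntegral.integral_neg,
      intervalIntegral.integral_eq_sub_of_hasDerivAt (fun s _ => du s)
        (cu'.intervalIntegrable _ _)]
    ring
  refine (norm_sub_le _ _).trans ((add_le_add b1 b2).trans (le_of_eq ?_))
  have : u 0 = 1 / a := by simp [u]
  rw [← add_div, this]; field_simp; ring

lemma norm_integral_Icc_exp_div_le {a : ℝ} (ha : 0 < a) {r : ℝ} (hr : r ≠ 0) {L : ℝ}
    (hL : 0 ≤ L) :
    ‖∫ s in Set.Icc (-L) L, Complex.exp (Complex.I * ((s * r : ℝ) : ℂ)) / ((a + s ^ 2 : ℝ) : ℂ)‖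
      ≤ 4 / (|r| * a) := by
  rw [integral_Icc_eq_integral_Ioc, ← intervalIntegral.integral_of_le (by linarith)]
  have hc : ∀ r : ℝ, Continuous fun s : ℝ =>
      Complex.exp (Complex.I * ((s * r : ℝ) : ℂ)) / ((a + s ^ 2 : ℝ) : ℂ) := by
    intro r
    refine Continuous.div (by fun_prop) (by fun_prop) fun s => ?_
    exact_mod_cast (by positivity : a + s ^ 2 ≠ 0)
  rw [← intervalIntegral.integral_add_adjacent_intervals (b := 0)
    ((hc r).intervalIntegrable _ _) ((hc r).intervalIntegrable _ _)]
  have e : (∫ s in (-L)..0, Complex.exp (Complex.I * ((s * r : ℝ) : ℂ)) / ((a + s ^ 2 : ℝ) : ℂ)) =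
      ∫ s in (0 : ℝ)..L, Complex.exp (Complex.I * ((s * (-r) : ℝ) : ℂ)) /
        ((a + s ^ 2 : ℝ) : ℂ) := by
    have := intervalIntegral.integral_comp_neg (a := 0) (b := L) (fun s : ℝ =>
      Complex.exp (Complex.I * ((s * r : ℝ) : ℂ)) / ((a + s ^ 2 : ℝ) : ℂ))
    rw [neg_zero] at this
    rw [← this]; congr 1; ext s; simp
  rw [e]
  have h1 := norm_integral_exp_div_le ha (neg_ne_zero.2 hr) hL
  have h2 := norm_integral_exp_div_le ha hr hL
  rw [abs_neg] at h1
  refine (norm_add_le _ _).trans ((add_le_add h1 h2).trans (le_of_eq ?_))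
  ring

lemma refIntegrand_coord (x : R2) (s t : ℝ) : refIntegrand x !₂[s, t] =
    Complex.exp (Complex.I * ((t * x 1 : ℝ) : ℂ)) *
      (Complex.exp (Complex.I * ((s * x 0 : ℝ) : ℂ)) / ((1 + t ^ 2 + s ^ 2 : ℝ) : ℂ)) := by
  unfold refIntegrand
  rw [R2.inner_eq, R2.norm_sq, mul_div_assoc', ← Complex.exp_add]
  simp only [Matrix.cons_val_zero, Matrix.cons_val_one]
  congr 2
  · push_cast; ring
  · ring

lemma norm_refIntegrand_coord (x : R2) (s t : ℝ) :
    ‖refIntegrand x !₂[s, t]‖ = 1 / (1 + t ^ 2 + s ^ 2) := by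
  rw [refIntegrand_coord, norm_mul, Complex.norm_exp_I_mul_ofReal, norm_div,
    Complex.norm_exp_I_mul_ofReal, Complex.norm_real, Real.norm_of_nonneg (by positivity), one_mul]

lemma integrable_refIntegrand_slice (x : R2) (t : ℝ) :
    Integrable fun s : ℝ => refIntegrand x !₂[s, t] := by
  refine integrable_inv_one_add_sq.mono' (Continuous.aestronglyMeasurable ?_)
    (ae_of_all _ fun s => ?_)
  · exact (continuous_refIntegrand x).comp (by fun_prop)
  · rw [norm_refIntegrand_coord, ← one_div]
    gcongr; nlinarith [sq_nonneg t]

lemma mem_closedBall_coord {N : ℝ} (hN : 0 ≤ N) (s t : ℝ) :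
    (!₂[s, t] : R2) ∈ Metric.closedBall (0 : R2) N ↔ s ^ 2 + t ^ 2 ≤ N ^ 2 := by
  rw [mem_closedBall_zero_iff, ← abs_of_nonneg (norm_nonneg (!₂[s, t] : R2)), ← abs_of_nonneg hN,
    ← sq_le_sq, R2.norm_sq, abs_of_nonneg hN]
  simp

/-- The comparison integral converges over growing discs. -/
lemma tendsto_integral_ref {x : R2} (hx : 0 < x 0) :
    (Integrable fun t : ℝ => ∫ s : ℝ, refIntegrand x !₂[s, t]) ∧
    Tendsto (fun N : ℝ => ∫ ξ in Metric.closedBall (0 : R2) N, refIntegrand x ξ) atTop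
      (𝓝 (∫ t : ℝ, ∫ s : ℝ, refIntegrand x !₂[s, t])) := by
  set F : ℝ → R2 → ℂ := fun N => (Metric.closedBall (0 : R2) N).indicator (refIntegrand x) with hF
  have hFi : ∀ N, Integrable (F N) := fun N =>
    (integrable_indicator_iff measurableSet_closedBall).2
      ((continuous_refIntegrand x).continuousOn.integrableOn_compact (isCompact_closedBall _ _))
  have hlim : ∀ t : ℝ, Tendsto (fun N => ∫ s : ℝ, F N !₂[s, t]) atTop
      (𝓝 (∫ s : ℝ, refIntegrand x !₂[s, t])) := by
    intro t
    refine tendsto_integral_filter_of_dominated_convergence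
      (fun s => ‖refIntegrand x !₂[s, t]‖) ?_ ?_ (integrable_refIntegrand_slice x t).norm ?_
    · refine Eventually.of_forall fun N => ?_
      have : Measurable (F N) :=
        (continuous_refIntegrand x).measurable.indicator measurableSet_closedBall
      exact (this.comp (Continuous.measurable (f := fun s : ℝ => (!₂[s, t] : R2))
        (by fun_prop))).aestronglyMeasurable
    · exact Eventually.of_forall fun N => ae_of_all _ fun s => norm_indicator_le_norm_self _ _
    · refine ae_of_all _ fun s => tendsto_const_nhds.congr' ?_
      filter_upwards [eventually_ge_atTop ‖(!₂[s, t] : R2)‖] with N hN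
      rw [hF]; simp only
      rw [Set.indicator_of_mem (mem_closedBall_zero_iff.2 hN)]
  -- Each horizontal line meets the disc in a symmetric chord. The oscillatory bound there does not
  -- depend on N, so dominated convergence works in t although the integrand is not absolutely
  -- integrable in the plane.
  have hbound : ∀ N : ℝ, 0 ≤ N → ∀ t : ℝ,
      ‖∫ s : ℝ, F N !₂[s, t]‖ ≤ 4 / x 0 * (1 + t ^ 2)⁻¹ := by
    intro N hN t
    by_cases ht : t ^ 2 ≤ N ^ 2
    · have hL := Real.sqrt_nonneg (N ^ 2 - t ^ 2)
      have hsq := Real.sq_sqrt (sub_nonneg.2 ht)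
      have e : (fun s : ℝ => F N !₂[s, t]) =
          (Set.Icc (-√(N ^ 2 - t ^ 2)) √(N ^ 2 - t ^ 2)).indicator
            (fun s => refIntegrand x !₂[s, t]) := by
        ext s
        simp only [hF, Set.indicator, mem_closedBall_coord hN]
        refine if_congr ?_ rfl rfl
        rw [Set.mem_Icc, ← abs_le, ← abs_of_nonneg hL, ← sq_le_sq, hsq]
        constructor <;> intro h <;> linarith
      rw [e, integral_indicator measurableSet_Icc]
      simp only [refIntegrand_coord]
      rw [integral_const_mul, norm_mul, Complex.norm_exp_I_mul_ofReal, one_mul]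
      refine (norm_integral_Icc_exp_div_le (by positivity : 0 < 1 + t ^ 2) hx.ne' hL).trans
        (le_of_eq ?_)
      rw [abs_of_pos hx]; field_simp
    · have e : (fun s : ℝ => F N !₂[s, t]) = fun _ => 0 := by
        ext s
        simp only [hF, Set.indicator, mem_closedBall_coord hN]
        rw [if_neg]; nlinarith [sq_nonneg s]
      rw [e]; simp; positivity
  have hmeas : ∀ N, AEStronglyMeasurable (fun t : ℝ => ∫ s : ℝ, F N !₂[s, t]) := fun N =>
    (integrable_slice_integral (hFi N)).aestronglyMeasurable
  have hbi : Integrable fun t : ℝ => 4 / x 0 * (1 + t ^ 2)⁻¹ :=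
    integrable_inv_one_add_sq.const_mul _
  refine ⟨hbi.mono' (aestronglyMeasurable_of_tendsto_ae atTop hmeas (ae_of_all _ hlim))
    (ae_of_all _ fun t => ?_), ?_⟩
  · refine le_of_tendsto (hlim t).norm ?_
    filter_upwards [eventually_ge_atTop 0] with N hN using hbound N hN t
  · have e : ∀ N, ∫ ξ in Metric.closedBall (0 : R2) N, refIntegrand x ξ =
        ∫ t : ℝ, ∫ s : ℝ, F N !₂[s, t] := by
      intro N
      rw [← integral_plane (hFi N), hF]; simp only
      rw [integral_indicator measurableSet_closedBall]
    simp_rw [e]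
    refine tendsto_integral_filter_of_dominated_convergence _ (Eventually.of_forall hmeas) ?_ hbi
      (ae_of_all _ hlim)
    filter_upwards [eventually_ge_atTop 0] with N hN
    exact ae_of_all _ (hbound N hN)

/-- The Green function as an iterated integral. -/
lemma tendsto_gTrunc_slices {x : R2} (hx : 0 < x 0) {k : C2} (hk : imVec k ≠ 0)
    (hs : ∀ᵐ t : ℝ, Integrable fun s : ℝ => greenIntegrand x k !₂[s, t]) :
    (Integrable fun t : ℝ => ∫ s : ℝ, greenIntegrand x k !₂[s, t]) ∧
    Tendsto (gTrunc x k) atTop (𝓝 (-(1 / (2 * (Real.pi : ℂ))) ^ 2 *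
      ∫ t : ℝ, ∫ s : ℝ, greenIntegrand x k !₂[s, t])) := by
  obtain ⟨h1, h2⟩ := tendsto_integral_ref hx
  have hD := integrable_greenIntegrand_sub_ref x hk
  have h3 := integrable_slice_integral hD
  have hae : (fun t : ℝ => (∫ s : ℝ, (greenIntegrand x k !₂[s, t] - refIntegrand x !₂[s, t])) +
      ∫ s : ℝ, refIntegrand x !₂[s, t]) =ᵐ[volume]
      fun t : ℝ => ∫ s : ℝ, greenIntegrand x k !₂[s, t] := by
    filter_upwards [hs] with t ht
    rw [integral_sub ht (integrable_refIntegrand_slice x t)]; ring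
  refine ⟨(h3.add h1).congr hae, ?_⟩
  unfold gTrunc
  refine Tendsto.const_mul _ ?_
  rw [← integral_congr_ae hae, integral_add h3 h1, ← integral_plane hD]
  have h4 : Tendsto (fun N : ℝ => ∫ ξ in Metric.closedBall (0 : R2) N,
      (greenIntegrand x k ξ - refIntegrand x ξ)) atTop
      (𝓝 (∫ ξ, (greenIntegrand x k ξ - refIntegrand x ξ))) := by
    rw [← setIntegral_univ]
    have hu : (⋃ N : ℝ, Metric.closedBall (0 : R2) N) = Set.univ := by
      ext ξ; simp only [Set.mem_iUnion, mem_closedBall_zero_iff, Set.mem_univ, iff_true]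
      exact ⟨_, le_rfl⟩
    rw [← hu]
    exact tendsto_setIntegral_of_monotone (fun N => measurableSet_closedBall)
      (fun a b hab => Metric.closedBall_subset_closedBall hab) hD.integrableOn
  refine (h4.add h2).congr fun N => ?_
  rw [integral_sub (integrableOn_greenIntegrand x hk N)
    ((continuous_refIntegrand x).continuousOn.integrableOn_compact (isCompact_closedBall _ _))]
  ring

/-! ### The contour representation of the Green function -/

/-- `t² + 2k₂t - k₁²`: the poles of `1/(ξ² + 2kξ)` on the line `ξ₂ = t` are `-k₁ ± i√W(t)`. -/
noncomputable def poleSq (k : C2) (t : ℝ) : ℂ := (t : ℂ) ^ 2 + 2 * k 1 * t - k 0 ^ 2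

/-- The contribution of the pole `-k₁ + iS`, present when it lies in the upper half-plane. -/
noncomputable def poleTerm (r q : ℝ) (S : ℂ) : ℂ := if q < S.re then Complex.exp (-(r * S)) / S else 0

/-- The joint contribution of the poles `-k₁ ± iS`. -/
noncomputable def pairTerm (r q : ℝ) (S : ℂ) : ℂ := poleTerm r q S + poleTerm r q (-S)

/-- The pair is symmetric in ±S, so any branch of the square root may be used. Continuity arguments
exploit this by choosing a branch that is continuous near the point at hand. -/
lemma pairTerm_congr (r q : ℝ) {S T : ℂ} (h : S ^ 2 = T ^ 2) : pairTerm r q S = pairTerm r q T := by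
  rcases sq_eq_sq_iff_eq_or_eq_neg.1 h with rfl | rfl
  · rfl
  · simp [pairTerm, add_comm]

lemma csqrt_sq (z : ℂ) : Complex.sqrt z ^ 2 = z := by
  rw [Complex.sqrt]; exact_mod_cast Complex.cpow_nat_inv_pow z two_ne_zero

lemma csqrt_re_nonneg (z : ℂ) : 0 ≤ (Complex.sqrt z).re := by
  rw [Complex.sqrt, Complex.cpow_inv_two_re]; positivity

lemma csqrt_re (z : ℂ) : (Complex.sqrt z).re = √((‖z‖ + z.re) / 2) := by
  rw [Complex.sqrt, Complex.cpow_inv_two_re]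

lemma norm_csqrt (z : ℂ) : ‖Complex.sqrt z‖ = √‖z‖ := by
  rw [← Real.sqrt_sq (norm_nonneg (Complex.sqrt z)), ← norm_pow, csqrt_sq]

/-- The integral of the Green integrand over the line `ξ₂ = t`, up to the factor `π`. -/
noncomputable def greenSlice (x : R2) (k : C2) (t : ℝ) : ℂ :=
  Complex.exp (Complex.I * (t * x 1 - k 0 * x 0)) *
    pairTerm (x 0) (k 0).im (Complex.sqrt (poleSq k t))

lemma greenIntegrand_coord (x : R2) (k : C2) (s t : ℝ) {S : ℂ} (hS : S ^ 2 = poleSq k t) :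
    greenIntegrand x k !₂[s, t] = Complex.exp (Complex.I * (t * x 1)) *
      (Complex.exp (Complex.I * s * x 0) /
        (((s : ℂ) - (-k 0 + Complex.I * S)) * ((s : ℂ) - (-k 0 - Complex.I * S)))) := by
  rw [greenIntegrand_eq, R2.inner_eq, mul_div_assoc', ← Complex.exp_add]
  simp only [Matrix.cons_val_zero, Matrix.cons_val_one]
  congr 1
  · congr 1; push_cast; ring
  · rw [poleSq] at hS
    rw [symb]
    linear_combination (-1 : ℂ) * hS + S ^ 2 * Complex.I_sq

/-- Apply the residue formula to the poles σ, τ = -k₁ ± iS. Here σ - τ = 2iS, so 2πi/(2iS) = π/S,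
and a pole lies in the upper half-plane exactly when Re(±S) > Im k₁. -/
lemma integral_greenIntegrand_slice {x : R2} (hx : 0 < x 0) {k : C2} {t : ℝ}
    (hW : poleSq k t ≠ 0) (hP : ∀ s : ℝ, symb k s t ≠ 0) :
    (Integrable fun s : ℝ => greenIntegrand x k !₂[s, t]) ∧
    ∫ s : ℝ, greenIntegrand x k !₂[s, t] = Real.pi * greenSlice x k t := by
  set S := Complex.sqrt (poleSq k t) with hSdef
  have hS : S ^ 2 = poleSq k t := csqrt_sq _
  have hS0 : S ≠ 0 := by intro h; rw [h] at hS; apply hW; rw [← hS]; ring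
  set σ := -k 0 + Complex.I * S with hσdef
  set τ := -k 0 - Complex.I * S with hτdef
  have hfac : ∀ z : ℂ, z ^ 2 + (t : ℂ) ^ 2 + 2 * (k 0 * z + k 1 * t) = (z - σ) * (z - τ) := by
    intro z
    rw [poleSq] at hS
    simp only [hσdef, hτdef]
    linear_combination (-1 : ℂ) * hS + S ^ 2 * Complex.I_sq
  have hσ : σ.im ≠ 0 := by
    intro h
    apply hP σ.re
    have e : ((σ.re : ℝ) : ℂ) = σ := Complex.ext (by simp) (by simp [h])
    rw [symb, hfac, e]; ring
  have hτ : τ.im ≠ 0 := by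
    intro h
    apply hP τ.re
    have e : ((τ.re : ℝ) : ℂ) = τ := Complex.ext (by simp) (by simp [h])
    rw [symb, hfac, e]; ring
  have hd : σ - τ = 2 * Complex.I * S := by simp only [hσdef, hτdef]; ring
  have hne : σ ≠ τ := by
    rw [← sub_ne_zero, hd]
    exact mul_ne_zero (mul_ne_zero two_ne_zero Complex.I_ne_zero) hS0
  simp_rw [greenIntegrand_coord x k _ t hS]
  refine ⟨(integrable_exp_div_sub_mul_sub hσ hτ (x 0)).const_mul _, ?_⟩
  rw [integral_const_mul, integral_exp_div_sub_mul_sub hσ hτ hne hx, hd, ← neg_sub σ τ, hd]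
  have i1 : σ.im = S.re - (k 0).im := by simp [hσdef]; ring
  have i2 : τ.im = -S.re - (k 0).im := by simp [hτdef]; ring
  rw [greenSlice, pairTerm, poleTerm, poleTerm, ← hSdef, i1, i2, Complex.neg_re]
  have E : Complex.exp (Complex.I * (t * x 1 - k 0 * x 0)) =
      Complex.exp (Complex.I * (t * x 1)) * Complex.exp (-(Complex.I * k 0 * x 0)) := by
    rw [← Complex.exp_add]; congr 1; ring
  have E1 : Complex.exp (Complex.I * σ * x 0) =
      Complex.exp (-(Complex.I * k 0 * x 0)) * Complex.exp (-(x 0 * S)) := by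
    rw [← Complex.exp_add]; congr 1; simp only [hσdef]
    linear_combination (S * x 0) * Complex.I_sq
  have E2 : Complex.exp (Complex.I * τ * x 0) =
      Complex.exp (-(Complex.I * k 0 * x 0)) * Complex.exp (-(x 0 * -S)) := by
    rw [← Complex.exp_add]; congr 1; simp only [hτdef]
    linear_combination (-S * x 0) * Complex.I_sq
  rw [E, E1, E2]
  simp only [sub_pos]
  have hI := Complex.I_ne_zero
  split_ifs <;> field_simp <;> ring

/-- The imaginary part of ξ² + 2kξ vanishes on a line through the origin, the real part on a circle
through the origin. They meet at 0 and in at most one further point, whose second coordinate is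
computed by elimination. -/
lemma ae_symb_ne_zero {k : C2} (hk : imVec k ≠ 0) : ∀ᵐ t : ℝ, ∀ s : ℝ, symb k s t ≠ 0 := by
  have hq := R2.ne_zero_iff.1 hk
  simp only [imVec_zero, imVec_one] at hq
  set q0 := (k 0).im
  set q1 := (k 1).im
  set p0 := (k 0).re
  set p1 := (k 1).re
  have n0 : ∀ᵐ t : ℝ, t ≠ 0 := by simp [ae_iff]
  have n1 : ∀ᵐ t : ℝ, t ≠ -(2 * q0 * (p1 * q0 - p0 * q1)) / (q0 ^ 2 + q1 ^ 2) := by simp [ae_iff]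
  filter_upwards [n0, n1] with t h0 h1 s hs
  have hre := symb_re k s t
  have him := symb_im k s t
  rw [hs] at hre him
  simp only [Complex.zero_re, Complex.zero_im] at hre him
  change 0 = 2 * (q0 * s + q1 * t) at him
  change 0 = s ^ 2 + t ^ 2 + 2 * (p0 * s + p1 * t) at hre
  apply h1
  rw [eq_div_iff hq.ne']
  have : t * (t * (q0 ^ 2 + q1 ^ 2) + (2 * q0 * (p1 * q0 - p0 * q1))) = 0 := by
    linear_combination (-q0 ^ 2) * hre + (1 / 2 * (q0 * s - q1 * t) + q0 * p0) * him
  have := (mul_eq_zero.1 this).resolve_left h0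
  linarith

lemma ae_poleSq_ne_zero (k : C2) : ∀ᵐ t : ℝ, poleSq k t ≠ 0 := by
  set P : Polynomial ℂ := Polynomial.X ^ 2 + Polynomial.C (2 * k 1) * Polynomial.X
    - Polynomial.C (k 0 ^ 2) with hP
  have hP0 : P ≠ 0 := by
    intro h
    have : P.coeff 2 = 1 := by
      rw [hP, Polynomial.coeff_sub, Polynomial.coeff_add, Polynomial.coeff_X_pow,
        Polynomial.coeff_C_mul, Polynomial.coeff_X, Polynomial.coeff_C]; simp
    rw [h] at this; simp at this
  have hfin : {t : ℝ | poleSq k t = 0}.Finite := by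
    have h1 : ((P.roots.toFinset : Set ℂ)).Finite := Finset.finite_toSet _
    refine (h1.preimage (f := fun t : ℝ => (t : ℂ)) (fun a _ b _ h => by simpa using h)).subset ?_
    intro t ht
    simp only [Set.mem_preimage, Finset.mem_coe, Multiset.mem_toFinset, Polynomial.mem_roots hP0,
      Polynomial.IsRoot.def]
    have ht' : poleSq k t = 0 := ht
    rw [hP, ← ht', poleSq]; simp
  rw [ae_iff]
  simpa using hfin.measure_zero volume

/-- The prefactor (1/2π)² times the factor π of each slice integral gives 1/(4π). Exceptional lines,
where a pole is real or double, have measure zero. -/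
lemma greenSlice_spec {x : R2} (hx : 0 < x 0) {k : C2} (hk : imVec k ≠ 0) :
    Integrable (greenSlice x k) ∧
    Tendsto (gTrunc x k) atTop (𝓝 (-(1 / (4 * (Real.pi : ℂ))) * ∫ t : ℝ, greenSlice x k t)) := by
  have hpi : (Real.pi : ℂ) ≠ 0 := by exact_mod_cast Real.pi_ne_zero
  have hgood : ∀ᵐ t : ℝ, (Integrable fun s : ℝ => greenIntegrand x k !₂[s, t]) ∧
      ∫ s : ℝ, greenIntegrand x k !₂[s, t] = Real.pi * greenSlice x k t := by
    filter_upwards [ae_symb_ne_zero hk, ae_poleSq_ne_zero k] with t h1 h2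
    exact integral_greenIntegrand_slice hx h2 h1
  obtain ⟨h1, h2⟩ := tendsto_gTrunc_slices hx hk (hgood.mono fun t h => h.1)
  constructor
  · refine (h1.const_mul (1 / (Real.pi : ℂ))).congr ?_
    filter_upwards [hgood] with t ht
    rw [ht.2]; field_simp
  · rw [integral_congr_ae (hgood.mono fun t h => h.2), integral_const_mul] at h2
    convert h2 using 2
    field_simp; ring

lemma tendsto_gTrunc_of_pos {x : R2} (hx : 0 < x 0) {k : C2} (hk : imVec k ≠ 0) :
    Tendsto (gTrunc x k) atTop (𝓝 (g x k)) :=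
  tendsto_nhds_limUnder ⟨_, (greenSlice_spec hx hk).2⟩

lemma g_eq_integral {x : R2} (hx : 0 < x 0) {k : C2} (hk : imVec k ≠ 0) :
    g x k = -(1 / (4 * (Real.pi : ℂ))) * ∫ t : ℝ, greenSlice x k t :=
  (greenSlice_spec hx hk).2.limUnder_eq

lemma imVec_rotC_ne_zero {c s : ℝ} (h : c ^ 2 + s ^ 2 = 1) {k : C2} (hk : imVec k ≠ 0) :
    imVec (rotC c s k) ≠ 0 := by
  rw [imVec_rotC]; exact rotR_ne_zero h hk

/-- The principal value integral defining `g` converges. -/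
lemma tendsto_gTrunc {x : R2} (hx : x ≠ 0) {k : C2} (hk : imVec k ≠ 0) :
    Tendsto (gTrunc x k) atTop (𝓝 (g x k)) := by
  obtain ⟨c, s, hcs, hrot⟩ := exists_rot_pos x hx
  have h0 : 0 < rotR c s x 0 := by
    have h1 := (hrot x).1
    have h2 := R2.ne_zero_iff.1 hx
    have h3 := norm_pos_iff.2 hx
    by_contra h
    nlinarith [mul_nonneg h3.le (neg_nonneg.2 (not_lt.1 h))]
  have := tendsto_gTrunc_of_pos h0 (imVec_rotC_ne_zero hcs hk)
  rw [funext (gTrunc_rot hcs x k), g_rot hcs] at this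
  exact this

lemma g_negConj {x : R2} (hx : x ≠ 0) {k : C2} (hk : imVec k ≠ 0) :
    g x (negConj k) = (starRingEnd ℂ) (g x k) := by
  have h1 := tendsto_gTrunc hx (k := negConj k) (by rwa [imVec_negConj])
  have h2 := (Complex.continuous_conj.tendsto _).comp (tendsto_gTrunc hx hk)
  rw [funext (gTrunc_negConj x k)] at h1
  exact tendsto_nhds_unique h1 h2

/-! ### Bounds and continuity -/

/-- The pole -S counts only if Re S < -q ≤ |q|. Its growing exponential is then at most e^{2r|q|}
times the decaying one. -/
lemma norm_pairTerm_le {r : ℝ} (hr : 0 < r) (q : ℝ) (S : ℂ) :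
    ‖pairTerm r q S‖ ≤ (1 + Real.exp (2 * r * |q|)) * (Real.exp (-(r * S.re)) / ‖S‖) := by
  have e : ∀ S : ℂ, ‖Complex.exp (-(r * S)) / S‖ = Real.exp (-(r * S.re)) / ‖S‖ := by
    intro S; rw [norm_div, Complex.norm_exp]; simp
  have h1 : ‖poleTerm r q S‖ ≤ Real.exp (-(r * S.re)) / ‖S‖ := by
    unfold poleTerm
    split_ifs
    · rw [e]
    · rw [norm_zero]; positivity
  have h2 : ‖poleTerm r q (-S)‖ ≤ Real.exp (2 * r * |q|) * (Real.exp (-(r * S.re)) / ‖S‖) := by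
    unfold poleTerm
    split_ifs with h
    · rw [e, norm_neg, mul_div_assoc', ← Real.exp_add]
      gcongr
      simp only [Complex.neg_re] at h ⊢
      have : S.re ≤ |q| := by linarith [neg_le_abs q]
      nlinarith
    · rw [norm_zero]; positivity
  calc _ ≤ ‖poleTerm r q S‖ + ‖poleTerm r q (-S)‖ := norm_add_le _ _
    _ ≤ _ := by linarith

lemma le_csqrt_re {z : ℂ} {t C : ℝ} (hC : 0 ≤ C) (h : t ^ 2 / 4 - C ^ 2 ≤ z.re) :
    |t| / 2 - C ≤ (Complex.sqrt z).re := by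
  rcases le_or_gt (|t| / 2 - C) 0 with h0 | h0
  · exact h0.trans (csqrt_re_nonneg z)
  · rw [csqrt_re]
    refine Real.le_sqrt_of_sq_le ?_
    have h1 : z.re ≤ ‖z‖ := Complex.re_le_norm z
    have h2 : (|t| / 2 - C) ^ 2 ≤ t ^ 2 / 4 - C ^ 2 := by
      rw [← sq_abs t]; nlinarith
    linarith

lemma poleSq_re_ge (k : C2) (t : ℝ) {M : ℝ} (hM : ‖k‖ ≤ M) :
    t ^ 2 / 4 - (2 * M) ^ 2 ≤ (poleSq k t).re := by
  have hn := C2.norm_sq k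
  rw [Complex.sq_norm, Complex.sq_norm, Complex.normSq_apply, Complex.normSq_apply] at hn
  have hk := norm_nonneg k
  have : (poleSq k t).re = t ^ 2 + 2 * (k 1).re * t - (k 0).re ^ 2 + (k 0).im ^ 2 := by
    simp [poleSq, sq]; ring
  rw [this]
  have h2 : ‖k‖ ^ 2 ≤ M ^ 2 := by gcongr
  nlinarith [sq_nonneg (t + 2 * (k 1).re), sq_nonneg (k 0).re, sq_nonneg (k 0).im,
    sq_nonneg (k 1).re, sq_nonneg (k 1).im, sq_nonneg t]

lemma norm_exp_phase (x : R2) (k : C2) (t : ℝ) :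
    ‖Complex.exp (Complex.I * (t * x 1 - k 0 * x 0))‖ = Real.exp ((k 0).im * x 0) := by
  rw [Complex.norm_exp]; simp

/-- The majorant used both for continuity of g and for its boundary values. It decays exponentially
in t, locally uniformly in k, and its only singularities are of inverse square root type at the
zeros of `poleSq`. -/
lemma norm_greenSlice_le {x : R2} (hx : 0 < x 0) (k : C2) (t : ℝ) {M : ℝ} (hM : ‖k‖ ≤ M) :
    ‖greenSlice x k t‖ ≤ Real.exp (M * x 0) * (1 + Real.exp (2 * x 0 * M)) *
      (Real.exp (2 * M * x 0) * Real.exp (-(x 0 / 2 * |t|)) / √‖poleSq k t‖) := by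
  have hq : |(k 0).im| ≤ M :=
    ((Complex.abs_im_le_norm _).trans (PiLp.norm_apply_le k 0)).trans hM
  have hM0 : 0 ≤ M := (norm_nonneg k).trans hM
  unfold greenSlice
  rw [norm_mul, norm_exp_phase, mul_assoc]
  have h1 := norm_pairTerm_le hx (k 0).im (Complex.sqrt (poleSq k t))
  have h2 := le_csqrt_re (by linarith : 0 ≤ 2 * M) (poleSq_re_ge k t hM)
  rw [norm_csqrt] at h1
  have h3 : Real.exp ((k 0).im * x 0) ≤ Real.exp (M * x 0) := by
    gcongr; exact (le_abs_self _).trans hq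
  refine mul_le_mul h3 (h1.trans ?_) (norm_nonneg _) (Real.exp_pos _).le
  have h4 : Real.exp (-(x 0 * (Complex.sqrt (poleSq k t)).re)) ≤
      Real.exp (2 * M * x 0) * Real.exp (-(x 0 / 2 * |t|)) := by
    rw [← Real.exp_add]; gcongr; nlinarith
  gcongr

lemma integrable_exp_neg_abs {a : ℝ} (ha : 0 < a) : Integrable fun t : ℝ => Real.exp (-(a * |t|)) := by
  have h1 : IntegrableOn (fun t : ℝ => Real.exp (-(a * |t|))) (Set.Ioi 0) := by
    refine (integrableOn_exp_mul_Ioi (neg_neg_of_pos ha) 0).congr_fun (fun t ht => ?_)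
      measurableSet_Ioi
    simp [abs_of_pos (Set.mem_Ioi.1 ht)]
  have h2 : IntegrableOn (fun t : ℝ => Real.exp (-(a * |t|))) (Set.Iic 0) := by
    refine (integrableOn_exp_mul_Iic ha 0).congr_fun (fun t ht => ?_) measurableSet_Iic
    simp [abs_of_nonpos (Set.mem_Iic.1 ht)]
  rw [← integrableOn_univ, ← Set.Iic_union_Ioi (a := (0 : ℝ))]
  exact h2.union h1

lemma tendsto_poleTerm_of_lt {ι : Type*} {l : Filter ι} (r : ℝ) {q : ι → ℝ} {S : ι → ℂ} {S₀ : ℂ}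
    (hS : Tendsto S l (𝓝 S₀)) (h0 : S₀ ≠ 0) (h : ∀ᶠ i in l, q i < (S i).re) :
    Tendsto (fun i => poleTerm r (q i) (S i)) l (𝓝 (Complex.exp (-(r * S₀)) / S₀)) := by
  have h1 : Tendsto (fun i => Complex.exp (-(r * S i)) / S i) l
      (𝓝 (Complex.exp (-(r * S₀)) / S₀)) :=
    ((Complex.continuous_exp.tendsto _).comp ((hS.const_mul _).neg)).div hS h0
  refine h1.congr' ?_
  filter_upwards [h] with i hi
  rw [poleTerm, if_pos hi]

lemma tendsto_poleTerm_of_le {ι : Type*} {l : Filter ι} (r : ℝ) {q : ι → ℝ} {S : ι → ℂ}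
    (h : ∀ᶠ i in l, (S i).re ≤ q i) :
    Tendsto (fun i => poleTerm r (q i) (S i)) l (𝓝 0) := by
  refine tendsto_const_nhds.congr' ?_
  filter_upwards [h] with i hi
  rw [poleTerm, if_neg (not_lt.2 hi)]

lemma tendsto_poleTerm {ι : Type*} {l : Filter ι} (r : ℝ) {q : ι → ℝ} {S : ι → ℂ} {q₀ : ℝ} {S₀ : ℂ}
    (hq : Tendsto q l (𝓝 q₀)) (hS : Tendsto S l (𝓝 S₀)) (h0 : S₀ ≠ 0) (h : S₀.re ≠ q₀) :
    Tendsto (fun i => poleTerm r (q i) (S i)) l (𝓝 (poleTerm r q₀ S₀)) := by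
  have hre : Tendsto (fun i => (S i).re) l (𝓝 S₀.re) := (Complex.continuous_re.tendsto _).comp hS
  rcases lt_or_gt_of_ne h with h' | h'
  · rw [poleTerm, if_neg (not_lt.2 h'.le)]
    exact tendsto_poleTerm_of_le r ((hre.eventually_lt hq h').mono fun i hi => hi.le)
  · rw [poleTerm, if_pos h']
    exact tendsto_poleTerm_of_lt r hS h0 (hq.eventually_lt hre h')

/-- At equality the pole -k₁ + iS would be real, hence a real zero of the denominator. So `poleTerm`
can switch only at exceptional t. -/
lemma pole_re_ne {k : C2} {t : ℝ} (hP : ∀ s : ℝ, symb k s t ≠ 0) {S : ℂ}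
    (hS : S ^ 2 = poleSq k t) : S.re ≠ (k 0).im := by
  intro h
  set z := -k 0 + Complex.I * S with hz
  apply hP z.re
  have e : ((z.re : ℝ) : ℂ) = z := Complex.ext (by simp) (by simp [hz, h])
  rw [symb, e, hz]
  rw [poleSq] at hS
  linear_combination (-1 : ℂ) * hS + S ^ 2 * Complex.I_sq

lemma continuous_imVec : Continuous imVec := by
  have : imVec = fun k : C2 => (!₂[(k 0).im, (k 1).im] : R2) := rfl
  rw [this]; fun_prop

lemma continuous_reVec : Continuous reVec := by
  have : reVec = fun k : C2 => (!₂[(k 0).re, (k 1).re] : R2) := rfl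
  rw [this]; fun_prop

lemma continuous_rotC (c s : ℝ) : Continuous (rotC c s) := by
  have : rotC c s = fun k : C2 => (!₂[c * k 0 - s * k 1, s * k 0 + c * k 1] : C2) := rfl
  rw [this]; fun_prop

lemma continuousAt_greenSlice (x : R2) {k : C2} {t : ℝ} (hP : ∀ s : ℝ, symb k s t ≠ 0)
    (hW : poleSq k t ≠ 0) : ContinuousAt (fun l => greenSlice x l t) k := by
  set S₀ := Complex.sqrt (poleSq k t) with hS₀
  have hsq : S₀ ^ 2 = poleSq k t := csqrt_sq _
  have h0 : S₀ ≠ 0 := by intro h; rw [h] at hsq; apply hW; rw [← hsq]; ring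
  -- A branch of the square root of `poleSq l t` that is continuous at k: the argument of
  -- `Complex.sqrt` is near 1, away from the cut.
  set S : C2 → ℂ := fun l => S₀ * Complex.sqrt (poleSq l t / poleSq k t) with hSdef
  have hSsq : ∀ l, S l ^ 2 = poleSq l t := by
    intro l
    have h1 := csqrt_sq (poleSq l t / poleSq k t)
    simp only [hSdef]
    rw [mul_pow, h1, hsq]; field_simp
  have hcW : Continuous fun l : C2 => poleSq l t := by unfold poleSq; fun_prop
  have hcS : Tendsto S (𝓝 k) (𝓝 S₀) := by
    have h1 : Tendsto (fun l : C2 => poleSq l t / poleSq k t) (𝓝 k) (𝓝 1) := by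
      have := (hcW.tendsto k).div_const (poleSq k t)
      rwa [div_self hW] at this
    have h2 : Tendsto Complex.sqrt (𝓝 1) (𝓝 1) := by
      have := (Complex.continuousAt_sqrt (z := 1) (by simp)).tendsto
      rwa [Complex.sqrt_one] at this
    have := (h2.comp h1).const_mul S₀
    rwa [mul_one] at this
  have hq : Tendsto (fun l : C2 => (l 0).im) (𝓝 k) (𝓝 (k 0).im) :=
    Continuous.tendsto (by fun_prop) k
  have e : (fun l => greenSlice x l t) = fun l => Complex.exp (Complex.I * (t * x 1 - l 0 * x 0)) *
      (poleTerm (x 0) (l 0).im (S l) + poleTerm (x 0) (l 0).im (-S l)) := by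
    ext l
    rw [greenSlice, pairTerm_congr (x 0) (l 0).im ((csqrt_sq _).trans (hSsq l).symm), pairTerm]
  have e0 : greenSlice x k t = Complex.exp (Complex.I * (t * x 1 - k 0 * x 0)) *
      (poleTerm (x 0) (k 0).im S₀ + poleTerm (x 0) (k 0).im (-S₀)) := rfl
  rw [ContinuousAt, e0, e]
  refine Tendsto.mul (Continuous.tendsto (by fun_prop) k) ?_
  refine (tendsto_poleTerm _ hq hcS h0 (pole_re_ne hP hsq)).add
    (tendsto_poleTerm _ hq hcS.neg (neg_ne_zero.2 h0) (pole_re_ne hP ?_))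
  rw [neg_sq, hsq]

/-- Compactness handles |t| ≤ 8M. Outside, the quadratic growth of the real part gives at least 16M²
- 4M² ≥ 1. -/
lemma eventually_poleSq_lower {k : C2} (hW : ∀ t : ℝ, poleSq k t ≠ 0) :
    ∃ δ > 0, ∀ᶠ l in 𝓝 k, ∀ t : ℝ, δ ≤ ‖poleSq l t‖ := by
  set M := ‖k‖ + 1
  have hM : 1 ≤ M := by have := norm_nonneg k; simp only [M]; linarith
  set T := 8 * M
  have hc : Continuous fun p : C2 × ℝ => poleSq p.1 p.2 := by unfold poleSq; fun_prop
  obtain ⟨t₀, -, ht₀⟩ := (isCompact_Icc (a := -T) (b := T)).exists_isMinOn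
    (Set.nonempty_Icc.2 (by simp only [T]; linarith))
    (f := fun t : ℝ => ‖poleSq k t‖)
    ((hc.comp (by fun_prop : Continuous fun t : ℝ => (k, t))).norm.continuousOn)
  set d := ‖poleSq k t₀‖
  have hd : 0 < d := norm_pos_iff.2 (hW t₀)
  have h1 : ∀ᶠ l in 𝓝 k, ∀ t ∈ Set.Icc (-T) T, d / 2 < ‖poleSq l t‖ := by
    refine isCompact_Icc.eventually_forall_of_forall_eventually fun t ht => ?_
    have : d / 2 < ‖poleSq (k, t).1 (k, t).2‖ := by
      have := ht₀ ht
      simp only [Set.mem_ofPred_eq] at this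
      simp only; linarith
    exact (hc.norm.tendsto (k, t)).eventually_const_lt this
  have h2 : ∀ᶠ l in 𝓝 k, ‖l‖ ≤ M := by
    refine (continuous_norm.tendsto k).eventually_le_const ?_
    simp only [M]; linarith
  refine ⟨min (d / 2) 1, by positivity, ?_⟩
  filter_upwards [h1, h2] with l hl1 hl2 t
  by_cases ht : t ∈ Set.Icc (-T) T
  · exact (min_le_left _ _).trans (hl1 t ht).le
  · refine (min_le_right _ _).trans (le_trans ?_ (Complex.re_le_norm _))
    refine le_trans ?_ (poleSq_re_ge l t hl2)
    have : T ^ 2 < t ^ 2 := by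
      rw [sq_lt_sq, abs_of_nonneg (by simp only [T]; linarith : 0 ≤ T)]
      by_contra h
      exact ht (abs_le.1 (not_lt.1 h))
    simp only [T] at this
    nlinarith

lemma continuousAt_g_of_pos {x : R2} (hx : 0 < x 0) {k : C2} (hk : imVec k ≠ 0)
    (hW : ∀ t : ℝ, poleSq k t ≠ 0) : ContinuousAt (g x) k := by
  have hev : ∀ᶠ l in 𝓝 k, imVec l ≠ 0 := continuous_imVec.continuousAt.eventually_ne hk
  have e : (fun l => -(1 / (4 * (Real.pi : ℂ))) * ∫ t : ℝ, greenSlice x l t) =ᶠ[𝓝 k] g x := by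
    filter_upwards [hev] with l hl
    exact (g_eq_integral hx hl).symm
  refine ContinuousAt.congr ?_ e
  refine ContinuousAt.mul continuousAt_const ?_
  obtain ⟨δ, hδ, hlow⟩ := eventually_poleSq_lower hW
  set M := ‖k‖ + 1
  have h2 : ∀ᶠ l in 𝓝 k, ‖l‖ ≤ M := by
    refine (continuous_norm.tendsto k).eventually_le_const ?_
    simp only [M]; linarith
  refine continuousAt_of_dominated (bound := fun t => Real.exp (M * x 0) *
    (1 + Real.exp (2 * x 0 * M)) * (Real.exp (2 * M * x 0) * Real.exp (-(x 0 / 2 * |t|)) / √δ))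
    ?_ ?_ ?_ ?_
  · filter_upwards [hev] with l hl
    exact (greenSlice_spec hx hl).1.aestronglyMeasurable
  · filter_upwards [hlow, h2] with l h3 h4
    refine ae_of_all _ fun t => (norm_greenSlice_le hx l t h4).trans ?_
    gcongr
    exact h3 t
  · exact (((integrable_exp_neg_abs (by linarith : 0 < x 0 / 2)).const_mul _).div_const _).const_mul _
  · filter_upwards [ae_symb_ne_zero hk] with t ht
    exact continuousAt_greenSlice x ht (hW t)

lemma poleSq_eq (k : C2) (t : ℝ) : poleSq k t = (t + k 1) ^ 2 - (k 0 ^ 2 + k 1 ^ 2) := by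
  unfold poleSq; ring

/-- A rotation after which the poles stay away from the branch points. -/
lemma exists_rot_poleSq_ne_zero {x : R2} (hx : x ≠ 0) {k : C2} (hk : imVec k ≠ 0) :
    ∃ c s : ℝ, c ^ 2 + s ^ 2 = 1 ∧ 0 < rotR c s x 0 ∧ ∀ t : ℝ, poleSq (rotC c s k) t ≠ 0 := by
  by_contra hcon
  push Not at hcon
  set q := imVec k with hqdef
  set E := k 0 ^ 2 + k 1 ^ 2 with hE
  have hρ := R2.ne_zero_iff.1 hx
  have hq := R2.ne_zero_iff.1 hk
  -- A zero of `poleSq` in the frame of n provides a square root of E whose imaginary part is the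
  -- component of Im k orthogonal to n. The square roots of E are ±z, so this component would have
  -- the same modulus in every admissible frame.
  have key : ∀ n : R2, n ≠ 0 → 0 < n 0 * x 0 + n 1 * x 1 → ∃ z : ℂ, z ^ 2 = E ∧
      ‖n‖ * z.im = n 0 * q 1 - n 1 * q 0 := by
    intro n hn hnx
    obtain ⟨c, s, hcs, hrot⟩ := exists_rot_pos n hn
    have hnn := norm_pos_iff.2 hn
    have h1 := (hrot x).1
    have hpos : 0 < rotR c s x 0 := by
      by_contra h
      nlinarith [mul_nonneg hnn.le (neg_nonneg.2 (not_lt.1 h))]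
    obtain ⟨t, ht⟩ := hcon c s hcs hpos
    refine ⟨t + rotC c s k 1, ?_, ?_⟩
    · rw [poleSq_eq, sum_sq_rotC hcs] at ht
      linear_combination ht
    · have h2 := (hrot q).2
      rw [hqdef, ← imVec_rotC, imVec_one] at h2
      rw [Complex.add_im, Complex.ofReal_im, zero_add]
      exact h2
  have heq : ∀ z w : ℂ, z ^ 2 = E → w ^ 2 = E → z.im ^ 2 = w.im ^ 2 := by
    intro z w hz hw
    rcases sq_eq_sq_iff_eq_or_eq_neg.1 (hz.trans hw.symm) with h | h
    · rw [h]
    · rw [h]; simp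
  have hne : ∀ n : R2, 0 < n 0 * x 0 + n 1 * x 1 → n ≠ 0 := by
    rintro n hn rfl; simp at hn
  set ρ := x 0 ^ 2 + x 1 ^ 2 with hρdef
  obtain ⟨z₁, hz₁, h₁⟩ := key x hx (by nlinarith)
  -- The vectors n₂, n₃ are x turned by ±45° and scaled by √2. Equal orthogonal components of Im k
  -- for the three directions x, n₂, n₃ force a = b = 0, that is Im k = 0.
  set n₂ : R2 := !₂[x 0 - x 1, x 1 + x 0] with hn₂
  set n₃ : R2 := !₂[x 0 + x 1, x 1 - x 0] with hn₃
  have p₂ : 0 < n₂ 0 * x 0 + n₂ 1 * x 1 := by simp [hn₂]; nlinarith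
  have p₃ : 0 < n₃ 0 * x 0 + n₃ 1 * x 1 := by simp [hn₃]; nlinarith
  obtain ⟨z₂, hz₂, h₂⟩ := key n₂ (hne _ p₂) p₂
  obtain ⟨z₃, hz₃, h₃⟩ := key n₃ (hne _ p₃) p₃
  set a := x 0 * q 1 - x 1 * q 0 with ha
  set b := x 0 * q 0 + x 1 * q 1 with hb
  have s₁ : ρ * z₁.im ^ 2 = a ^ 2 := by
    rw [← h₁, mul_pow, R2.norm_sq]
  have s₂ : 2 * ρ * z₁.im ^ 2 = (a - b) ^ 2 := by
    have : n₂ 0 * q 1 - n₂ 1 * q 0 = a - b := by simp [hn₂, ha, hb]; ring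
    rw [← this, ← h₂, mul_pow, R2.norm_sq, heq z₂ z₁ hz₂ hz₁]
    simp only [hn₂, hρdef, Matrix.cons_val_zero, Matrix.cons_val_one]; ring
  have s₃ : 2 * ρ * z₁.im ^ 2 = (a + b) ^ 2 := by
    have : n₃ 0 * q 1 - n₃ 1 * q 0 = a + b := by simp [hn₃, ha, hb]; ring
    rw [← this, ← h₃, mul_pow, R2.norm_sq, heq z₃ z₁ hz₃ hz₁]
    simp only [hn₃, hρdef, Matrix.cons_val_zero, Matrix.cons_val_one]; ring
  have hab : a ^ 2 + b ^ 2 = ρ * (q 0 ^ 2 + q 1 ^ 2) := by rw [ha, hb, hρdef]; ring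
  have hpos := mul_pos hρ hq
  have h4 : a * b = 0 := by linear_combination (1 / 4) * (s₂ - s₃)
  have h5 : a ^ 2 = b ^ 2 := by linear_combination s₂ - 2 * s₁ - 2 * h4
  have h6 : a ^ 2 * a ^ 2 = 0 := by
    calc a ^ 2 * a ^ 2 = (a * b) ^ 2 := by rw [mul_pow, h5]
      _ = 0 := by rw [h4]; ring
  have h7 : a ^ 2 = 0 := mul_self_eq_zero.1 h6
  rw [← hab, ← h5, h7] at hpos
  norm_num at hpos

/-- The Green function is continuous in the spectral parameter. -/
lemma continuousAt_g {x : R2} (hx : x ≠ 0) {k : C2} (hk : imVec k ≠ 0) : ContinuousAt (g x) k := by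
  obtain ⟨c, s, hcs, hpos, hW⟩ := exists_rot_poleSq_ne_zero hx hk
  have h := continuousAt_g_of_pos hpos (imVec_rotC_ne_zero hcs hk) hW
  have e : g x = g (rotR c s x) ∘ rotC c s := funext fun l => (g_rot hcs x l).symm
  rw [e]
  exact ContinuousAt.comp h (continuous_rotC c s).continuousAt

/-! ### The Faddeev Green function at real energy -/

/-- `G(x,k) = exp(ikx) g(x,k)`. -/
noncomputable def faddeevG (x : R2) (k : C2) : ℂ := Complex.exp (Complex.I * bdot k x) * g x k

lemma faddeevG_rot {c s : ℝ} (h : c ^ 2 + s ^ 2 = 1) (x : R2) (k : C2) :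
    faddeevG (rotR c s x) (rotC c s k) = faddeevG x k := by
  rw [faddeevG, faddeevG, bdot_rot h, g_rot h]

lemma faddeevG_negConj {x : R2} (hx : x ≠ 0) {k : C2} (hk : imVec k ≠ 0) :
    faddeevG x (negConj k) = (starRingEnd ℂ) (faddeevG x k) := by
  rw [faddeevG, faddeevG, exp_bdot_negConj, g_negConj hx hk, map_mul]

/-- The line integrand of `G`; it depends on `Im k` and `k²` only. -/
noncomputable def greenLine (x q : R2) (E : ℂ) (τ : ℝ) : ℂ :=
  Complex.exp (Complex.I * ((τ + Complex.I * q 1) * x 1)) *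
    pairTerm (x 0) (q 0) (Complex.sqrt ((τ + Complex.I * q 1) ^ 2 - E))

/-- The plane wave cancels k₁ in the phase and completes t to t + k₂, while `poleSq` is (t + k₂)² -
k². What is left of Re k₂ is a translation of the integration variable. -/
lemma exp_mul_greenSlice (x : R2) (k : C2) (t : ℝ) :
    Complex.exp (Complex.I * bdot k x) * greenSlice x k t =
      greenLine x (imVec k) (k 0 ^ 2 + k 1 ^ 2) (t + (k 1).re) := by
  have h1 : ((t + (k 1).re : ℝ) : ℂ) + Complex.I * ((k 1).im : ℂ) = t + k 1 := by
    conv_rhs => rw [← Complex.re_add_im (k 1)]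
    push_cast; ring
  rw [greenSlice, greenLine, imVec_one, imVec_zero, h1, poleSq_eq, ← mul_assoc, ← Complex.exp_add]
  congr 2
  rw [bdot]; ring

lemma faddeevG_eq_integral {x : R2} (hx : 0 < x 0) {k : C2} (hk : imVec k ≠ 0) :
    Integrable (greenLine x (imVec k) (k 0 ^ 2 + k 1 ^ 2)) ∧
    faddeevG x k = -(1 / (4 * (Real.pi : ℂ))) *
      ∫ τ : ℝ, greenLine x (imVec k) (k 0 ^ 2 + k 1 ^ 2) τ := by
  have hi := (greenSlice_spec hx hk).1.const_mul (Complex.exp (Complex.I * bdot k x))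
  simp only [exp_mul_greenSlice] at hi
  constructor
  · have := hi.comp_sub_right (k 1).re
    simpa using this
  · rw [faddeevG, g_eq_integral hx hk, mul_left_comm, ← integral_const_mul]
    simp only [exp_mul_greenSlice]
    rw [integral_add_right_eq_self (μ := volume)
      (greenLine x (imVec k) (k 0 ^ 2 + k 1 ^ 2)) (k 1).re]

lemma rot_to_pos {x : R2} (hx : x ≠ 0) : ∃ c s : ℝ, c ^ 2 + s ^ 2 = 1 ∧ rotR c s x 0 = ‖x‖ ∧
    rotR c s x 1 = 0 ∧ 0 < rotR c s x 0 := by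
  obtain ⟨c, s, hcs, hrot⟩ := exists_rot_pos x hx
  have h3 := norm_pos_iff.2 hx
  obtain ⟨h1, h2⟩ := hrot x
  rw [← sq, ← sq, ← R2.norm_sq, sq] at h1
  have h4 : rotR c s x 0 = ‖x‖ := mul_left_cancel₀ h3.ne' h1
  refine ⟨c, s, hcs, h4, ?_, h4 ▸ h3⟩
  have : ‖x‖ * rotR c s x 1 = 0 := by rw [h2]; ring
  exact (mul_eq_zero.1 this).resolve_left h3.ne'

/-- At real energy `G` depends on `Im k` and the energy only. -/
lemma faddeevG_congr {x : R2} (hx : x ≠ 0) {k l : C2} (hk : imVec k ≠ 0) (him : imVec k = imVec l)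
    (hE : k 0 ^ 2 + k 1 ^ 2 = l 0 ^ 2 + l 1 ^ 2) : faddeevG x k = faddeevG x l := by
  obtain ⟨c, s, hcs, -, -, hpos⟩ := rot_to_pos hx
  rw [← faddeevG_rot hcs x k, ← faddeevG_rot hcs x l,
    (faddeevG_eq_integral hpos (imVec_rotC_ne_zero hcs hk)).2,
    (faddeevG_eq_integral hpos (imVec_rotC_ne_zero hcs (him ▸ hk))).2, imVec_rotC, imVec_rotC,
    sum_sq_rotC hcs, sum_sq_rotC hcs, him, hE]

/-- At real energy `G` is real. -/
lemma conj_faddeevG {x : R2} (hx : x ≠ 0) {k : C2} (hk : imVec k ≠ 0) {E : ℝ}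
    (hE : k 0 ^ 2 + k 1 ^ 2 = E) : (starRingEnd ℂ) (faddeevG x k) = faddeevG x k := by
  -- The vector -k̄ has the same imaginary part as k, and the same k² because k² is real.
  rw [← faddeevG_negConj hx hk]
  refine (faddeevG_congr hx hk (imVec_negConj k).symm ?_).symm
  have := congrArg (starRingEnd ℂ) hE
  simp only [map_add, map_pow, Complex.conj_ofReal] at this
  simp only [negConj_zero, negConj_one, neg_sq]
  rw [this, hE]

lemma csqrt_eq_of_sq {z S : ℂ} (h : S ^ 2 = z) (hS : 0 < S.re) : Complex.sqrt z = S := by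
  rcases sq_eq_sq_iff_eq_or_eq_neg.1 ((csqrt_sq z).trans h.symm) with h1 | h1
  · exact h1
  · have := csqrt_re_nonneg z
    rw [h1, Complex.neg_re] at this
    linarith

/-- Write S = a + ib. Eliminating b, and likewise p₀, shows that (A,T) = (a², τ²) and (q₀², p₁²)
both satisfy T(A + q₁²) = A(A + q₁² + E). The identity `key` expresses that T and A increase
together along this relation; the degenerate case a = q₁ = 0 is treated apart. -/
lemma re_csqrt_gt_iff {p₀ p₁ q₀ q₁ E τ : ℝ} (hq : 0 < q₀) (hp : 0 < p₁)
    (hE : p₀ ^ 2 - q₀ ^ 2 + p₁ ^ 2 - q₁ ^ 2 = E) (hpq : p₀ * q₀ + p₁ * q₁ = 0) {S : ℂ}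
    (h0 : 0 ≤ S.re) (hS : S ^ 2 = (τ + Complex.I * q₁) ^ 2 - E) : q₀ < S.re ↔ p₁ < |τ| := by
  obtain ⟨a, b⟩ := S
  have hre : a ^ 2 - b ^ 2 = τ ^ 2 - q₁ ^ 2 - E := by
    have := congrArg Complex.re hS
    simp [sq] at this; linarith
  have him : a * b = τ * q₁ := by
    have := congrArg Complex.im hS
    simp [sq] at this; linarith
  simp only at h0 ⊢
  have e1 : τ ^ 2 * (a ^ 2 + q₁ ^ 2) = a ^ 2 * (a ^ 2 + q₁ ^ 2 + E) := by
    linear_combination (-a ^ 2) * hre - (a * b + τ * q₁) * him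
  have e2 : p₁ ^ 2 * (q₀ ^ 2 + q₁ ^ 2) = q₀ ^ 2 * (q₀ ^ 2 + q₁ ^ 2 + E) := by
    linear_combination (q₀ ^ 2) * hE + (p₁ * q₁ - p₀ * q₀) * hpq
  have hu : 0 ≤ a ^ 2 + q₁ ^ 2 + E := by nlinarith [sq_nonneg b, sq_nonneg τ]
  have hv : 0 < q₀ ^ 2 + q₁ ^ 2 + E := by nlinarith [sq_nonneg p₀, mul_pos hp hp]
  have hv' : 0 < q₀ ^ 2 + q₁ ^ 2 := by positivity
  have iff1 : p₁ < |τ| ↔ p₁ ^ 2 < τ ^ 2 := by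
    rw [sq_lt_sq, abs_of_pos hp]
  have iff2 : q₀ < a ↔ q₀ ^ 2 < a ^ 2 := by
    rw [sq_lt_sq, abs_of_pos hq, abs_of_nonneg h0]
  rw [iff1, iff2]
  rcases (add_nonneg (sq_nonneg a) (sq_nonneg q₁)).eq_or_lt' with hz | hz
  · have ha : a ^ 2 = 0 := by nlinarith [sq_nonneg a, sq_nonneg q₁]
    have hq1 : q₁ ^ 2 = 0 := by nlinarith [sq_nonneg a, sq_nonneg q₁]
    have e3 : p₁ ^ 2 = q₀ ^ 2 + E := by
      rw [hq1] at e2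
      have h5 : q₀ ^ 2 ≠ 0 := by positivity
      have : q₀ ^ 2 * (p₁ ^ 2 - (q₀ ^ 2 + E)) = 0 := by linarith
      linarith [(mul_eq_zero.1 this).resolve_left h5]
    have hq2 := sq_pos_of_pos hq
    constructor
    · intro h; linarith
    · intro h; nlinarith [sq_nonneg b]
  · set u := a ^ 2 + q₁ ^ 2
    set v := q₀ ^ 2 + q₁ ^ 2
    have hZ : 0 < u * v + E * q₁ ^ 2 := by
      rcases le_or_gt 0 E with hE0 | hE0
      · have := mul_pos hz hv'
        have := mul_nonneg hE0 (sq_nonneg q₁)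
        linarith
      · have h1 := mul_pos hz hv
        have h2 := mul_nonneg (neg_nonneg.2 hE0.le) (sq_nonneg a)
        have : u * v + E * q₁ ^ 2 = u * (v + E) + (-E) * a ^ 2 := by simp only [u]; ring
        linarith
    have key : (τ ^ 2 - p₁ ^ 2) * (u * v) = (a ^ 2 - q₀ ^ 2) * (u * v + E * q₁ ^ 2) := by
      simp only [u, v] at e1 e2 ⊢
      linear_combination (q₀ ^ 2 + q₁ ^ 2) * e1 - (a ^ 2 + q₁ ^ 2) * e2
    have huv := mul_pos hz hv'
    constructor
    · intro h
      have : 0 < (τ ^ 2 - p₁ ^ 2) * (u * v) := key ▸ mul_pos (sub_pos.2 h) hZ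
      linarith [(pos_iff_pos_of_mul_pos this).2 huv]
    · intro h
      have : 0 < (a ^ 2 - q₀ ^ 2) * (u * v + E * q₁ ^ 2) := key ▸ mul_pos (sub_pos.2 h) huv
      linarith [(pos_iff_pos_of_mul_pos this).2 hZ]

/-- The plane wave over the upper sheet of the energy curve, as a function of `κ = k₂`. -/
noncomputable def sheetWave (x : R2) (E : ℝ) (κ : ℂ) : ℂ :=
  Complex.exp (Complex.I * (κ * x 1)) *
    (Complex.exp (-(x 0 * Complex.sqrt (κ ^ 2 - E))) / Complex.sqrt (κ ^ 2 - E))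

/-- The integral of `sheetWave` along the horizontal ray from `κ`. -/
noncomputable def rayIntegral (x : R2) (E : ℝ) (κ : ℂ) : ℂ :=
  ∫ t in Set.Ioi (0 : ℝ), sheetWave x E (κ + t)

lemma sheetWave_neg_conj {x : R2} {E : ℝ} {κ : ℂ} (h : 0 < (Complex.sqrt (κ ^ 2 - E)).re) :
    sheetWave x E (-(starRingEnd ℂ) κ) = (starRingEnd ℂ) (sheetWave x E κ) := by
  have hs : Complex.sqrt ((-(starRingEnd ℂ) κ) ^ 2 - E) =
      (starRingEnd ℂ) (Complex.sqrt (κ ^ 2 - E)) := by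
    refine csqrt_eq_of_sq ?_ (by simpa using h)
    rw [← map_pow, csqrt_sq]; simp
  unfold sheetWave
  rw [hs]
  simp only [map_mul, map_div₀, ← Complex.exp_conj, map_neg, Complex.conj_ofReal, Complex.conj_I]
  congr 2; ring

/-- Since Im k₁ > 0, the pole with Re(-S) ≤ 0 never counts, and the other one counts exactly for |τ|
> Re k₂. The rays τ > Re k₂ and τ < -Re k₂ give conjugate contributions, hence twice a real part,
and -(1/4π) becomes -(1/2π). -/
lemma faddeevG_eq_rayIntegral {x : R2} (hx : 0 < x 0) {k : C2} {E : ℝ}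
    (hE : k 0 ^ 2 + k 1 ^ 2 = E) (hq : 0 < (k 0).im) (hp : 0 < (k 1).re) :
    faddeevG x k = ((-(1 / (2 * Real.pi)) * (rayIntegral x E (k 1)).re : ℝ) : ℂ) := by
  have hk : imVec k ≠ 0 := by
    intro h; have := congrArg (fun v : R2 => v 0) h
    simp at this; exact hq.ne' this
  obtain ⟨hi, hG⟩ := faddeevG_eq_integral hx hk
  rw [hE] at hi hG
  set p₁ := (k 1).re
  set q₁ := (k 1).im
  have hEre : (k 0).re ^ 2 - (k 0).im ^ 2 + p₁ ^ 2 - q₁ ^ 2 = E := by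
    have := congrArg Complex.re hE
    simp [sq] at this; simp only [p₁, q₁]; linarith
  have hEim : (k 0).re * (k 0).im + p₁ * q₁ = 0 := by
    have := congrArg Complex.im hE
    simp [sq] at this; simp only [p₁, q₁]; linarith
  set S : ℝ → ℂ := fun τ => Complex.sqrt ((τ + Complex.I * q₁) ^ 2 - E) with hSdef
  have hiff : ∀ τ : ℝ, (k 0).im < (S τ).re ↔ p₁ < |τ| := fun τ =>
    re_csqrt_gt_iff hq hp hEre hEim (csqrt_re_nonneg _) (csqrt_sq _)
  have hL : ∀ τ : ℝ, greenLine x (imVec k) E τ =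
      if p₁ < |τ| then sheetWave x E (τ + Complex.I * q₁) else 0 := by
    intro τ
    have h2 : ¬ (k 0).im < (-(S τ)).re := by
      have : 0 ≤ (S τ).re := csqrt_re_nonneg _
      rw [Complex.neg_re, not_lt]; linarith
    rw [greenLine, pairTerm, poleTerm, poleTerm]
    change _ * ((if (k 0).im < (S τ).re then _ else _) + if (k 0).im < (-(S τ)).re then _ else _) = _
    rw [if_neg h2, add_zero]
    by_cases h : p₁ < |τ|
    · rw [if_pos h, if_pos ((hiff τ).2 h)]; rfl
    · rw [if_neg h, if_neg (mt (hiff τ).1 h), mul_zero]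
  have hsym : ∀ τ : ℝ, greenLine x (imVec k) E (-τ) =
      (starRingEnd ℂ) (greenLine x (imVec k) E τ) := by
    intro τ
    rw [hL, hL, abs_neg]
    split_ifs with h
    · rw [← sheetWave_neg_conj (hq.trans ((hiff τ).2 h))]
      congr 1; simp; ring
    · simp
  have hsplit : ∫ τ : ℝ, greenLine x (imVec k) E τ =
      (∫ τ in Set.Ioi (0 : ℝ), (starRingEnd ℂ) (greenLine x (imVec k) E τ)) +
      ∫ τ in Set.Ioi (0 : ℝ), greenLine x (imVec k) E τ := by
    rw [← intervalIntegral.integral_Iic_add_Ioi (b := 0) hi.integrableOn hi.integrableOn]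
    congr 1
    have := integral_comp_neg_Ioi (0 : ℝ) (greenLine x (imVec k) E)
    rw [neg_zero] at this
    rw [← this]
    simp only [hsym]
  have hray : ∫ τ in Set.Ioi (0 : ℝ), greenLine x (imVec k) E τ = rayIntegral x E (k 1) := by
    have e1 : ∫ τ in Set.Ioi (0 : ℝ), greenLine x (imVec k) E τ =
        ∫ τ in Set.Ioi p₁, sheetWave x E (τ + Complex.I * q₁) := by
      rw [← integral_indicator measurableSet_Ioi, ← integral_indicator measurableSet_Ioi]
      congr 1; ext τ
      simp only [Set.indicator, Set.mem_Ioi, hL]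
      by_cases h0 : 0 < τ
      · simp only [h0, if_true, abs_of_pos h0]
      · have : ¬ p₁ < τ := by intro h; exact h0 (hp.trans h)
        simp only [h0, if_false, this]
    rw [e1, rayIntegral]
    have := (measurePreserving_add_right volume p₁).setIntegral_preimage_emb
      (measurableEmbedding_addRight p₁) (fun τ : ℝ => sheetWave x E (τ + Complex.I * q₁))
      (Set.Ioi p₁)
    rw [Set.preimage_add_const_Ioi, sub_self] at this
    rw [← this]
    congr 1; ext t; congr 1
    conv_rhs => rw [← Complex.re_add_im (k 1)]
    push_cast; ring
  rw [hG, hsplit, integral_conj, hray, add_comm, Complex.add_conj]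
  push_cast; ring

/-! ### The ray integral is holomorphic -/

/-- The domain of `sheetWave`. -/
def sheetDomain (E : ℝ) : Set ℂ := {κ | 0 < κ.re ∧ κ ^ 2 - E ∈ Complex.slitPlane}

lemma isOpen_sheetDomain (E : ℝ) : IsOpen (sheetDomain E) :=
  (isOpen_lt continuous_const Complex.continuous_re).inter
    (Complex.isOpen_slitPlane.preimage (by fun_prop))

lemma add_mem_sheetDomain {E : ℝ} {κ : ℂ} (h : κ ∈ sheetDomain E) {t : ℝ} (ht : 0 ≤ t) :
    κ + t ∈ sheetDomain E := by
  obtain ⟨h1, h2⟩ := h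
  refine ⟨by simp; linarith, ?_⟩
  rw [Complex.mem_slitPlane_iff] at h2 ⊢
  simp only [sq, Complex.sub_re, Complex.mul_re, Complex.sub_im, Complex.mul_im, Complex.add_re,
    Complex.add_im, Complex.ofReal_re, Complex.ofReal_im, add_zero, sub_zero] at h2 ⊢
  by_cases him : κ.im = 0
  · left
    rcases h2 with h2 | h2
    · nlinarith
    · rw [him] at h2; simp at h2
  · right
    have : (κ.re + t) * κ.im + κ.im * (κ.re + t) = 2 * ((κ.re + t) * κ.im) := by ring
    rw [this]
    exact mul_ne_zero two_ne_zero (mul_ne_zero (by linarith) him)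

lemma differentiableAt_sheetWave (x : R2) {E : ℝ} {κ : ℂ} (h : κ ∈ sheetDomain E) :
    DifferentiableAt ℂ (sheetWave x E) κ := by
  have h0 : Complex.sqrt (κ ^ 2 - E) ≠ 0 := by
    intro h1
    have := csqrt_sq (κ ^ 2 - E)
    rw [h1] at this
    exact Complex.slitPlane_ne_zero h.2 (by rw [← this]; ring)
  have hs : DifferentiableAt ℂ (fun κ : ℂ => Complex.sqrt (κ ^ 2 - E)) κ :=
    DifferentiableAt.comp (f := fun κ : ℂ => κ ^ 2 - (E : ℂ)) κ (Complex.differentiableAt_sqrt h.2)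
      (by fun_prop)
  unfold sheetWave
  refine DifferentiableAt.mul (by fun_prop) (DifferentiableAt.div ?_ hs h0)
  exact ((hs.const_mul _).neg).cexp

/-- Factor (κ+t)² - E through the roots ±√E. If κ + t came within ρ of a root e, then e - t would
lie in the ball of radius 3ρ inside the domain; the domain is stable under translation to the right,
so it would contain e, where κ² - E vanishes. -/
lemma exists_sheetDomain_bound {E : ℝ} {κ₀ : ℂ} (h : κ₀ ∈ sheetDomain E) :
    ∃ ρ > 0, ∀ κ ∈ Metric.ball κ₀ (2 * ρ), κ ∈ sheetDomain E ∧
      ∀ t : ℝ, 0 ≤ t → ρ ^ 2 ≤ ‖(κ + t) ^ 2 - E‖ := by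
  obtain ⟨ε, hε, hball⟩ := Metric.isOpen_iff.1 (isOpen_sheetDomain E) κ₀ h
  set ρ := ε / 3
  have hρ : 0 < ρ := by positivity
  refine ⟨ρ, hρ, fun κ hκ => ⟨hball (Metric.ball_subset_ball (by simp only [ρ]; linarith) hκ), ?_⟩⟩
  intro t ht
  have key : ∀ e : ℂ, e ^ 2 = E → ρ ≤ ‖κ + t - e‖ := by
    intro e he
    by_contra hlt
    rw [not_le] at hlt
    have h1 : e - t ∈ sheetDomain E := by
      apply hball
      rw [Metric.mem_ball] at hκ ⊢
      have h2 : dist (e - t) κ < ρ := by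
        rw [dist_comm, dist_eq_norm, show κ - (e - t) = κ + t - e by ring]; exact hlt
      calc dist (e - t) κ₀ ≤ dist (e - t) κ + dist κ κ₀ := dist_triangle _ _ _
        _ < ρ + 2 * ρ := by linarith
        _ = ε := by simp only [ρ]; ring
    have h3 := add_mem_sheetDomain h1 ht
    have := h3.2
    rw [sub_add_cancel, he, sub_self] at this
    exact Complex.slitPlane_ne_zero this rfl
  set e := Complex.sqrt (E : ℂ)
  have he : e ^ 2 = E := csqrt_sq _
  have h1 := key e he
  have h2 := key (-e) (by rw [neg_sq, he])
  have : (κ + t) ^ 2 - E = (κ + t - e) * (κ + t - -e) := by rw [← he]; ring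
  rw [this, norm_mul, sq]
  exact mul_le_mul h1 h2 hρ.le (norm_nonneg _)

lemma norm_sheetWave_le {x : R2} (hx : 0 < x 0) {E ρ M : ℝ} (hρ : 0 < ρ) (hM : 0 ≤ M) {κ : ℂ}
    (hκ : ‖κ‖ ≤ M) (hre : 0 ≤ κ.re) {t : ℝ} (ht : 0 ≤ t) (hlow : ρ ^ 2 ≤ ‖(κ + t) ^ 2 - E‖) :
    ‖sheetWave x E (κ + t)‖ ≤ Real.exp (M * |x 1|) * Real.exp (x 0 * (M + |E| + 1)) / ρ *
      Real.exp (-(x 0 / 2) * t) := by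
  unfold sheetWave
  rw [norm_mul, norm_div, norm_csqrt, Complex.norm_exp, Complex.norm_exp]
  have him : |κ.im| ≤ M := (Complex.abs_im_le_norm κ).trans hκ
  have a1 : Real.exp (Complex.I * ((κ + t) * x 1)).re ≤ Real.exp (M * |x 1|) := by
    gcongr
    have : (Complex.I * ((κ + t) * x 1)).re = -(κ.im * x 1) := by simp
    rw [this]
    calc -(κ.im * x 1) ≤ |κ.im * x 1| := neg_le_abs _
      _ = |κ.im| * |x 1| := abs_mul _ _
      _ ≤ M * |x 1| := by gcongr
  have a2 : (-(x 0 * Complex.sqrt ((κ + t) ^ 2 - E))).re ≤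
      x 0 * (M + |E| + 1) + -(x 0 / 2) * t := by
    have h1 : (κ.re + t) ^ 2 / 4 - (M + |E| + 1) ^ 2 ≤ ((κ + t) ^ 2 - E).re := by
      have : ((κ + t) ^ 2 - E).re = (κ.re + t) ^ 2 - κ.im ^ 2 - E := by simp [sq]
      rw [this]
      have h2 : κ.im ^ 2 ≤ M ^ 2 := by rw [← sq_abs]; gcongr
      nlinarith [le_abs_self E, abs_nonneg E, sq_nonneg (κ.re + t), mul_nonneg hM (abs_nonneg E)]
    have h3 := le_csqrt_re (by positivity) h1
    rw [abs_of_nonneg (by linarith)] at h3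
    have : (-(x 0 * Complex.sqrt ((κ + t) ^ 2 - E))).re =
      -(x 0 * (Complex.sqrt ((κ + t) ^ 2 - E)).re) := by simp
    rw [this]
    nlinarith
  have a3 : ρ ≤ √‖(κ + t) ^ 2 - E‖ := Real.le_sqrt_of_sq_le hlow
  calc _ ≤ Real.exp (M * |x 1|) * (Real.exp (x 0 * (M + |E| + 1) + -(x 0 / 2) * t) / ρ) := by
        gcongr
    _ = _ := by rw [Real.exp_add]; ring

/-- Differentiation under the integral sign: the exponential bound holds on a ball around κ₀, and
Cauchy's estimate on circles of radius ρ/2 transfers it to the derivative. The derivative integrates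
along the ray to minus the value at the starting point. -/
lemma hasDerivAt_rayIntegral {x : R2} (hx : 0 < x 0) {E : ℝ} {κ₀ : ℂ} (h : κ₀ ∈ sheetDomain E) :
    HasDerivAt (rayIntegral x E) (-sheetWave x E κ₀) κ₀ := by
  obtain ⟨ρ, hρ, hb⟩ := exists_sheetDomain_bound h
  set M := ‖κ₀‖ + 2 * ρ
  have hM : 0 ≤ M := by positivity
  set C := Real.exp (M * |x 1|) * Real.exp (x 0 * (M + |E| + 1)) / ρ
  have hC : 0 ≤ C := by positivity
  have hbound : ∀ κ ∈ Metric.ball κ₀ (2 * ρ), ∀ t : ℝ, 0 ≤ t →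
      ‖sheetWave x E (κ + t)‖ ≤ C * Real.exp (-(x 0 / 2) * t) := by
    intro κ hκ t ht
    obtain ⟨h1, h2⟩ := hb κ hκ
    refine norm_sheetWave_le hx hρ hM ?_ h1.1.le ht (h2 t ht)
    have := norm_sub_norm_le κ κ₀
    rw [Metric.mem_ball, dist_eq_norm] at hκ
    simp only [M]; linarith
  have hdiff : ∀ κ ∈ Metric.ball κ₀ (2 * ρ), ∀ t : ℝ, 0 ≤ t →
      HasDerivAt (fun κ => sheetWave x E (κ + t)) (deriv (sheetWave x E) (κ + t)) κ := by
    intro κ hκ t ht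
    have := (differentiableAt_sheetWave x (add_mem_sheetDomain (hb κ hκ).1 ht)).hasDerivAt
    exact this.comp_add_const κ (t : ℂ)
  have hsub : Metric.ball κ₀ ρ ⊆ Metric.ball κ₀ (2 * ρ) := Metric.ball_subset_ball (by linarith)
  have hcont : ∀ κ ∈ Metric.ball κ₀ (2 * ρ), ContinuousOn (fun t : ℝ => sheetWave x E (κ + t))
      (Set.Ici 0) := by
    intro κ hκ t ht
    have h1 := (differentiableAt_sheetWave x (add_mem_sheetDomain (hb κ hκ).1 ht)).continuousAt
    exact (ContinuousAt.comp (f := fun t : ℝ => κ + (t : ℂ)) h1 (by fun_prop)).continuousWithinAt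
  have hmeas : ∀ κ ∈ Metric.ball κ₀ (2 * ρ), AEStronglyMeasurable
      (fun t : ℝ => sheetWave x E (κ + t)) (volume.restrict (Set.Ioi 0)) := fun κ hκ =>
    ((hcont κ hκ).mono Set.Ioi_subset_Ici_self).aestronglyMeasurable measurableSet_Ioi
  have hexp : IntegrableOn (fun t : ℝ => Real.exp (-(x 0 / 2) * t)) (Set.Ioi 0) :=
    integrableOn_exp_mul_Ioi (by linarith) 0
  have h0 : κ₀ ∈ Metric.ball κ₀ (2 * ρ) := Metric.mem_ball_self (by positivity)
  have hint : IntegrableOn (fun t : ℝ => sheetWave x E (κ₀ + t)) (Set.Ioi 0) :=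
    (hexp.const_mul C).mono' (hmeas κ₀ h0)
      ((ae_restrict_iff' measurableSet_Ioi).2 (ae_of_all _ fun t ht => hbound κ₀ h0 t (le_of_lt ht)))
  have hderiv_bound : ∀ κ ∈ Metric.ball κ₀ ρ, ∀ t : ℝ, 0 ≤ t →
      ‖deriv (sheetWave x E) (κ + t)‖ ≤ C / (ρ / 2) * Real.exp (-(x 0 / 2) * t) := by
    intro κ hκ t ht
    rw [← (hdiff κ (hsub hκ) t ht).deriv]
    have hin : ∀ z ∈ Metric.closedBall κ (ρ / 2), z ∈ Metric.ball κ₀ (2 * ρ) := by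
      intro z hz
      rw [Metric.mem_closedBall] at hz
      rw [Metric.mem_ball] at hκ ⊢
      linarith [dist_triangle z κ κ₀]
    refine (Complex.norm_deriv_le_of_forall_mem_sphere_norm_le (by positivity) ?_ fun z hz =>
      hbound z (hin z (Metric.sphere_subset_closedBall hz)) t ht).trans (le_of_eq (by ring))
    refine DifferentiableOn.diffContOnCl fun z hz => ?_
    rw [closure_ball κ (by positivity)] at hz
    exact (hdiff z (hin z hz) t ht).differentiableAt.differentiableWithinAt
  have hd_cont : ContinuousOn (fun t : ℝ => deriv (sheetWave x E) (κ₀ + t)) (Set.Ici 0) := by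
    intro t ht
    have h1 : ContinuousAt (deriv (sheetWave x E)) (κ₀ + t) := by
      have ho : DifferentiableOn ℂ (sheetWave x E) (sheetDomain E) := fun z hz =>
        (differentiableAt_sheetWave x hz).differentiableWithinAt
      exact ((ho.deriv (isOpen_sheetDomain E)).continuousOn).continuousAt
        ((isOpen_sheetDomain E).mem_nhds (add_mem_sheetDomain h ht))
    exact (ContinuousAt.comp (f := fun t : ℝ => κ₀ + (t : ℂ)) h1 (by fun_prop)).continuousWithinAt
  have hmain := hasDerivAt_integral_of_dominated_loc_of_deriv_le
    (μ := volume.restrict (Set.Ioi (0 : ℝ))) (F := fun κ t => sheetWave x E (κ + (t : ℝ)))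
    (F' := fun κ t => deriv (sheetWave x E) (κ + (t : ℝ))) (x₀ := κ₀) (s := Metric.ball κ₀ ρ)
    (bound := fun t => C / (ρ / 2) * Real.exp (-(x 0 / 2) * t))
    (Metric.ball_mem_nhds κ₀ hρ)
    (by filter_upwards [Metric.ball_mem_nhds κ₀ hρ] with κ hκ using hmeas κ (hsub hκ))
    hint
    ((hd_cont.mono Set.Ioi_subset_Ici_self).aestronglyMeasurable measurableSet_Ioi)
    ((ae_restrict_iff' measurableSet_Ioi).2 (ae_of_all _ fun t ht κ hκ =>
      hderiv_bound κ hκ t (le_of_lt ht)))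
    (hexp.const_mul _)
    ((ae_restrict_iff' measurableSet_Ioi).2 (ae_of_all _ fun t ht κ hκ =>
      hdiff κ (hsub hκ) t (le_of_lt ht)))
  have hval : ∫ t in Set.Ioi (0 : ℝ), deriv (sheetWave x E) (κ₀ + t) = -sheetWave x E κ₀ := by
    have h1 := integral_Ioi_of_hasDerivAt_of_tendsto (a := (0 : ℝ)) (m := 0)
      (f := fun t : ℝ => sheetWave x E (κ₀ + t))
      (f' := fun t : ℝ => deriv (sheetWave x E) (κ₀ + t))
      (hcont κ₀ h0 0 (Set.mem_Ici.2 le_rfl)) (fun t ht => ?_) hmain.1 ?_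
    · simpa using h1
    · have h2 := (differentiableAt_sheetWave x
        (add_mem_sheetDomain h (le_of_lt (Set.mem_Ioi.1 ht)))).hasDerivAt
      have h3 : HasDerivAt (fun t : ℝ => κ₀ + (t : ℂ)) 1 t :=
        (Complex.ofRealCLM.hasDerivAt (x := t)).const_add κ₀
      have := HasDerivAt.comp (h := fun t : ℝ => κ₀ + (t : ℂ)) t h2 h3
      simpa [Function.comp_def] using this
    · have hz : Tendsto (fun t : ℝ => C * Real.exp (-(x 0 / 2) * t)) atTop (𝓝 0) := by
        have h4 : Tendsto (fun t : ℝ => Real.exp (-(x 0 / 2) * t)) atTop (𝓝 0) :=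
          Real.tendsto_exp_atBot.comp
            (tendsto_id.const_mul_atTop_of_neg (by linarith : -(x 0 / 2) < 0))
        simpa using h4.const_mul C
      refine squeeze_zero_norm' ?_ hz
      filter_upwards [eventually_ge_atTop 0] with t ht using hbound κ₀ h0 t ht
  have := hmain.2
  rw [hval] at this
  exact this

/-! ### Differentiating `G` along the energy curve -/

/-- The real-linear map `v ↦ Re (c v)`. -/
noncomputable def reMul (c : ℂ) : ℂ →L[ℝ] ℂ :=
  Complex.ofRealCLM ∘L Complex.reCLM ∘L (c • ContinuousLinearMap.id ℝ ℂ)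

@[simp] lemma reMul_apply (c v : ℂ) : reMul c v = ((c * v).re : ℂ) := by simp [reMul]

/-- The curve `k` solves the differential equation of the energy curve at `z`. -/
def IsEnergyCurveAt (k : ℂ → C2) (z : ℂ) : Prop :=
  HasDerivAt (fun w => k w 0) (Complex.I / z * k z 1) z ∧
    HasDerivAt (fun w => k w 1) (-(Complex.I / z) * k z 0) z

lemma IsEnergyCurveAt.rot {k : ℂ → C2} {z : ℂ} (h : IsEnergyCurveAt k z) (c s : ℝ) :
    IsEnergyCurveAt (fun w => rotC c s (k w)) z := by
  constructor
  · refine ((h.1.const_mul (c : ℂ)).sub (h.2.const_mul (s : ℂ))).congr_deriv ?_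
    simp; ring
  · refine ((h.1.const_mul (s : ℂ)).add (h.2.const_mul (c : ℂ))).congr_deriv ?_
    simp; ring

lemma continuousAt_C2 {k : ℂ → C2} {z : ℂ} (h0 : ContinuousAt (fun w => k w 0) z)
    (h1 : ContinuousAt (fun w => k w 1) z) : ContinuousAt k z := by
  have : k = fun w => (!₂[k w 0, k w 1] : C2) := by
    ext w i; fin_cases i <;> rfl
  rw [this]
  fun_prop

lemma IsEnergyCurveAt.continuousAt {k : ℂ → C2} {z : ℂ} (h : IsEnergyCurveAt k z) :
    ContinuousAt k z := continuousAt_C2 h.1.continuousAt h.2.continuousAt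

lemma hasFDerivAt_re_of_hasDerivAt {f : ℂ → ℂ} {c z : ℂ} (h : HasDerivAt f c z) (a : ℝ) :
    HasFDerivAt (fun w => ((a * (f w).re : ℝ) : ℂ)) (a • reMul c) z := by
  have h3 := Complex.ofRealCLM.hasFDerivAt.comp z
    (((Complex.reCLM.hasFDerivAt.comp z (h.hasFDerivAt.restrictScalars ℝ))).const_mul a)
  refine h3.congr_fderiv ?_
  ext v
  simp [mul_comm]

/-- On the curve, √(k₂² - E) = -ik₁ because Im k₁ > 0, so `sheetWave` at k₂ is e^{ikx}/(-ik₁). The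
derivative of k₂ is -(i/z)k₁; the factor k₁ cancels and the ray integral has derivative -e^{ikx}/z.
-/
lemma hasFDerivAt_faddeevG_of_pos {x : R2} (hx : 0 < x 0) {k : ℂ → C2} {z : ℂ}
    (hk : IsEnergyCurveAt k z) {E : ℝ} (hE : ∀ᶠ w in 𝓝 z, k w 0 ^ 2 + k w 1 ^ 2 = E)
    (hq : 0 < (k z 0).im) (hp : 0 < (k z 1).re) :
    HasFDerivAt (fun w => faddeevG x (k w))
      ((1 / (2 * Real.pi)) • reMul (Complex.exp (Complex.I * bdot (k z) x) / z)) z := by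
  have hEz : k z 0 ^ 2 + k z 1 ^ 2 = E := hE.self_of_nhds
  have hS : (-(Complex.I * k z 0)) ^ 2 = k z 1 ^ 2 - E := by
    rw [← hEz]; linear_combination k z 0 ^ 2 * Complex.I_sq
  have hSre : 0 < (-(Complex.I * k z 0)).re := by simpa using hq
  have hsqrt := csqrt_eq_of_sq hS hSre
  have hk0 : k z 0 ≠ 0 := by intro h; rw [h] at hq; simp at hq
  have hmem : k z 1 ∈ sheetDomain E := by
    refine ⟨hp, ?_⟩
    rw [← hS, Complex.mem_slitPlane_iff]
    by_contra hcon
    push Not at hcon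
    simp only [sq, Complex.mul_re, Complex.mul_im, Complex.neg_re, Complex.neg_im, Complex.I_re,
      Complex.I_im, zero_mul, one_mul, zero_sub, zero_add, neg_neg] at hcon
    obtain ⟨h1, h2⟩ := hcon
    have h3 : (k z 0).re = 0 := by
      have : (k z 0).im * (k z 0).re = 0 := by nlinarith
      exact (mul_eq_zero.1 this).resolve_left hq.ne'
    rw [h3] at h1; nlinarith
  have hev : (fun w => ((-(1 / (2 * Real.pi)) * (rayIntegral x E (k w 1)).re : ℝ) : ℂ)) =ᶠ[𝓝 z]
      fun w => faddeevG x (k w) := by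
    have h1 : ∀ᶠ w in 𝓝 z, 0 < (k w 0).im :=
      (Complex.continuous_im.continuousAt.comp hk.1.continuousAt).eventually_const_lt hq
    have h2 : ∀ᶠ w in 𝓝 z, 0 < (k w 1).re :=
      (Complex.continuous_re.continuousAt.comp hk.2.continuousAt).eventually_const_lt hp
    filter_upwards [hE, h1, h2] with w hw1 hw2 hw3
    exact (faddeevG_eq_rayIntegral hx hw1 hw2 hw3).symm
  refine HasFDerivAt.congr_of_eventuallyEq ?_ hev.symm
  have hd : HasDerivAt (fun w => rayIntegral x E (k w 1))
      (-(Complex.exp (Complex.I * bdot (k z) x) / z)) z := by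
    have := HasDerivAt.comp z (hasDerivAt_rayIntegral hx hmem) hk.2
    refine this.congr_deriv ?_
    rw [sheetWave, hsqrt, bdot]
    have e : Complex.exp (Complex.I * (k z 0 * x 0 + k z 1 * x 1)) =
        Complex.exp (Complex.I * (k z 1 * x 1)) *
          Complex.exp (-((x 0 : ℂ) * -(Complex.I * k z 0))) := by
      rw [← Complex.exp_add]; congr 1; ring
    rw [e]
    have hI := Complex.I_ne_zero
    field_simp
  refine (hasFDerivAt_re_of_hasDerivAt hd (-(1 / (2 * Real.pi)))).congr_fderiv ?_
  ext v
  simp; ring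

lemma rot_orientation {c s : ℝ} (h : c ^ 2 + s ^ 2 = 1) (k : C2) :
    (rotC c s k 1).re * (rotC c s k 0).im - (rotC c s k 0).re * (rotC c s k 1).im =
      (k 1).re * (k 0).im - (k 0).re * (k 1).im := by
  simp
  linear_combination ((k 1).re * (k 0).im - (k 0).re * (k 1).im) * h

/-- The bisector ‖q‖x + ‖x‖q works, by strict Cauchy-Schwarz for non-parallel vectors. -/
lemma exists_common_positive {x q : R2} (h : x 0 * q 1 - x 1 * q 0 ≠ 0) :
    ∃ n : R2, 0 < n 0 * x 0 + n 1 * x 1 ∧ 0 < n 0 * q 0 + n 1 * q 1 := by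
  have hx : x ≠ 0 := by rintro rfl; simp at h
  have hq : q ≠ 0 := by rintro rfl; simp at h
  have nx := norm_pos_iff.2 hx
  have nq := norm_pos_iff.2 hq
  have sx := R2.norm_sq x
  have sq' := R2.norm_sq q
  have hcs : |x 0 * q 0 + x 1 * q 1| < ‖x‖ * ‖q‖ := by
    rw [← abs_of_pos (mul_pos nx nq)]
    refine sq_lt_sq.1 ?_
    rw [mul_pow, sx, sq']
    nlinarith [sq_pos_of_ne_zero h]
  have h1 := (abs_lt.1 hcs).1
  refine ⟨‖q‖ • x + ‖x‖ • q, ?_, ?_⟩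
  · simp
    have : (‖q‖ * x 0 + ‖x‖ * q 0) * x 0 + (‖q‖ * x 1 + ‖x‖ * q 1) * x 1 =
      ‖x‖ * (‖x‖ * ‖q‖ + (x 0 * q 0 + x 1 * q 1)) := by
      linear_combination (-‖q‖) * sx
    rw [this]; apply mul_pos nx; linarith
  · simp
    have : (‖q‖ * x 0 + ‖x‖ * q 0) * q 0 + (‖q‖ * x 1 + ‖x‖ * q 1) * q 1 =
      ‖q‖ * (‖x‖ * ‖q‖ + (x 0 * q 0 + x 1 * q 1)) := by
      linear_combination (-‖x‖) * sq'
    rw [this]; apply mul_pos nq; linarith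

/-- The bisecting direction of x and Im k is turned to the first axis, which makes x₁ and Im k₁
positive. Real energy means that Re k and Im k are orthogonal, and the orientation, being invariant
under rotation, then forces Re k₂ > 0. -/
lemma hasFDerivAt_faddeevG_of_cross_ne {x : R2} {k : ℂ → C2} {z : ℂ}
    (hk : IsEnergyCurveAt k z) {E : ℝ} (hE : ∀ᶠ w in 𝓝 z, k w 0 ^ 2 + k w 1 ^ 2 = E)
    (hor : 0 < (k z 1).re * (k z 0).im - (k z 0).re * (k z 1).im)
    (hcross : x 0 * (k z 1).im - x 1 * (k z 0).im ≠ 0) :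
    HasFDerivAt (fun w => faddeevG x (k w))
      ((1 / (2 * Real.pi)) • reMul (Complex.exp (Complex.I * bdot (k z) x) / z)) z := by
  obtain ⟨n, h1, h2⟩ := exists_common_positive (x := x) (q := imVec (k z)) (by simpa using hcross)
  have hn : n ≠ 0 := by rintro rfl; simp at h1
  obtain ⟨c, s, hcs, hrot⟩ := exists_rot_pos n hn
  have nn := norm_pos_iff.2 hn
  have hx' : 0 < rotR c s x 0 := by
    have := (hrot x).1
    exact (pos_iff_pos_of_mul_pos (by rw [this]; exact h1)).1 nn
  have hq' : 0 < (rotC c s (k z) 0).im := by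
    have := (hrot (imVec (k z))).1
    have h3 := (pos_iff_pos_of_mul_pos (by rw [this]; exact h2)).1 nn
    rwa [← imVec_rotC, imVec_zero] at h3
  have hE' : ∀ᶠ w in 𝓝 z, rotC c s (k w) 0 ^ 2 + rotC c s (k w) 1 ^ 2 = E := by
    filter_upwards [hE] with w hw
    rw [sum_sq_rotC hcs, hw]
  have hp' : 0 < (rotC c s (k z) 1).re := by
    rw [← rot_orientation hcs] at hor
    have hEz := hE'.self_of_nhds
    have him := congrArg Complex.im hEz
    simp only [sq, Complex.add_im, Complex.mul_im, Complex.ofReal_im] at him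
    set a := (rotC c s (k z) 0).im
    set b := (rotC c s (k z) 1).im
    set p := (rotC c s (k z) 1).re
    set p' := (rotC c s (k z) 0).re
    have h3 : 0 < p * (a ^ 2 + b ^ 2) := by
      have : p * (a ^ 2 + b ^ 2) = a * (p * a - p' * b) := by linear_combination (b / 2) * him
      rw [this]; exact mul_pos hq' hor
    exact (pos_iff_pos_of_mul_pos h3).2 (by positivity)
  have := hasFDerivAt_faddeevG_of_pos hx' (hk.rot c s) hE' hq' hp'
  simpa only [faddeevG_rot hcs, bdot_rot hcs] using this

/-- The segment from a point of the line ℓ = 0 to a point off it meets the line only at its start,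
so D is constant along it by continuity and vanishing derivative. -/
lemma eq_of_segment {D : ℂ → ℂ} {z₀ : ℂ} {ε : ℝ} (hc : ContinuousOn D (Metric.ball z₀ ε))
    (ℓ : ℂ →L[ℝ] ℝ) (hd : ∀ w ∈ Metric.ball z₀ ε, ℓ w ≠ 0 → HasFDerivAt D (0 : ℂ →L[ℝ] ℂ) w)
    {w μ : ℂ} (hw : w ∈ Metric.ball z₀ ε) (hμ : μ ∈ Metric.ball z₀ ε) (h0 : ℓ w = 0)
    (h1 : ℓ μ ≠ 0) : D w = D μ := by
  set γ : ℝ → ℂ := fun s => w + s * (μ - w) with hγ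
  have hmem : ∀ s ∈ Set.Icc (0 : ℝ) 1, γ s ∈ Metric.ball z₀ ε := by
    intro s hs
    have := (convex_ball z₀ ε).add_smul_sub_mem hw hμ hs
    simpa [hγ, Complex.real_smul] using this
  have hcγ : Continuous γ := by fun_prop
  have hℓ : ∀ s : ℝ, ℓ (γ s) = s * ℓ μ := by
    intro s
    have : γ s = w + s • (μ - w) := by simp [hγ, Complex.real_smul]
    rw [this, map_add, map_smul, map_sub, h0]; simp
  have h := intervalIntegral.integral_eq_sub_of_hasDerivAt_of_le (zero_le_one' ℝ)
    (f := D ∘ γ) (f' := fun _ => 0) (hc.comp hcγ.continuousOn hmem) (fun s hs => ?_)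
    (by simp)
  · simp [hγ] at h
    exact (sub_eq_zero.1 h.symm).symm
  · have hd1 := hd (γ s) (hmem s (Set.Ioo_subset_Icc_self hs))
      (by rw [hℓ]; exact mul_ne_zero hs.1.ne' h1)
    have hγ' : HasDerivAt γ (1 * (μ - w)) s :=
      ((Complex.ofRealCLM.hasDerivAt (x := s)).mul_const (μ - w)).const_add w
    have := hd1.comp_hasDerivAt s hγ'
    simpa using this

/-- The differential of `G` along a positively oriented energy curve. -/
lemma hasFDerivAt_faddeevG {x : R2} (hx : x ≠ 0) {k : ℂ → C2} {z : ℂ} (hz : z ≠ 0)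
    (hk : ∀ᶠ w in 𝓝 z, IsEnergyCurveAt k w) {E : ℝ}
    (hE : ∀ᶠ w in 𝓝 z, k w 0 ^ 2 + k w 1 ^ 2 = E)
    (hor : ∀ᶠ w in 𝓝 z, 0 < (k w 1).re * (k w 0).im - (k w 0).re * (k w 1).im)
    (ℓ : ℂ →L[ℝ] ℝ) {v : ℂ} (hv : ℓ v ≠ 0)
    (hcross : ∀ᶠ w in 𝓝 z, ℓ w ≠ 0 → x 0 * (k w 1).im - x 1 * (k w 0).im ≠ 0) :
    HasFDerivAt (fun w => faddeevG x (k w))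
      ((1 / (2 * Real.pi)) • reMul (Complex.exp (Complex.I * bdot (k z) x) / z)) z := by
  by_cases hℓz : ℓ z = 0
  swap
  · exact hasFDerivAt_faddeevG_of_cross_ne hk.self_of_nhds hE hor.self_of_nhds
      (hcross.self_of_nhds hℓz)
  have hall := hk.and (hE.eventually_nhds.and (hor.and (hcross.and (eventually_ne_nhds hz))))
  obtain ⟨ε, hε, hball⟩ := Metric.eventually_nhds_iff_ball.1 hall
  set wave : ℂ → ℂ := fun w => Complex.exp (Complex.I * bdot (k w) x) / w with hwave
  have hwd : DifferentiableOn ℂ wave (Metric.ball z ε) := by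
    intro w hw
    obtain ⟨h1, -, -, -, h5⟩ := hball w hw
    have h6 : DifferentiableAt ℂ (fun w => bdot (k w) x) w := by
      unfold bdot
      exact (h1.1.differentiableAt.mul_const _).add (h1.2.differentiableAt.mul_const _)
    exact ((h6.const_mul Complex.I).cexp.div differentiableAt_id h5).differentiableWithinAt
  -- With Ω a holomorphic primitive of e^{ikx}/w, the function D = G - (1/2π) Re Ω is continuous and
  -- has zero differential off the line ℓ = 0. It is therefore constant on the ball, and the formula
  -- for the differential extends to the line.
  obtain ⟨Ω, hΩ⟩ := hwd.isExactOn_ball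
  set a : ℝ := 1 / (2 * Real.pi)
  set D : ℂ → ℂ := fun w => faddeevG x (k w) - ((a * (Ω w).re : ℝ) : ℂ) with hD
  have him : ∀ w ∈ Metric.ball z ε, imVec (k w) ≠ 0 := by
    intro w hw h
    obtain ⟨-, -, h3, -⟩ := hball w hw
    have i0 := congrArg (fun v : R2 => v 0) h
    have i1 := congrArg (fun v : R2 => v 1) h
    simp at i0 i1
    rw [i0, i1] at h3; simp at h3
  have hDc : ContinuousOn D (Metric.ball z ε) := by
    intro w hw
    refine ContinuousAt.continuousWithinAt ?_
    have hkc := (hball w hw).1.continuousAt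
    have c1 : ContinuousAt (fun w => faddeevG x (k w)) w := by
      unfold faddeevG bdot
      have hg : ContinuousAt (fun w => g x (k w)) w :=
        ContinuousAt.comp (g := g x) (f := k) (continuousAt_g hx (him w hw)) hkc
      have := (hball w hw).1.1.continuousAt
      have := (hball w hw).1.2.continuousAt
      fun_prop
    have c2 := (hΩ w hw).continuousAt
    exact c1.sub (hasFDerivAt_re_of_hasDerivAt (hΩ w hw) a).continuousAt
  have hDd : ∀ w ∈ Metric.ball z ε, ℓ w ≠ 0 → HasFDerivAt D (0 : ℂ →L[ℝ] ℂ) w := by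
    intro w hw hℓ
    obtain ⟨h1, h2, h3, h4, -⟩ := hball w hw
    have := (hasFDerivAt_faddeevG_of_cross_ne (x := x) h1 h2 h3 (h4 hℓ)).sub
      (hasFDerivAt_re_of_hasDerivAt (hΩ w hw) a)
    rwa [sub_self] at this
  obtain ⟨μ, hμ, hℓμ⟩ : ∃ μ ∈ Metric.ball z ε, ℓ μ ≠ 0 := by
    have hv0 : v ≠ 0 := by rintro rfl; simp at hv
    have hvn := norm_pos_iff.2 hv0
    refine ⟨z + (ε / (2 * ‖v‖)) • v, ?_, ?_⟩
    · rw [Metric.mem_ball, dist_eq_norm, add_sub_cancel_left, norm_smul, Real.norm_of_nonneg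
        (by positivity)]
      field_simp; norm_num
    · rw [map_add, hℓz, map_smul, zero_add]
      exact smul_ne_zero (by positivity) hv
  have hconst : ∀ w ∈ Metric.ball z ε, D w = D z := by
    have hzμ := eq_of_segment hDc ℓ hDd (Metric.mem_ball_self hε) hμ hℓz hℓμ
    intro w hw
    by_cases h : ℓ w = 0
    · rw [eq_of_segment hDc ℓ hDd hw hμ h hℓμ, hzμ]
    · exact (eq_of_segment hDc ℓ hDd (Metric.mem_ball_self hε) hw hℓz h).symm
  have hev : (fun w => D z + ((a * (Ω w).re : ℝ) : ℂ)) =ᶠ[𝓝 z] fun w => faddeevG x (k w) := by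
    filter_upwards [Metric.ball_mem_nhds z hε] with w hw
    rw [← hconst w hw, hD]; simp
  refine HasFDerivAt.congr_of_eventuallyEq ?_ hev.symm
  exact (hasFDerivAt_re_of_hasDerivAt (hΩ z (Metric.mem_ball_self hε)) a).const_add _

/-! ### The energy curves -/

@[simp] lemma kE_zero (E : ℝ) (z : ℂ) : kE E z 0 = (1 / z + z) * (sqrtC E / 2) := rfl
@[simp] lemma kE_one (E : ℝ) (z : ℂ) : kE E z 1 = (1 / z - z) * (Complex.I * sqrtC E / 2) := rfl
@[simp] lemma kZero_zero (σ : ℝ) (z : ℂ) : kZero σ z 0 = z := rfl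
@[simp] lemma kZero_one (σ : ℝ) (z : ℂ) : kZero σ z 1 = (σ : ℂ) * Complex.I * z := rfl

lemma sqrtC_of_pos {E : ℝ} (hE : 0 < E) : sqrtC E = (√E : ℝ) := if_pos hE.le

lemma sqrtC_of_neg {E : ℝ} (hE : E < 0) : sqrtC E = Complex.I * (√(-E) : ℝ) :=
  if_neg (not_le.2 hE)

lemma sqrtC_sq (E : ℝ) : sqrtC E ^ 2 = E := by
  unfold sqrtC
  split_ifs with h
  · rw [← Complex.ofReal_pow, Real.sq_sqrt h]
  · rw [mul_pow, Complex.I_sq, ← Complex.ofReal_pow, Real.sq_sqrt (by linarith)]; simp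

lemma sum_sq_kE (E : ℝ) {z : ℂ} (hz : z ≠ 0) : kE E z 0 ^ 2 + kE E z 1 ^ 2 = E := by
  rw [← sqrtC_sq E, kE_zero, kE_one]
  field_simp
  linear_combination sqrtC E ^ 2 * (1 - z ^ 2) ^ 2 * Complex.I_sq

lemma sum_sq_kZero {σ : ℝ} (hσ : σ = 1 ∨ σ = -1) (z : ℂ) :
    kZero σ z 0 ^ 2 + kZero σ z 1 ^ 2 = (0 : ℝ) := by
  rcases hσ with rfl | rfl <;> simp [mul_pow]

lemma isEnergyCurveAt_kE (E : ℝ) {z : ℂ} (hz : z ≠ 0) : IsEnergyCurveAt (kE E) z := by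
  have h1 : HasDerivAt (fun w : ℂ => 1 / w) (-(z ^ 2)⁻¹) z := by
    simpa only [one_div] using hasDerivAt_inv hz
  constructor
  · refine ((h1.add (hasDerivAt_id z)).mul_const (sqrtC E / 2)).congr_deriv ?_
    rw [kE_one]
    field_simp
    linear_combination (-(1 - z ^ 2)) * sqrtC E * Complex.I_sq
  · refine ((h1.sub (hasDerivAt_id z)).mul_const (Complex.I * sqrtC E / 2)).congr_deriv ?_
    rw [kE_zero]
    field_simp
    ring

lemma isEnergyCurveAt_kZero {z : ℂ} (hz : z ≠ 0) : IsEnergyCurveAt (kZero (-1)) z := by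
  constructor
  · refine (hasDerivAt_id z).congr_deriv ?_
    simp; field_simp; simp
  · refine ((hasDerivAt_id z).const_mul (((-1 : ℝ) : ℂ) * Complex.I)).congr_deriv ?_
    simp; field_simp

lemma kE_coords_of_pos {E : ℝ} (hE : 0 < E) (z : ℂ) :
    (kE E z 0).re = (1 / Complex.normSq z + 1) * z.re * (√E / 2) ∧
    (kE E z 0).im = (1 - 1 / Complex.normSq z) * z.im * (√E / 2) ∧
    (kE E z 1).re = (1 / Complex.normSq z + 1) * z.im * (√E / 2) ∧
    (kE E z 1).im = (1 / Complex.normSq z - 1) * z.re * (√E / 2) := by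
  have e0 : kE E z 0 = (z⁻¹ + z) * ((√E / 2 : ℝ) : ℂ) := by
    rw [kE_zero, sqrtC_of_pos hE]; push_cast; ring
  have e1 : kE E z 1 = (z⁻¹ - z) * Complex.I * ((√E / 2 : ℝ) : ℂ) := by
    rw [kE_one, sqrtC_of_pos hE]; push_cast; ring
  rw [e0, e1]
  simp only [Complex.re_mul_ofReal, Complex.im_mul_ofReal, Complex.mul_I_re, Complex.mul_I_im,
    Complex.add_re, Complex.add_im, Complex.sub_re, Complex.sub_im, Complex.inv_re, Complex.inv_im]
  refine ⟨by ring, by ring, by ring, by ring⟩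

lemma kE_coords_of_neg {E : ℝ} (hE : E < 0) (z : ℂ) :
    (kE E z 0).re = (1 / Complex.normSq z - 1) * z.im * (√(-E) / 2) ∧
    (kE E z 0).im = (1 / Complex.normSq z + 1) * z.re * (√(-E) / 2) ∧
    (kE E z 1).re = (1 - 1 / Complex.normSq z) * z.re * (√(-E) / 2) ∧
    (kE E z 1).im = (1 / Complex.normSq z + 1) * z.im * (√(-E) / 2) := by
  have e0 : kE E z 0 = (z⁻¹ + z) * Complex.I * ((√(-E) / 2 : ℝ) : ℂ) := by
    rw [kE_zero, sqrtC_of_neg hE]; push_cast; ring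
  have e1 : kE E z 1 = (z - z⁻¹) * ((√(-E) / 2 : ℝ) : ℂ) := by
    rw [kE_one, sqrtC_of_neg hE]; push_cast
    linear_combination ((1 / z - z) * √(-E) / 2) * Complex.I_sq
  rw [e0, e1]
  simp only [Complex.re_mul_ofReal, Complex.im_mul_ofReal, Complex.mul_I_re, Complex.mul_I_im,
    Complex.add_re, Complex.add_im, Complex.sub_re, Complex.sub_im, Complex.inv_re, Complex.inv_im]
  refine ⟨by ring, by ring, by ring, by ring⟩

lemma kE_orientation {E : ℝ} (hE : E ≠ 0) {z : ℂ} (hz : 1 < ‖z‖) :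
    0 < (kE E z 1).re * (kE E z 0).im - (kE E z 0).re * (kE E z 1).im := by
  have hN : 1 < Complex.normSq z := by rw [Complex.normSq_eq_norm_sq]; nlinarith
  have hN' : Complex.normSq z = z.re ^ 2 + z.im ^ 2 := by rw [Complex.normSq_apply]; ring
  set N := Complex.normSq z with hNdef
  have h2 : 0 < 1 - 1 / N := by rw [sub_pos, div_lt_one (by linarith)]; exact hN
  have h3 : 0 < 1 / N + 1 := by positivity
  rcases lt_or_gt_of_ne hE with h | h
  · obtain ⟨a, b, c, d⟩ := kE_coords_of_neg h z
    have hs := Real.sqrt_pos.2 (neg_pos.2 h)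
    rw [a, b, c, d]
    have : 0 < (1 - 1 / N) * (1 / N + 1) * N * (√(-E) / 2) ^ 2 := by positivity
    convert this using 1
    rw [← hNdef]
    linear_combination (-((1 - 1 / N) * (1 / N + 1) * (√(-E) / 2) ^ 2)) * hN'
  · obtain ⟨a, b, c, d⟩ := kE_coords_of_pos h z
    have hs := Real.sqrt_pos.2 h
    rw [a, b, c, d]
    have : 0 < (1 - 1 / N) * (1 / N + 1) * N * (√E / 2) ^ 2 := by positivity
    convert this using 1
    rw [← hNdef]
    linear_combination (-((1 - 1 / N) * (1 / N + 1) * (√E / 2) ^ 2)) * hN'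

lemma imVec_ne_zero_of_orientation {k : C2}
    (h : 0 < (k 1).re * (k 0).im - (k 0).re * (k 1).im) : imVec k ≠ 0 := by
  intro h0
  have i0 := congrArg (fun v : R2 => v 0) h0
  have i1 := congrArg (fun v : R2 => v 1) h0
  simp at i0 i1
  rw [i0, i1] at h; simp at h

lemma negConj_kE_of_pos {E : ℝ} (hE : 0 < E) (z : ℂ) :
    negConj (kE E z) = kE E (-1 / (starRingEnd ℂ) z) := by
  apply C2.ext
  · simp only [negConj_zero, kE_zero, sqrtC_of_pos hE, map_mul, map_add, map_div₀, map_one,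
      Complex.conj_ofReal, map_ofNat, one_div_div]
    ring
  · simp only [negConj_one, kE_one, sqrtC_of_pos hE, map_mul, map_sub, map_div₀, map_one,
      Complex.conj_ofReal, map_ofNat, one_div_div, Complex.conj_I]
    ring

lemma negConj_kE_of_neg {E : ℝ} (hE : E < 0) (z : ℂ) :
    negConj (kE E z) = kE E (1 / (starRingEnd ℂ) z) := by
  apply C2.ext
  · simp only [negConj_zero, kE_zero, sqrtC_of_neg hE, map_mul, map_add, map_div₀, map_one,
      Complex.conj_ofReal, map_ofNat, one_div_div, Complex.conj_I]
    ring
  · simp only [negConj_one, kE_one, sqrtC_of_neg hE, map_mul, map_sub, map_div₀, map_one,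
      Complex.conj_ofReal, map_ofNat, one_div_div, Complex.conj_I]
    ring

lemma negConj_kZero (z : ℂ) : negConj (kZero 1 z) = kZero (-1) (-(starRingEnd ℂ) z) := by
  apply C2.ext <;> simp

/-- On the energy curve the antipodal parameter is `c / z̄`. -/
lemma exists_negConj_kE {E : ℝ} (hE : E ≠ 0) : ∃ c : ℝ, (c = 1 ∨ c = -1) ∧
    ∀ z, negConj (kE E z) = kE E (c / (starRingEnd ℂ) z) := by
  rcases lt_or_gt_of_ne hE with h | h
  · exact ⟨1, Or.inl rfl, fun z => by simpa using negConj_kE_of_neg h z⟩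
  · exact ⟨-1, Or.inr rfl, fun z => by simpa using negConj_kE_of_pos h z⟩

lemma imVec_kE_ne_zero {E : ℝ} (hE : E ≠ 0) {z : ℂ} (hz : z ≠ 0) (h1 : ‖z‖ ≠ 1) :
    imVec (kE E z) ≠ 0 := by
  rcases lt_or_gt_of_ne h1 with h | h
  · obtain ⟨c, hc, hk⟩ := exists_negConj_kE hE
    rw [← imVec_negConj, hk]
    refine imVec_ne_zero_of_orientation (kE_orientation hE ?_)
    have : ‖(c : ℂ)‖ = 1 := by rcases hc with rfl | rfl <;> simp
    rw [norm_div, this, Complex.norm_conj]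
    exact (one_lt_div (norm_pos_iff.2 hz)).2 h
  · exact imVec_ne_zero_of_orientation (kE_orientation hE h)

lemma imVec_kE_ne_zero_of_neg {E : ℝ} (hE : E < 0) {z : ℂ} (hz : z ≠ 0) : imVec (kE E z) ≠ 0 := by
  obtain ⟨-, b, -, d⟩ := kE_coords_of_neg hE z
  have hN : 0 < Complex.normSq z := Complex.normSq_pos.2 hz
  have hN' : Complex.normSq z = z.re ^ 2 + z.im ^ 2 := by rw [Complex.normSq_apply]; ring
  have hs := Real.sqrt_pos.2 (neg_pos.2 hE)
  rw [R2.ne_zero_iff, imVec_zero, imVec_one, b, d]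
  have : 0 < ((1 / Complex.normSq z + 1) * (√(-E) / 2)) ^ 2 * Complex.normSq z := by positivity
  convert this using 1
  rw [hN']; ring

lemma imVec_kZero_ne_zero {σ : ℝ} (hσ : σ = 1 ∨ σ = -1) {z : ℂ} (hz : z ≠ 0) :
    imVec (kZero σ z) ≠ 0 := by
  have hN : 0 < Complex.normSq z := Complex.normSq_pos.2 hz
  rw [Complex.normSq_apply] at hN
  rw [R2.ne_zero_iff]
  rcases hσ with rfl | rfl <;> simp <;> nlinarith

/-- The reflection k ↦ -k̄ conjugates G, and G is real. This symmetry relates the inside and the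
outside of the unit circle. -/
lemma faddeevG_kE_neg {x : R2} (hx : x ≠ 0) {E : ℝ} {z w : ℂ} (hz : z ≠ 0)
    (him : imVec (kE E z) ≠ 0) (h : negConj (kE E z) = kE E w) :
    faddeevG x (kE E z) = faddeevG x (kE E w) := by
  rw [← h, faddeevG_negConj hx him, conj_faddeevG hx him (sum_sq_kE E hz)]

/-- The differential of `G` on the energy curve `k_E`, outside the unit circle. -/
lemma hasFDerivAt_faddeevG_kE_of_one_lt {x : R2} (hx : x ≠ 0) {E : ℝ} (hE : E ≠ 0) {z : ℂ}
    (h1 : 1 < ‖z‖) : HasFDerivAt (fun w => faddeevG x (kE E w))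
      ((1 / (2 * Real.pi)) • reMul (Complex.exp (Complex.I * bdot (kE E z) x) / z)) z := by
  have hz : z ≠ 0 := by rintro rfl; simp at h1; linarith
  have hev : ∀ᶠ w in 𝓝 z, 1 < ‖w‖ := continuous_norm.continuousAt.eventually_const_lt h1
  have hev0 : ∀ᶠ w in 𝓝 z, w ≠ 0 := eventually_ne_nhds hz
  have hρ := R2.ne_zero_iff.1 hx
  rcases lt_or_gt_of_ne hE with h | h
  -- At negative energy Im k_E(w) is a positive multiple of (Re w, Im w), so it is parallel to x
  -- only on the line x₁ Im w = x₂ Re w.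
  · refine hasFDerivAt_faddeevG hx hz (hev0.mono fun w hw => isEnergyCurveAt_kE E hw)
      (hev0.mono fun w hw => sum_sq_kE E hw) (hev.mono fun w hw => kE_orientation hE hw)
      (x 0 • Complex.imCLM - x 1 • Complex.reCLM) (v := ⟨-(x 1), x 0⟩) ?_ ?_
    · simp; nlinarith
    · filter_upwards [hev0] with w hw hℓ
      obtain ⟨-, b, -, d⟩ := kE_coords_of_neg h w
      have hN : 0 < Complex.normSq w := Complex.normSq_pos.2 hw
      have hs := Real.sqrt_pos.2 (neg_pos.2 h)
      rw [b, d]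
      have : x 0 * ((1 / Complex.normSq w + 1) * w.im * (√(-E) / 2)) -
          x 1 * ((1 / Complex.normSq w + 1) * w.re * (√(-E) / 2)) =
          (1 / Complex.normSq w + 1) * (√(-E) / 2) * (x 0 * w.im - x 1 * w.re) := by ring
      rw [this]
      exact mul_ne_zero (by positivity) (by simpa using hℓ)
  -- At positive energy, outside the unit circle, Im k_E(w) is a positive multiple of (Im w, -Re w),
  -- and the exceptional line is x₁ Re w + x₂ Im w = 0.
  · refine hasFDerivAt_faddeevG hx hz (hev0.mono fun w hw => isEnergyCurveAt_kE E hw)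
      (hev0.mono fun w hw => sum_sq_kE E hw) (hev.mono fun w hw => kE_orientation hE hw)
      (x 0 • Complex.reCLM + x 1 • Complex.imCLM) (v := ⟨x 0, x 1⟩) ?_ ?_
    · simp; nlinarith
    · filter_upwards [hev] with w hw hℓ
      obtain ⟨-, b, -, d⟩ := kE_coords_of_pos h w
      have hN : 1 < Complex.normSq w := by rw [Complex.normSq_eq_norm_sq]; nlinarith
      have hs := Real.sqrt_pos.2 h
      have hN2 : 0 < 1 - 1 / Complex.normSq w := by
        rw [sub_pos, div_lt_one (by linarith)]; exact hN
      rw [b, d]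
      have : x 0 * ((1 / Complex.normSq w - 1) * w.re * (√E / 2)) -
          x 1 * ((1 - 1 / Complex.normSq w) * w.im * (√E / 2)) =
          -((1 - 1 / Complex.normSq w) * (√E / 2) * (x 0 * w.re + x 1 * w.im)) := by ring
      rw [this]
      exact neg_ne_zero.2 (mul_ne_zero (by positivity) (by simpa using hℓ))

lemma hasFDerivAt_conj (z : ℂ) : HasFDerivAt (fun w : ℂ => (starRingEnd ℂ) w)
    (Complex.conjCLE : ℂ →L[ℝ] ℂ) z := Complex.conjCLE.hasFDerivAt

/-- The differential of `G` on the energy curve `k_E`. -/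
lemma hasFDerivAt_faddeevG_kE {x : R2} (hx : x ≠ 0) {E : ℝ} (hE : E ≠ 0) {z : ℂ}
    (hz : z ≠ 0) (h1 : ‖z‖ ≠ 1) : HasFDerivAt (fun w => faddeevG x (kE E w))
      ((Real.sign (‖z‖ ^ 2 - 1) / (2 * Real.pi)) •
        reMul (Complex.exp (Complex.I * bdot (kE E z) x) / z)) z := by
  rcases lt_or_gt_of_ne h1 with h | h
  · have hzn := norm_pos_iff.2 hz
    have hs : Real.sign (‖z‖ ^ 2 - 1) = -1 := Real.sign_of_neg (by nlinarith)
    rw [hs]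
    obtain ⟨c, hc, hk⟩ := exists_negConj_kE hE
    have hcn : ‖(c : ℂ)‖ = 1 := by rcases hc with rfl | rfl <;> simp
    have hc0 : (c : ℂ) ≠ 0 := by rw [← norm_pos_iff, hcn]; exact one_pos
    have hzc : (starRingEnd ℂ) z ≠ 0 := by simpa using hz
    set w₀ := (c : ℂ) / (starRingEnd ℂ) z with hw₀
    have hw₀1 : 1 < ‖w₀‖ := by
      rw [hw₀, norm_div, hcn, Complex.norm_conj]; exact (one_lt_div hzn).2 h
    have hev : (fun w => faddeevG x (kE E ((c : ℂ) / (starRingEnd ℂ) w))) =ᶠ[𝓝 z]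
        fun w => faddeevG x (kE E w) := by
      have h2 : ∀ᶠ w in 𝓝 z, ‖w‖ < 1 := continuous_norm.continuousAt.eventually_lt_const h
      filter_upwards [eventually_ne_nhds hz, h2] with w hw hw1
      exact (faddeevG_kE_neg hx hw (imVec_kE_ne_zero hE hw hw1.ne) (hk w)).symm
    refine HasFDerivAt.congr_of_eventuallyEq ?_ hev.symm
    have d1 := hasFDerivAt_faddeevG_kE_of_one_lt hx hE hw₀1
    have d2 : HasDerivAt (fun u : ℂ => (c : ℂ) / u) (-(c : ℂ) / ((starRingEnd ℂ) z) ^ 2)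
        ((starRingEnd ℂ) z) := by
      have := (hasDerivAt_inv hzc).const_mul (c : ℂ)
      simp only [← div_eq_mul_inv] at this
      refine this.congr_deriv ?_
      field_simp
    have d3 := (d2.hasFDerivAt.restrictScalars ℝ).comp z (hasFDerivAt_conj z)
    have d4 := HasFDerivAt.comp (g := fun w => faddeevG x (kE E w))
      (f := fun w : ℂ => (c : ℂ) / (starRingEnd ℂ) w) z d1 d3
    refine d4.congr_fderiv ?_
    ext v
    -- For w₀ = c/z̄ the form dw₀/w₀ is minus the conjugate of dz/z, and the plane wave at w₀ is the
    -- conjugate of that at z. Taking real parts leaves the factor -1 inside the disc.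
    have e : Complex.exp (Complex.I * bdot (kE E w₀) x) / w₀ *
        ((starRingEnd ℂ) v * (-(c : ℂ) / ((starRingEnd ℂ) z) ^ 2)) =
        -(starRingEnd ℂ) (Complex.exp (Complex.I * bdot (kE E z) x) / z * v) := by
      rw [hw₀, ← hk z, exp_bdot_negConj]
      simp only [map_mul, map_div₀]
      field_simp
    simp only [ContinuousLinearMap.comp_apply, smul_apply, reMul_apply]
    have e2 : ((ContinuousLinearMap.restrictScalars ℝ (ContinuousLinearMap.toSpanSingleton ℂ
        (-(c : ℂ) / ((starRingEnd ℂ) z) ^ 2))) ((Complex.conjCLE : ℂ →L[ℝ] ℂ) v)) =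
        (starRingEnd ℂ) v * (-(c : ℂ) / ((starRingEnd ℂ) z) ^ 2) := by
      simp
    rw [e2, e, Complex.neg_re, Complex.conj_re]
    simp only [Complex.real_smul]
    push_cast; ring
  · have hs : Real.sign (‖z‖ ^ 2 - 1) = 1 := Real.sign_of_pos (by nlinarith)
    rw [hs]
    exact hasFDerivAt_faddeevG_kE_of_one_lt hx hE h

/-- The differential of `G` at zero energy. -/
lemma hasFDerivAt_faddeevG_kZero {x : R2} (hx : x ≠ 0) {σ : ℝ} (hσ : σ = 1 ∨ σ = -1) {z : ℂ}
    (hz : z ≠ 0) : HasFDerivAt (fun w => faddeevG x (kZero σ w))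
      ((1 / (2 * Real.pi)) • reMul (Complex.exp (Complex.I * bdot (kZero σ z) x) / z)) z := by
  have hρ := R2.ne_zero_iff.1 hx
  have hminus : ∀ z : ℂ, z ≠ 0 → HasFDerivAt (fun w => faddeevG x (kZero (-1) w))
      ((1 / (2 * Real.pi)) • reMul (Complex.exp (Complex.I * bdot (kZero (-1) z) x) / z)) z := by
    intro z hz
    have hev0 : ∀ᶠ w in 𝓝 z, w ≠ 0 := eventually_ne_nhds hz
    refine hasFDerivAt_faddeevG hx hz (hev0.mono fun w hw => isEnergyCurveAt_kZero hw)
      (hev0.mono fun w hw => sum_sq_kZero (Or.inr rfl) w) (hev0.mono fun w hw => ?_)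
      (x 0 • Complex.reCLM + x 1 • Complex.imCLM) (v := ⟨x 0, x 1⟩) ?_ ?_
    · have hN : 0 < Complex.normSq w := Complex.normSq_pos.2 hw
      rw [Complex.normSq_apply] at hN
      simp; linarith
    · simp; nlinarith
    · filter_upwards [hev0] with w hw hℓ
      simp at hℓ ⊢
      intro h; apply hℓ; linarith
  rcases hσ with rfl | rfl
  -- The curve with σ = 1 solves the energy curve equation with the opposite sign, so it is reached
  -- from σ = -1 by the reflection z ↦ -z̄.
  · have hzc : -(starRingEnd ℂ) z ≠ 0 := by simpa using hz
    have hev : (fun w => faddeevG x (kZero (-1) (-(starRingEnd ℂ) w))) =ᶠ[𝓝 z]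
        fun w => faddeevG x (kZero 1 w) := by
      filter_upwards [eventually_ne_nhds hz] with w hw
      have him := imVec_kZero_ne_zero (Or.inl rfl) hw
      rw [← negConj_kZero, faddeevG_negConj hx him,
        conj_faddeevG hx him (sum_sq_kZero (Or.inl rfl) w)]
    refine HasFDerivAt.congr_of_eventuallyEq ?_ hev.symm
    have d4 := HasFDerivAt.comp (g := fun w => faddeevG x (kZero (-1) w))
      (f := fun w : ℂ => -(starRingEnd ℂ) w) z (hminus _ hzc) (hasFDerivAt_conj z).neg
    refine d4.congr_fderiv ?_
    ext v
    have e : Complex.exp (Complex.I * bdot (kZero (-1) (-(starRingEnd ℂ) z)) x) /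
        (-(starRingEnd ℂ) z) * (-(starRingEnd ℂ) v) =
        (starRingEnd ℂ) (Complex.exp (Complex.I * bdot (kZero 1 z) x) / z * v) := by
      rw [← negConj_kZero, exp_bdot_negConj]
      simp only [map_mul, map_div₀]
      field_simp
    simp only [ContinuousLinearMap.comp_apply, smul_apply, reMul_apply]
    have e2 : (-(Complex.conjCLE : ℂ →L[ℝ] ℂ)) v = -(starRingEnd ℂ) v := by simp
    rw [e2, e, Complex.conj_re]
  · exact hminus z hz

/-! ### The modulus `|Re k| + |Im k|` -/

lemma norm_eq_of_sq {v : R2} {a : ℝ} (ha : 0 ≤ a) (h : v 0 ^ 2 + v 1 ^ 2 = a ^ 2) : ‖v‖ = a := by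
  rw [← abs_of_nonneg (norm_nonneg v), ← abs_of_nonneg ha, ← sq_eq_sq_iff_abs_eq_abs, R2.norm_sq, h]

/-- The lengths of Re k and Im k are, in an order depending on the sign of E, (√|E|/2)(1/|z| + |z|)
and (√|E|/2)|1/|z| - |z||. Their sum is √|E| times the larger of |z| and 1/|z|. -/
lemma modSum_kE (E : ℝ) (hE : E ≠ 0) {z : ℂ} (hz : z ≠ 0) :
    modSum (kE E z) = √|E| * (if 1 ≤ ‖z‖ then ‖z‖ else ‖z‖⁻¹) := by
  have hzn := norm_pos_iff.2 hz
  have hNn := Complex.normSq_eq_norm_sq z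
  have hN' : z.re ^ 2 + z.im ^ 2 = ‖z‖ ^ 2 := by rw [← hNn, Complex.normSq_apply]; ring
  have key : ∀ e : ℝ, 0 ≤ e → (1 / ‖z‖ ^ 2 + 1) * ‖z‖ * (e / 2) +
      |1 / ‖z‖ ^ 2 - 1| * ‖z‖ * (e / 2) = e * (if 1 ≤ ‖z‖ then ‖z‖ else ‖z‖⁻¹) := by
    intro e he
    split_ifs with h
    · rw [abs_of_nonpos (by rw [sub_nonpos, div_le_one (by positivity)]; nlinarith)]
      field_simp; ring
    · rw [abs_of_nonneg (by rw [sub_nonneg, le_div_iff₀ (by positivity)]; nlinarith)]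
      field_simp; ring
  unfold modSum
  rcases lt_or_gt_of_ne hE with h | h
  · obtain ⟨a, b, c, d⟩ := kE_coords_of_neg h z
    rw [hNn] at a b c d
    have hre : ‖reVec (kE E z)‖ = |1 / ‖z‖ ^ 2 - 1| * ‖z‖ * (√(-E) / 2) := by
      refine norm_eq_of_sq (by positivity) ?_
      rw [reVec_zero, reVec_one, a, c]
      linear_combination ((1 / ‖z‖ ^ 2 - 1) ^ 2 * (√(-E) / 2) ^ 2) * hN' -
        (‖z‖ * (√(-E) / 2)) ^ 2 * sq_abs (1 / ‖z‖ ^ 2 - 1)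
    have him : ‖imVec (kE E z)‖ = (1 / ‖z‖ ^ 2 + 1) * ‖z‖ * (√(-E) / 2) := by
      refine norm_eq_of_sq (by positivity) ?_
      rw [imVec_zero, imVec_one, b, d]
      linear_combination ((1 / ‖z‖ ^ 2 + 1) ^ 2 * (√(-E) / 2) ^ 2) * hN'
    rw [hre, him, add_comm, key _ (Real.sqrt_nonneg _), abs_of_neg h]
  · obtain ⟨a, b, c, d⟩ := kE_coords_of_pos h z
    rw [hNn] at a b c d
    have him : ‖imVec (kE E z)‖ = |1 / ‖z‖ ^ 2 - 1| * ‖z‖ * (√E / 2) := by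
      refine norm_eq_of_sq (by positivity) ?_
      rw [imVec_zero, imVec_one, b, d]
      linear_combination ((1 / ‖z‖ ^ 2 - 1) ^ 2 * (√E / 2) ^ 2) * hN' -
        (‖z‖ * (√E / 2)) ^ 2 * sq_abs (1 / ‖z‖ ^ 2 - 1)
    have hre : ‖reVec (kE E z)‖ = (1 / ‖z‖ ^ 2 + 1) * ‖z‖ * (√E / 2) := by
      refine norm_eq_of_sq (by positivity) ?_
      rw [reVec_zero, reVec_one, a, c]
      linear_combination ((1 / ‖z‖ ^ 2 + 1) ^ 2 * (√E / 2) ^ 2) * hN'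
    rw [hre, him, key _ (Real.sqrt_nonneg _), abs_of_pos h]

lemma modSum_kZero {σ : ℝ} (hσ : σ = 1 ∨ σ = -1) (z : ℂ) : modSum (kZero σ z) = 2 * ‖z‖ := by
  have hN : z.re ^ 2 + z.im ^ 2 = ‖z‖ ^ 2 := by
    rw [← Complex.normSq_eq_norm_sq, Complex.normSq_apply]; ring
  unfold modSum
  have hre : ‖reVec (kZero σ z)‖ = ‖z‖ := by
    refine norm_eq_of_sq (norm_nonneg z) ?_
    rw [reVec_zero, reVec_one, ← hN]
    rcases hσ with rfl | rfl <;> simp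
  have him : ‖imVec (kZero σ z)‖ = ‖z‖ := by
    refine norm_eq_of_sq (norm_nonneg z) ?_
    rw [imVec_zero, imVec_one, ← hN]
    rcases hσ with rfl | rfl <;> simp [add_comm]
  rw [hre, him]; ring

/-! ### The pointwise `∂̄`-equation -/

lemma psi_eq (α : ℝ) (x : R2) (k : C2) : psi α x k = Complex.exp (Complex.I * bdot k x) +
    (α : ℂ) / ((den α (modSum k) : ℝ) : ℂ) * faddeevG x k := by
  unfold psi mu faddeevG; ring

lemma hasFDerivAt_log_norm {z : ℂ} (hz : z ≠ 0) :
    HasFDerivAt (fun w : ℂ => ((Real.log ‖w‖ : ℝ) : ℂ)) (reMul (1 / z)) z := by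
  -- Dividing by z moves the argument to 1, off the branch cut of the logarithm; this changes the
  -- real part only by a constant.
  have h1 : HasDerivAt (fun w : ℂ => Complex.log (w / z)) (1 / z) z := by
    have h0 : HasDerivAt (fun w : ℂ => w / z) (1 / z) z := (hasDerivAt_id z).div_const z
    have := h0.clog (by rw [div_self hz]; exact Complex.one_mem_slitPlane)
    rwa [div_self hz, div_one] at this
  have h2 := (hasFDerivAt_re_of_hasDerivAt h1 1).add_const ((Real.log ‖z‖ : ℝ) : ℂ)
  rw [one_smul] at h2
  refine h2.congr_of_eventuallyEq ?_
  filter_upwards [eventually_ne_nhds hz] with w hw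
  rw [Complex.log_re, norm_div, Real.log_div (norm_ne_zero_iff.2 hw) (norm_ne_zero_iff.2 hz)]
  push_cast; ring

/-- The real differential of the Faddeev eigenfunction along a curve of spectral parameters, where
`|Re k| + |Im k|` is proportional to `|z| ^ s` and `A`, `B` are the derivatives of `k₁`, `k₂`. -/
noncomputable def psiDiff (α : ℝ) (x : R2) (k : C2) (A B : ℂ) (s : ℝ) (z : ℂ) : ℂ →L[ℝ] ℂ :=
  (Complex.I * (A * x 0 + B * x 1) * Complex.exp (Complex.I * bdot k x)) • (1 : ℂ →L[ℝ] ℂ) +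
    ((s : ℂ) * ((α : ℂ) / ((den α (modSum k) : ℝ) : ℂ) / (2 * Real.pi))) •
        reMul (Complex.exp (Complex.I * bdot k x) / z) +
      ((s : ℂ) * (((α : ℂ) / ((den α (modSum k) : ℝ) : ℂ)) ^ 2 / (2 * Real.pi) *
        faddeevG x k)) • reMul (1 / z)

/-- Product rule for e^{ikx} + (α/den) G. As d(den) = -(α/2π) s Re(dz/z), the quotient α/den has
differential (s/2π)(α/den)² Re(dz/z), which has the shape of dG with e^{ikx} replaced by a constant.
-/
lemma hasFDerivAt_psi {α : ℝ} {x : R2} {k : ℂ → C2} {z A B : ℂ} {s : ℝ}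
    (h0 : HasDerivAt (fun w => k w 0) A z) (h1 : HasDerivAt (fun w => k w 1) B z)
    (hG : HasFDerivAt (fun w => faddeevG x (k w))
      ((s / (2 * Real.pi)) • reMul (Complex.exp (Complex.I * bdot (k z) x) / z)) z)
    (hM : HasFDerivAt (fun w => ((Real.log (modSum (k w)) : ℝ) : ℂ)) (s • reMul (1 / z)) z)
    (hden : den α (modSum (k z)) ≠ 0) :
    HasFDerivAt (fun w => psi α x (k w)) (psiDiff α x (k z) A B s z) z := by
  have hden' : ((den α (modSum (k z)) : ℝ) : ℂ) ≠ 0 := by exact_mod_cast hden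
  have hexp : HasDerivAt (fun w => Complex.exp (Complex.I * bdot (k w) x))
      (Complex.exp (Complex.I * bdot (k z) x) * (Complex.I * (A * x 0 + B * x 1))) z :=
    ((h0.mul_const (x 0 : ℂ)).add (h1.mul_const (x 1 : ℂ))).const_mul Complex.I |>.cexp
  have hd : HasFDerivAt (fun w => ((den α (modSum (k w)) : ℝ) : ℂ))
      (-((α : ℂ) / (2 * Real.pi)) • (s • reMul (1 / z))) z := by
    have := (hM.const_mul ((α : ℂ) / (2 * Real.pi))).const_sub 1
    refine (this.congr_of_eventuallyEq (Eventually.of_forall fun w => ?_)).congr_fderiv ?_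
    · simp [den]
    · ext v; simp
  have hi := (hasDerivAt_inv hden').comp_hasFDerivAt z hd
  have := (hexp.hasFDerivAt.restrictScalars ℝ).add ((hi.const_mul (α : ℂ)).mul hG)
  refine (this.congr_of_eventuallyEq (Eventually.of_forall fun w => ?_)).congr_fderiv ?_
  · simp only [psi_eq, div_eq_mul_inv]; rfl
  · ext v
    simp [psiDiff]
    field_simp
    ring

/-- Consequently a function with differential Re(c dz) has ∂̄-derivative c̄/2. This is the origin of
the conjugate in the ∂̄-equation. -/
lemma reMul_add_I_mul (c : ℂ) :
    reMul c 1 + Complex.I * reMul c Complex.I = (starRingEnd ℂ) c := by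
  apply Complex.ext <;> simp

/-- The complex-linear part of the differential drops out. With e = e^{ikx} and d the denominator,
the rest is (s/(4π z̄)) (α/d) (ē + (α/d) G), whose bracket is the conjugate of ψ since α/d and G are
real; and α/(4πd) = π b. -/
lemma hasDbarAt_psi {α : ℝ} {x : R2} {k : ℂ → C2} {z A B : ℂ} {s : ℝ}
    (hD : HasFDerivAt (fun w => psi α x (k w)) (psiDiff α x (k z) A B s z) z)
    (hG : (starRingEnd ℂ) (faddeevG x (k z)) = faddeevG x (k z)) :
    HasDbarAt (fun w => psi α x (k w))
      ((Real.pi : ℂ) * s / (starRingEnd ℂ) z * bData α (k z) *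
        (starRingEnd ℂ) (psi α x (k z))) z := by
  refine ⟨hD.differentiableAt, ?_⟩
  rw [dbar, hD.fderiv]
  set e := Complex.exp (Complex.I * bdot (k z) x) with he
  set d : ℂ := ((den α (modSum (k z)) : ℝ) : ℂ) with hd
  have h1 := reMul_add_I_mul (e / z)
  have h2 := reMul_add_I_mul (1 / z)
  have hc : (starRingEnd ℂ) (psi α x (k z)) =
      (starRingEnd ℂ) e + (α : ℂ) / d * faddeevG x (k z) := by
    rw [psi_eq, map_add, map_mul, map_div₀, hG, hd, Complex.conj_ofReal, Complex.conj_ofReal]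
  rw [map_div₀] at h1
  rw [map_div₀, map_one (starRingEnd ℂ)] at h2
  rw [hc]
  simp only [psiDiff, ← he, ← hd, add_apply, smul_apply,
    one_apply_eq_self, smul_eq_mul, bData, aData]
  have hpi : (Real.pi : ℂ) ≠ 0 := by exact_mod_cast Real.pi_ne_zero
  have hI := Complex.I_sq
  trans (1 / 2) * ((s : ℂ) * ((α : ℂ) / d / (2 * Real.pi)) * ((starRingEnd ℂ) e / (starRingEnd ℂ) z)
    + ((s : ℂ) * (((α : ℂ) / d) ^ 2 / (2 * Real.pi) * faddeevG x (k z))) *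
      (1 / (starRingEnd ℂ) z))
  · rw [← h1, ← h2]
    linear_combination (1 / 2 * (Complex.I * (A * x 0 + B * x 1) * e)) * hI
  · generalize (α : ℂ) / d = a
    field_simp

/-! #### The energy curves -/

lemma hasFDerivAt_log_modSum_kE {E : ℝ} (hE : E ≠ 0) {z : ℂ} (hz : z ≠ 0) (h1 : ‖z‖ ≠ 1) :
    HasFDerivAt (fun w => ((Real.log (modSum (kE E w)) : ℝ) : ℂ))
      (Real.sign (‖z‖ ^ 2 - 1) • reMul (1 / z)) z := by
  have hs : √|E| ≠ 0 := (Real.sqrt_pos.2 (abs_pos.2 hE)).ne'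
  have hl := hasFDerivAt_log_norm hz
  rcases lt_or_gt_of_ne h1 with h | h
  · rw [Real.sign_of_neg (by nlinarith [norm_nonneg z])]
    refine (((hl.const_smul (-1 : ℝ)).const_add ((Real.log √|E| : ℝ) : ℂ))).congr_of_eventuallyEq ?_
    filter_upwards [eventually_ne_nhds hz, continuous_norm.continuousAt.eventually_lt_const h]
      with w hw hw1
    rw [modSum_kE E hE hw, if_neg (not_le.2 hw1), Real.log_mul hs (by simpa using hw), Real.log_inv]
    simp
  · rw [Real.sign_of_pos (by nlinarith [norm_nonneg z]), one_smul]
    refine (hl.const_add ((Real.log √|E| : ℝ) : ℂ)).congr_of_eventuallyEq ?_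
    filter_upwards [eventually_ne_nhds hz, continuous_norm.continuousAt.eventually_const_lt h]
      with w hw hw1
    rw [modSum_kE E hE hw, if_pos hw1.le, Real.log_mul hs (by simpa using hw)]
    simp

lemma hasFDerivAt_log_modSum_kZero {σ : ℝ} (hσ : σ = 1 ∨ σ = -1) {z : ℂ} (hz : z ≠ 0) :
    HasFDerivAt (fun w => ((Real.log (modSum (kZero σ w)) : ℝ) : ℂ))
      ((1 : ℝ) • reMul (1 / z)) z := by
  rw [one_smul]
  refine ((hasFDerivAt_log_norm hz).const_add ((Real.log 2 : ℝ) : ℂ)).congr_of_eventuallyEq ?_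
  filter_upwards [eventually_ne_nhds hz] with w hw
  rw [modSum_kZero hσ, Real.log_mul two_ne_zero (by simpa using hw)]
  simp

lemma hasFDerivAt_psi_kE {α : ℝ} {x : R2} (hx : x ≠ 0) {E : ℝ} (hE : E ≠ 0) {z : ℂ} (hz : z ≠ 0)
    (h1 : ‖z‖ ≠ 1) (hden : den α (modSum (kE E z)) ≠ 0) :
    HasFDerivAt (fun w => psi α x (kE E w)) (psiDiff α x (kE E z) (Complex.I / z * kE E z 1)
      (-(Complex.I / z) * kE E z 0) (Real.sign (‖z‖ ^ 2 - 1)) z) z :=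
  hasFDerivAt_psi (isEnergyCurveAt_kE E hz).1 (isEnergyCurveAt_kE E hz).2
    (hasFDerivAt_faddeevG_kE hx hE hz h1) (hasFDerivAt_log_modSum_kE hE hz h1) hden

lemma hasDbarAt_psi_kE {α : ℝ} {x : R2} (hx : x ≠ 0) {E : ℝ} (hE : E ≠ 0) {z : ℂ} (hz : z ≠ 0)
    (h1 : ‖z‖ ≠ 1) (hden : den α (modSum (kE E z)) ≠ 0) :
    HasDbarAt (fun w => psi α x (kE E w)) (dbarRHS α x E z) z :=
  hasDbarAt_psi (hasFDerivAt_psi_kE hx hE hz h1 hden)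
    (conj_faddeevG hx (imVec_kE_ne_zero hE hz h1) (sum_sq_kE E hz))

lemma hasDbarAt_psi_kZero {α : ℝ} {x : R2} (hx : x ≠ 0) {σ : ℝ} (hσ : σ = 1 ∨ σ = -1) {z : ℂ}
    (hz : z ≠ 0) (hden : den α (modSum (kZero σ z)) ≠ 0) :
    HasDbarAt (fun w => psi α x (kZero σ w))
      ((Real.pi : ℂ) / (starRingEnd ℂ) z * bData α (kZero σ z) *
        (starRingEnd ℂ) (psi α x (kZero σ z))) z := by
  have h0 : HasDerivAt (fun w => kZero σ w 0) 1 z := hasDerivAt_id z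
  have h1 : HasDerivAt (fun w => kZero σ w 1) ((σ : ℂ) * Complex.I * 1) z :=
    (hasDerivAt_id z).const_mul _
  have := hasDbarAt_psi (hasFDerivAt_psi h0 h1 (hasFDerivAt_faddeevG_kZero hx hσ hz)
    (hasFDerivAt_log_modSum_kZero hσ hz) hden)
    (conj_faddeevG hx (imVec_kZero_ne_zero hσ hz) (sum_sq_kZero hσ z))
  simpa using this

/-! ### Integration by parts across the unit circle -/

lemma integral_eq_zero_of_hasDerivAt_off_countable {f f' : ℝ → ℂ} {S : Set ℝ} (hS : S.Countable)
    (hc : Continuous f) {R : ℝ} (hz : ∀ t, R < |t| → f t = 0) (hd : ∀ t ∉ S, HasDerivAt f (f' t) t)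
    (hi : Integrable f') : ∫ t, f' t = 0 := by
  have h0 : Tendsto (fun n : ℕ => ∫ t in (-(n : ℝ))..n, f' t) atTop (𝓝 (∫ t, f' t)) :=
    intervalIntegral_tendsto_integral hi
      (tendsto_neg_atTop_atBot.comp tendsto_natCast_atTop_atTop) tendsto_natCast_atTop_atTop
  refine tendsto_nhds_unique h0 (tendsto_const_nhds.congr' ?_)
  filter_upwards [tendsto_natCast_atTop_atTop.eventually_gt_atTop R,
    tendsto_natCast_atTop_atTop.eventually_ge_atTop (0 : ℝ)] with n hn hn0
  rw [integral_eq_of_hasDerivAt_off_countable f f' hS hc.continuousOn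
    (fun t ht => hd t ht.2) hi.intervalIntegrable, hz n (by rwa [abs_of_nonneg hn0]),
    hz (-n) (by rwa [abs_neg, abs_of_nonneg hn0]), sub_zero]

lemma ae_norm_ne_one : ∀ᵐ z : ℂ, ‖z‖ ≠ 1 := by
  have := Measure.addHaar_sphere (volume : Measure ℂ) 0 1
  rw [ae_iff]
  convert this using 2
  ext z; simp

lemma integral_complex {f : ℂ → ℂ} : ∫ z, f z = ∫ p : ℝ × ℝ, f ⟨p.1, p.2⟩ := by
  rw [← Complex.volume_preserving_equiv_real_prod.symm.integral_comp
    Complex.measurableEquivRealProd.symm.measurableEmbedding]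
  rfl

lemma integrable_complex {f : ℂ → ℂ} (hf : Integrable f) :
    Integrable (fun p : ℝ × ℝ => f ⟨p.1, p.2⟩) :=
  Complex.volume_preserving_equiv_real_prod.symm.integrable_comp_of_integrable hf

lemma finite_sq_eq (c : ℝ) : {t : ℝ | t ^ 2 = c}.Finite := by
  refine (Set.toFinite {√c, -√c}).subset fun t ht => ?_
  have ht' : t ^ 2 = c := ht
  have hc : 0 ≤ c := ht' ▸ sq_nonneg t
  simp only [Set.mem_insert_iff, Set.mem_singleton_iff]
  rw [← sq_eq_sq_iff_eq_or_eq_neg, ht', Real.sq_sqrt hc]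

lemma norm_mk_eq_one_iff (a b : ℝ) : ‖(⟨a, b⟩ : ℂ)‖ = 1 ↔ a ^ 2 + b ^ 2 = 1 := by
  rw [← sq_eq_sq₀ (norm_nonneg _) zero_le_one, ← Complex.normSq_eq_norm_sq, Complex.normSq_apply]
  simp [sq]

lemma integrable_fderiv_apply {H : ℂ → ℂ} (hs : HasCompactSupport H) {C : ℝ}
    (hb : ∀ z, ‖z‖ ≠ 1 → ‖fderiv ℝ H z‖ ≤ C) (v : ℂ) : Integrable (fun z => fderiv ℝ H z v) := by
  have hcs : HasCompactSupport (fun z => fderiv ℝ H z v) := hs.fderiv_apply (𝕜 := ℝ) v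
  rw [← integrableOn_iff_integrable_of_support_subset (subset_tsupport _)]
  refine Measure.integrableOn_of_bounded (M := C * ‖v‖) hcs.isCompact.measure_lt_top.ne
    (measurable_fderiv_apply_const ℝ H v).aestronglyMeasurable ?_
  filter_upwards [ae_restrict_of_ae ae_norm_ne_one] with z hz
  exact (fderiv ℝ H z).le_of_opNorm_le (hb z hz) v

/-- A coordinate line meets the unit circle in at most two points, and the fundamental theorem of
calculus tolerates a countable exceptional set for a continuous function. -/
lemma integral_fderiv_line_eq_zero {H : ℂ → ℂ} (hc : Continuous H) (hs : HasCompactSupport H)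
    (hd : ∀ z, ‖z‖ ≠ 1 → DifferentiableAt ℝ H z) {γ : ℝ → ℂ} {v : ℂ}
    (hγ : ∀ t, HasDerivAt γ v t) (hn : ∀ t, |t| ≤ ‖γ t‖) {c : ℝ} (h1 : ∀ t, ‖γ t‖ = 1 → t ^ 2 = c)
    (hi : Integrable (fun t => fderiv ℝ H (γ t) v)) : ∫ t, fderiv ℝ H (γ t) v = 0 := by
  obtain ⟨R, hR⟩ := hs.isCompact.isBounded.subset_closedBall 0
  refine integral_eq_zero_of_hasDerivAt_off_countable (f := fun t => H (γ t)) (R := R)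
    (finite_sq_eq c).countable
    (hc.comp (continuous_iff_continuousAt.2 fun a => (hγ a).continuousAt))
    (fun t ht => image_eq_zero_of_notMem_tsupport fun h => ?_) (fun t ht => ?_) hi
  · have := hR h
    rw [mem_closedBall_zero_iff] at this
    linarith [hn t]
  · exact (hd _ fun h => ht (h1 t h)).hasFDerivAt.comp_hasDerivAt t (hγ t)

lemma integral_fderiv_eq_zero {H : ℂ → ℂ} (hc : Continuous H) (hs : HasCompactSupport H)
    (hd : ∀ z, ‖z‖ ≠ 1 → DifferentiableAt ℝ H z) {C : ℝ}
    (hb : ∀ z, ‖z‖ ≠ 1 → ‖fderiv ℝ H z‖ ≤ C) :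
    ∫ z, fderiv ℝ H z 1 = 0 ∧ ∫ z, fderiv ℝ H z Complex.I = 0 := by
  constructor
  · have hi := integrable_complex (integrable_fderiv_apply hs hb 1)
    rw [integral_complex, Measure.volume_eq_prod, integral_prod_symm _ hi]
    refine integral_eq_zero_of_ae ?_
    filter_upwards [hi.prod_left_ae] with b hb'
    refine integral_fderiv_line_eq_zero (γ := fun t => ⟨t, b⟩) (c := 1 - b ^ 2) hc hs hd
      (fun a => ?_) (fun t => Complex.abs_re_le_norm ⟨t, b⟩) (fun t ht => ?_) hb'
    · have := (Complex.ofRealCLM.hasDerivAt (x := a)).add_const ((b : ℂ) * Complex.I)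
      refine (this.congr_of_eventuallyEq (Eventually.of_forall fun t => ?_)).congr_deriv (by simp)
      simp [Complex.mk_eq_add_mul_I]
    · rw [norm_mk_eq_one_iff] at ht; linarith
  · have hi := integrable_complex (integrable_fderiv_apply hs hb Complex.I)
    rw [integral_complex, Measure.volume_eq_prod, integral_prod _ hi]
    refine integral_eq_zero_of_ae ?_
    filter_upwards [hi.prod_right_ae] with a ha'
    refine integral_fderiv_line_eq_zero (γ := fun t => ⟨a, t⟩) (c := 1 - a ^ 2) hc hs hd
      (fun b => ?_) (fun t => Complex.abs_im_le_norm ⟨a, t⟩) (fun t ht => ?_) ha'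
    · have := ((Complex.ofRealCLM.hasDerivAt (x := b)).mul_const Complex.I).const_add (a : ℂ)
      refine (this.congr_of_eventuallyEq (Eventually.of_forall fun t => ?_)).congr_deriv (by simp)
      simp [Complex.mk_eq_add_mul_I]
    · rw [norm_mk_eq_one_iff] at ht; linarith

/-- A continuous function satisfying `∂F/∂z̄ = Q` classically off the unit circle, with locally
bounded differential, satisfies the equation in the sense of distributions. -/
lemma weakDbarOn_of_off_circle {U : Set ℂ} (hU : IsOpen U) {F Q : ℂ → ℂ} (hF : ContinuousOn F U)
    (hQ : LocallyIntegrableOn Q U) (hd : ∀ z ∈ U, ‖z‖ ≠ 1 → HasDbarAt F (Q z) z)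
    {M : ℂ → ℝ} (hM : ContinuousOn M U) (hb : ∀ z ∈ U, ‖z‖ ≠ 1 → ‖fderiv ℝ F z‖ ≤ M z) :
    WeakDbarOn U F Q := by
  refine ⟨hF.locallyIntegrableOn hU.measurableSet, hQ, fun φ hφ hφc hφU => ?_⟩
  set H : ℂ → ℂ := fun z => F z * φ z with hH
  have hφd : Differentiable ℝ φ := hφ.differentiable (by simp)
  have hoff : ∀ z, z ∉ U → z ∉ tsupport φ := fun z hz h => hz (hφU h)
  have hzero : ∀ z, z ∉ tsupport φ → φ =ᶠ[𝓝 z] 0 := fun z hz =>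
    notMem_tsupport_iff_eventuallyEq.1 hz
  have hHzero : ∀ z, z ∉ tsupport φ → H =ᶠ[𝓝 z] 0 := fun z hz => by
    filter_upwards [hzero z hz] with w hw
    simp [hH, hw]
  have hHc : Continuous H := continuous_iff_continuousAt.2 fun z => by
    by_cases hz : z ∈ tsupport φ
    · exact (hF.continuousAt (hU.mem_nhds (hφU hz))).mul hφ.continuous.continuousAt
    · exact continuousAt_const.congr (hHzero z hz).symm
  have hHs : HasCompactSupport H := hφc.mul_left
  have hHd' : ∀ z ∈ U, ‖z‖ ≠ 1 →
      HasFDerivAt H (F z • fderiv ℝ φ z + φ z • fderiv ℝ F z) z := fun z hz h1 =>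
    (hd z hz h1).1.hasFDerivAt.mul (hφd z).hasFDerivAt
  have hHd : ∀ z, ‖z‖ ≠ 1 → DifferentiableAt ℝ H z := fun z h1 => by
    by_cases hz : z ∈ U
    · exact (hHd' z hz h1).differentiableAt
    · exact (differentiableAt_const (0 : ℂ)).congr_of_eventuallyEq (hHzero z (hoff z hz))
  obtain ⟨C₁, hC₁⟩ := hφc.isCompact.exists_bound_of_continuousOn (hF.mono hφU)
  obtain ⟨C₂, hC₂⟩ := hφc.isCompact.exists_bound_of_continuousOn (hM.mono hφU)
  obtain ⟨C₃, hC₃⟩ := hφc.isCompact.exists_bound_of_continuousOn (f := φ) hφ.continuous.continuousOn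
  obtain ⟨C₄, hC₄⟩ := hφc.isCompact.exists_bound_of_continuousOn (f := fderiv ℝ φ)
    (hφ.continuous_fderiv (by simp)).continuousOn
  have hHb : ∀ z, ‖z‖ ≠ 1 → ‖fderiv ℝ H z‖ ≤ max (C₁ * C₄ + C₃ * C₂) 0 := fun z h1 => by
    by_cases hz : z ∈ tsupport φ
    · rw [(hHd' z (hφU hz) h1).fderiv]
      refine le_max_of_le_left ((norm_add_le _ _).trans (add_le_add ?_ ?_))
      · rw [norm_smul]
        exact mul_le_mul (hC₁ z hz) (hC₄ z hz) (norm_nonneg _) ((norm_nonneg _).trans (hC₁ z hz))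
      · rw [norm_smul]
        exact mul_le_mul (hC₃ z hz)
          ((hb z (hφU hz) h1).trans ((le_abs_self _).trans (hC₂ z hz)))
          (norm_nonneg _) ((norm_nonneg _).trans (hC₃ z hz))
    · rw [(hHzero z hz).fderiv_eq]
      simp
  obtain ⟨e1, e2⟩ := integral_fderiv_eq_zero hHc hHs hHd hHb
  have i1 := integrable_fderiv_apply hHs hHb 1
  have i2 := integrable_fderiv_apply hHs hHb Complex.I
  have hdH : ∫ z, dbar H z = 0 := by
    unfold dbar
    rw [integral_const_mul, integral_add i1 (i2.const_mul _), integral_const_mul, e1, e2]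
    simp
  have hdHi : Integrable (dbar H) := (i1.add (i2.const_mul _)).const_mul _
  have hdφ : Continuous (dbar φ) := by
    have := hφ.continuous_fderiv (by simp)
    unfold dbar
    fun_prop
  have hFφ : Integrable (fun z => F z * dbar φ z) := by
    refine Continuous.integrable_of_hasCompactSupport (continuous_iff_continuousAt.2 fun z => ?_) ?_
    · by_cases hz : z ∈ tsupport φ
      · exact (hF.continuousAt (hU.mem_nhds (hφU hz))).mul hdφ.continuousAt
      · refine continuousAt_const.congr (f := fun _ => (0 : ℂ)) ?_
        filter_upwards [(isClosed_tsupport φ).isOpen_compl.mem_nhds hz] with w hw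
        simp [dbar, (hzero w hw).fderiv_eq]
    · refine HasCompactSupport.intro hφc.isCompact fun z hz => ?_
      simp [dbar, (hzero z hz).fderiv_eq]
  have hae : (fun z => Q z * φ z) =ᵐ[volume] fun z => dbar H z - F z * dbar φ z := by
    filter_upwards [ae_norm_ne_one] with z h1
    by_cases hz : z ∈ U
    · rw [← (hd z hz h1).2, dbar, dbar, dbar, (hHd' z hz h1).fderiv]
      simp only [add_apply, smul_apply, smul_eq_mul]
      ring
    · have h0 := hoff z hz
      rw [dbar, dbar, (hHzero z h0).fderiv_eq, (hzero z h0).fderiv_eq, (hzero z h0).eq_of_nhds]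
      simp
  rw [integral_congr_ae hae, integral_sub hdHi hFφ, hdH]
  simp

/-! ### The equation in the sense of distributions at negative energy -/

lemma modSum_kE_pos {E : ℝ} (hE : E ≠ 0) {z : ℂ} (hz : z ≠ 0) : 0 < modSum (kE E z) := by
  rw [modSum_kE E hE hz]
  have := norm_pos_iff.2 hz
  have hs := Real.sqrt_pos.2 (abs_pos.2 hE)
  split_ifs <;> positivity

lemma continuousAt_kE (E : ℝ) {z : ℂ} (hz : z ≠ 0) : ContinuousAt (kE E) z :=
  (isEnergyCurveAt_kE E hz).continuousAt

lemma continuousAt_den_kE (α : ℝ) {E : ℝ} (hE : E ≠ 0) {z : ℂ} (hz : z ≠ 0) :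
    ContinuousAt (fun w => den α (modSum (kE E w))) z := by
  have hk := continuousAt_kE E hz
  have hm : ContinuousAt (fun w => modSum (kE E w)) z :=
    (continuous_reVec.norm.add continuous_imVec.norm).continuousAt.comp hk
  exact continuousAt_const.sub (continuousAt_const.mul (hm.log (modSum_kE_pos hE hz).ne'))

lemma continuousAt_exp_kE (x : R2) (E : ℝ) {z : ℂ} (hz : z ≠ 0) :
    ContinuousAt (fun w => Complex.exp (Complex.I * bdot (kE E w) x)) z :=
  ((((isEnergyCurveAt_kE E hz).1.continuousAt.mul continuousAt_const).add
    ((isEnergyCurveAt_kE E hz).2.continuousAt.mul continuousAt_const)).const_mul _).cexp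

/-- At negative energy Im k_E does not vanish on the unit circle either, so continuity of g covers
all z ≠ 0. -/
lemma continuousAt_faddeevG_kE {x : R2} (hx : x ≠ 0) {E : ℝ} (hE : E < 0) {z : ℂ} (hz : z ≠ 0) :
    ContinuousAt (fun w => faddeevG x (kE E w)) z :=
  (continuousAt_exp_kE x E hz).mul (ContinuousAt.comp (f := kE E)
    (continuousAt_g hx (imVec_kE_ne_zero_of_neg hE hz)) (continuousAt_kE E hz))

lemma isOpen_regular (α : ℝ) {E : ℝ} (hE : E ≠ 0) :
    IsOpen {z : ℂ | z ≠ 0 ∧ den α (modSum (kE E z)) ≠ 0} := by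
  rw [isOpen_iff_mem_nhds]
  rintro z ⟨hz, hd⟩
  filter_upwards [eventually_ne_nhds hz, (continuousAt_den_kE α hE hz).eventually_ne hd]
    with w h1 h2 using ⟨h1, h2⟩

lemma norm_reMul_le (c : ℂ) : ‖reMul c‖ ≤ ‖c‖ := by
  refine ContinuousLinearMap.opNorm_le_bound _ (norm_nonneg _) fun v => ?_
  rw [reMul_apply, Complex.norm_real, ← norm_mul]
  exact Complex.abs_re_le_norm _

/-- The bound no longer contains s, whose value jumps at the unit circle; along the energy curve it
is therefore continuous across the circle. -/
lemma norm_psiDiff_le (α : ℝ) (x : R2) (k : C2) (A B : ℂ) {s : ℝ} (hs : |s| ≤ 1) (z : ℂ) :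
    ‖psiDiff α x k A B s z‖ ≤
      ‖Complex.I * (A * x 0 + B * x 1) * Complex.exp (Complex.I * bdot k x)‖ +
      ‖(α : ℂ) / ((den α (modSum k) : ℝ) : ℂ) / (2 * Real.pi)‖ *
        ‖Complex.exp (Complex.I * bdot k x) / z‖ +
      ‖((α : ℂ) / ((den α (modSum k) : ℝ) : ℂ)) ^ 2 / (2 * Real.pi) * faddeevG x k‖ *
        ‖1 / z‖ := by
  have hsm : ∀ a c : ℂ, ‖((s : ℂ) * a) • reMul c‖ ≤ ‖a‖ * ‖c‖ := fun a c => by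
    rw [norm_smul, norm_mul, Complex.norm_real, Real.norm_eq_abs]
    refine mul_le_mul ?_ (norm_reMul_le c) (norm_nonneg _) (norm_nonneg _)
    exact mul_le_of_le_one_left (norm_nonneg _) hs
  refine (norm_add_le _ _).trans (add_le_add ((norm_add_le _ _).trans (add_le_add ?_ ?_)) ?_)
  · rw [norm_smul, norm_one, mul_one]
  · exact hsm _ _
  · exact hsm _ _

lemma abs_sign_le_one (r : ℝ) : |Real.sign r| ≤ 1 := by
  rcases Real.sign_apply_eq r with h | h | h <;> simp [h]

lemma locallyIntegrable_sign : LocallyIntegrable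
    (fun z : ℂ => ((Real.sign (‖z‖ ^ 2 - 1) : ℝ) : ℂ)) := by
  refine (locallyIntegrable_const (1 : ℂ)).mono ?_ (Eventually.of_forall fun z => ?_)
  · refine Measurable.aestronglyMeasurable ?_
    have : Measurable Real.sign := by
      unfold Real.sign
      exact Measurable.ite measurableSet_Iio measurable_const
        (Measurable.ite measurableSet_Ioi measurable_const measurable_const)
    exact Complex.measurable_ofReal.comp (this.comp ((measurable_norm.pow_const 2).sub_const 1))
  · simpa using abs_sign_le_one (‖z‖ ^ 2 - 1)

lemma weakDbarOn_psi_kE (α : ℝ) {x : R2} (hx : x ≠ 0) {E : ℝ} (hE : E < 0) :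
    WeakDbarOn {z : ℂ | z ≠ 0 ∧ den α (modSum (kE E z)) ≠ 0}
      (fun z => psi α x (kE E z)) (dbarRHS α x E) := by
  have hd : ∀ z ∈ {z : ℂ | z ≠ 0 ∧ den α (modSum (kE E z)) ≠ 0}, ContinuousAt
      (fun w => (α : ℂ) / ((den α (modSum (kE E w)) : ℝ) : ℂ)) z := fun z hz =>
    continuousAt_const.div (Complex.continuous_ofReal.continuousAt.comp
      (continuousAt_den_kE α hE.ne hz.1)) (by exact_mod_cast hz.2)
  have hF : ∀ z ∈ {z : ℂ | z ≠ 0 ∧ den α (modSum (kE E z)) ≠ 0},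
      ContinuousAt (fun z => psi α x (kE E z)) z := fun z hz => by
    simp only [psi_eq]
    exact (continuousAt_exp_kE x E hz.1).add
      ((hd z hz).mul (continuousAt_faddeevG_kE hx hE hz.1))
  have hinv : ∀ z : ℂ, z ≠ 0 → ContinuousAt (fun w : ℂ => Complex.I / w) z := fun z hz =>
    continuousAt_const.div continuousAt_id hz
  refine weakDbarOn_of_off_circle (isOpen_regular α hE.ne)
    (fun z hz => (hF z hz).continuousWithinAt) ?_
    (fun z hz h1 => hasDbarAt_psi_kE hx hE.ne hz.1 h1 hz.2)
    (M := fun z => ‖Complex.I * (Complex.I / z * kE E z 1 * x 0 + -(Complex.I / z) * kE E z 0 * x 1)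
        * Complex.exp (Complex.I * bdot (kE E z) x)‖ +
      ‖(α : ℂ) / ((den α (modSum (kE E z)) : ℝ) : ℂ) / (2 * Real.pi)‖ *
        ‖Complex.exp (Complex.I * bdot (kE E z) x) / z‖ +
      ‖((α : ℂ) / ((den α (modSum (kE E z)) : ℝ) : ℂ)) ^ 2 / (2 * Real.pi) *
        faddeevG x (kE E z)‖ * ‖1 / z‖) (fun z hz => ContinuousAt.continuousWithinAt ?_)
    (fun z hz h1 => ?_)
  · have := (locallyIntegrable_sign.locallyIntegrableOn
      {z : ℂ | z ≠ 0 ∧ den α (modSum (kE E z)) ≠ 0}).continuousOn_mul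
      (g := fun z => (Real.pi : ℂ) / (starRingEnd ℂ) z * bData α (kE E z) *
        (starRingEnd ℂ) (psi α x (kE E z))) (fun z hz => ContinuousAt.continuousWithinAt ?_)
      (isOpen_regular α hE.ne).isLocallyClosed
    · refine this.congr (Eventually.of_forall fun z => ?_)
      simp only [dbarRHS]; ring
    · refine ContinuousAt.mul (ContinuousAt.mul ?_ ?_) ?_
      · exact continuousAt_const.div Complex.continuous_conj.continuousAt (by simpa using hz.1)
      · exact continuousAt_const.mul (hd z hz)
      · exact Complex.continuous_conj.continuousAt.comp (hF z hz)
  · have c0 := (isEnergyCurveAt_kE E hz.1).1.continuousAt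
    have c1 := (isEnergyCurveAt_kE E hz.1).2.continuousAt
    have ce := continuousAt_exp_kE x E hz.1
    have ci := hinv z hz.1
    have cd := hd z hz
    have cG := continuousAt_faddeevG_kE hx hE hz.1
    refine ContinuousAt.add (ContinuousAt.add ?_ ?_) ?_
    · exact ((continuousAt_const.mul (((ci.mul c1).mul continuousAt_const).add
        ((ci.neg.mul c0).mul continuousAt_const))).mul ce).norm
    · exact (cd.div_const _).norm.mul (ce.div continuousAt_id hz.1).norm
    · exact (((cd.pow 2).div_const _).mul cG).norm.mul
        (continuousAt_const.div continuousAt_id hz.1).norm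
  · rw [(hasFDerivAt_psi_kE hx hE.ne hz.1 h1 hz.2).fderiv]
    exact norm_psiDiff_le α x _ _ _ (abs_sign_le_one _) z

/-! ### Normalization at infinity -/

/-- The phase of the slice may grow like e^{qr}, but the pole counts only when Re S > q, and the
product is e^{-r(Re S - q)}/|S|. -/
lemma exp_mul_norm_poleTerm_le (r q : ℝ) {S : ℂ} (hS : 1 ≤ ‖S‖) :
    Real.exp (q * r) * ‖poleTerm r q S‖ ≤ Real.exp (-(r * |S.re - q|)) := by
  unfold poleTerm
  split_ifs with h
  · rw [norm_div, Complex.norm_exp, mul_div_assoc', ← Real.exp_add, abs_of_pos (by linarith)]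
    refine (div_le_self (Real.exp_pos _).le hS).trans (Real.exp_le_exp.2 ?_)
    simp; nlinarith
  · rw [norm_zero, mul_zero]; positivity

/-- From (S - T)(S + T) = -E. When both real parts are nonnegative, |Re S - Re T| is at most |S - T|
and at most |S + T|, hence its square is at most |E|. -/
lemma abs_re_sub_abs_le {S T : ℂ} {E : ℝ} (hS : 0 ≤ S.re) (h : S ^ 2 = T ^ 2 - E) :
    |S.re - (|T.re|)| ≤ √|E| := by
  have aux : ∀ T : ℂ, 0 ≤ T.re → S ^ 2 = T ^ 2 - E → |S.re - T.re| ≤ √|E| := by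
    intro T hT h
    have e : (S - T) * (S + T) = -(E : ℂ) := by linear_combination h
    have h1 : |S.re - T.re| ≤ ‖S - T‖ := by
      simpa using Complex.abs_re_le_norm (S - T)
    have h2 : |S.re - T.re| ≤ ‖S + T‖ := by
      have := Complex.abs_re_le_norm (S + T)
      rw [Complex.add_re, abs_of_nonneg (add_nonneg hS hT)] at this
      exact (abs_le.2 ⟨by linarith, by linarith⟩ : |S.re - T.re| ≤ S.re + T.re).trans this
    refine Real.le_sqrt_of_sq_le ?_
    have h3 : ‖S - T‖ * ‖S + T‖ = |E| := by
      rw [← norm_mul, e, norm_neg, Complex.norm_real, Real.norm_eq_abs]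
    rw [← h3, sq]
    exact mul_le_mul h1 h2 (abs_nonneg _) (norm_nonneg _)
  rcases le_total 0 T.re with hT | hT
  · rw [abs_of_nonneg hT]; exact aux T hT h
  · rw [abs_of_nonpos hT]
    simpa using aux (-T) (by simpa using hT) (by simpa using h)

/-- The condition on Im k₂ keeps |S| ≥ 1, removing the inverse square root singularity. Since Re S
is within √|E| of |t + Re k₂|, the slice is bounded by translates of e^{-x₁|t|}, whose integral does
not depend on k. -/
lemma norm_g_le_of_pos {x : R2} (hx : 0 < x 0) {k : C2} (hk : imVec k ≠ 0) {E : ℝ}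
    (hE : k 0 ^ 2 + k 1 ^ 2 = E) (hq : |E| + 1 ≤ (k 1).im ^ 2) :
    ‖g x k‖ ≤ 1 / (4 * Real.pi) * (4 * Real.exp (x 0 * √|E|) *
      ∫ t : ℝ, Real.exp (-(x 0 * |t|))) := by
  set p := (k 1).re
  set q := (k 0).im
  set b : ℝ → ℝ := fun t => Real.exp (-(x 0 * |t|)) with hb
  have hbi : Integrable b := integrable_exp_neg_abs hx
  have hbound : ∀ t : ℝ, ‖greenSlice x k t‖ ≤
      2 * Real.exp (x 0 * √|E|) * (b (t + (p - q)) + b (t + (p + q))) := by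
    intro t
    set S := Complex.sqrt (poleSq k t)
    have hS2 : S ^ 2 = ((t : ℂ) + k 1) ^ 2 - E := by
      rw [csqrt_sq, poleSq_eq, hE]
    have hS1 : 1 ≤ ‖S‖ := by
      have h1 : (k 1).im ^ 2 ≤ ‖((t : ℂ) + k 1) ^ 2‖ := by
        rw [norm_pow, ← sq_abs (k 1).im]
        have := Complex.abs_im_le_norm ((t : ℂ) + k 1)
        simp only [Complex.add_im, Complex.ofReal_im, zero_add] at this
        gcongr
      have h2 : ‖((t : ℂ) + k 1) ^ 2‖ - ‖(E : ℂ)‖ ≤ ‖S ^ 2‖ := by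
        rw [hS2]; exact norm_sub_norm_le _ _
      rw [norm_pow] at h1
      rw [Complex.norm_real, Real.norm_eq_abs, norm_pow, norm_pow] at h2
      nlinarith [norm_nonneg S]
    have hre : |S.re - (|t + p|)| ≤ √|E| := by
      simpa using abs_re_sub_abs_le (csqrt_re_nonneg _) hS2
    have hcomp : ∀ u v : ℝ, |u - v| ≤ √|E| → b u ≤ Real.exp (x 0 * √|E|) * b v := by
      intro u v huv
      simp only [hb]
      rw [← Real.exp_add]
      refine Real.exp_le_exp.2 ?_
      have := abs_sub_abs_le_abs_sub v u
      rw [abs_sub_comm] at this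
      nlinarith
    have h0 : ∀ u v : ℝ, |t + p| = u → v = q ∨ v = -q →
        b (u - v) ≤ b (t + (p - q)) + b (t + (p + q)) := by
      rintro u v rfl hv
      have p1 : 0 < b (t + (p - q)) := Real.exp_pos _
      have p2 : 0 < b (t + (p + q)) := Real.exp_pos _
      have hneg : ∀ w, b (-w) = b w := fun w => by simp [hb]
      rcases abs_choice (t + p) with h | h <;> rcases hv with rfl | rfl <;> rw [h]
      · rw [show t + p - q = t + (p - q) by ring]; linarith
      · rw [show t + p - -q = t + (p + q) by ring]; linarith
      · rw [show -(t + p) - q = -(t + (p + q)) by ring, hneg]; linarith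
      · rw [show -(t + p) - -q = -(t + (p - q)) by ring, hneg]; linarith
    have e1 := exp_mul_norm_poleTerm_le (x 0) q hS1
    have e2 := exp_mul_norm_poleTerm_le (x 0) q (S := -S) (by rwa [norm_neg])
    have f1 := hcomp (S.re - q) (|t + p| - q) (by simpa using hre)
    have f2 := hcomp (S.re + q) (|t + p| - -q) (by simpa using hre)
    have g1 := h0 _ q rfl (Or.inl rfl)
    have g2 := h0 _ (-q) rfl (Or.inr rfl)
    have e2' : Real.exp (q * x 0) * ‖poleTerm (x 0) q (-S)‖ ≤ b (S.re + q) := by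
      refine e2.trans_eq ?_
      simp only [hb, Complex.neg_re]
      rw [← abs_neg]; congr 4; ring
    have hX := Real.exp_pos (x 0 * √|E|)
    unfold greenSlice
    rw [norm_mul, norm_exp_phase]
    calc _ ≤ Real.exp (q * x 0) * (‖poleTerm (x 0) q S‖ + ‖poleTerm (x 0) q (-S)‖) := by
          gcongr; exact norm_add_le _ _
      _ ≤ b (S.re - q) + b (S.re + q) := by rw [mul_add]; exact add_le_add e1 e2'
      _ ≤ _ := by
        have k1 := mul_le_mul_of_nonneg_left g1 hX.le
        have k2 := mul_le_mul_of_nonneg_left g2 hX.le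
        linarith
  rw [g_eq_integral hx hk, norm_mul]
  have e0 : ‖-(1 / (4 * (Real.pi : ℂ)))‖ = 1 / (4 * Real.pi) := by
    rw [norm_neg, norm_div, norm_one, norm_mul, Complex.norm_real, Real.norm_eq_abs,
      abs_of_pos Real.pi_pos]; simp
  rw [e0]
  refine mul_le_mul_of_nonneg_left ?_ (by positivity)
  refine (norm_integral_le_of_norm_le (((hbi.comp_add_right (p - q)).add
    (hbi.comp_add_right (p + q))).const_mul _) (ae_of_all _ hbound)).trans_eq ?_
  rw [integral_const_mul]
  simp only [Pi.add_apply]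
  rw [integral_add (hbi.comp_add_right (p - q)) (hbi.comp_add_right (p + q)),
    integral_add_right_eq_self b, integral_add_right_eq_self b]
  ring

/-- Take the two frames in which x makes an angle ±45° with the first axis. The second components of
Im k in them are orthogonal projections of the same vector, so one of their squares is at least half
of |Im k|². -/
lemma exists_norm_g_le {x : R2} (hx : x ≠ 0) (E : ℝ) : ∃ C, ∀ k : C2,
    k 0 ^ 2 + k 1 ^ 2 = E → 2 * (|E| + 1) ≤ ‖imVec k‖ ^ 2 → ‖g x k‖ ≤ C := by
  obtain ⟨c, s, hcs, h0, h1, hpos⟩ := rot_to_pos hx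
  have h2 : (√2 : ℝ) ^ 2 = 2 := Real.sq_sqrt zero_le_two
  have hh : (1 / √2 : ℝ) ^ 2 = 1 / 2 := by rw [div_pow, h2]; norm_num
  have hspos : (0 : ℝ) < 1 / √2 := by positivity
  refine ⟨1 / (4 * Real.pi) * (4 * Real.exp (1 / √2 * ‖x‖ * √|E|) *
      ∫ t : ℝ, Real.exp (-(1 / √2 * ‖x‖ * |t|))), fun k hE hk => ?_⟩
  have hk0 : imVec k ≠ 0 := by
    intro h; rw [h, norm_zero] at hk; nlinarith [abs_nonneg E]
  have key : ∀ d : ℝ, d ^ 2 = 1 / 2 → |E| + 1 ≤ (rotC (1 / √2) d (rotC c s k) 1).im ^ 2 →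
      ‖g x k‖ ≤ 1 / (4 * Real.pi) * (4 * Real.exp (1 / √2 * ‖x‖ * √|E|) *
        ∫ t : ℝ, Real.exp (-(1 / √2 * ‖x‖ * |t|))) := by
    intro d hd him
    have hd' : (1 / √2 : ℝ) ^ 2 + d ^ 2 = 1 := by rw [hh, hd]; norm_num
    have e0 : rotR (1 / √2) d (rotR c s x) 0 = 1 / √2 * ‖x‖ := by
      rw [rotR_zero, h0, h1]; ring
    rw [← g_rot hcs x k, ← g_rot hd' (rotR c s x), ← e0]
    refine norm_g_le_of_pos ?_ (imVec_rotC_ne_zero hd' (imVec_rotC_ne_zero hcs hk0)) ?_ him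
    · rw [e0]; exact mul_pos hspos (norm_pos_iff.2 hx)
    · rw [sum_sq_rotC hd', sum_sq_rotC hcs, hE]
  have hn : ‖imVec (rotC c s k)‖ = ‖imVec k‖ := by rw [imVec_rotC, norm_rotR hcs]
  rw [← hn, R2.norm_sq, imVec_zero, imVec_one] at hk
  set u := (rotC c s k 0).im with hu
  set v := (rotC c s k 1).im with hv
  have him : ∀ d : ℝ, (rotC (1 / √2) d (rotC c s k) 1).im = d * u + 1 / √2 * v := by
    intro d; rw [rotC_one, Complex.add_im, Complex.im_ofReal_mul, Complex.im_ofReal_mul]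
  rcases le_total (u * v) 0 with huv | huv
  · refine key (-(1 / √2)) (by rw [neg_sq, hh]) ?_
    rw [him]
    have : (-(1 / √2) * u + 1 / √2 * v) ^ 2 = (u ^ 2 + v ^ 2 - 2 * (u * v)) / 2 := by
      linear_combination (u - v) ^ 2 * hh
    rw [this]; linarith
  · refine key (1 / √2) hh ?_
    rw [him]
    have : (1 / √2 * u + 1 / √2 * v) ^ 2 = (u ^ 2 + v ^ 2 + 2 * (u * v)) / 2 := by
      linear_combination (u + v) ^ 2 * hh
    rw [this]; linarith

lemma norm_sq_reVec {k : C2} {E : ℝ} (hE : k 0 ^ 2 + k 1 ^ 2 = E) :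
    ‖reVec k‖ ^ 2 = ‖imVec k‖ ^ 2 + E := by
  have := congrArg Complex.re hE
  simp only [sq, Complex.add_re, Complex.mul_re, Complex.ofReal_re] at this
  rw [R2.norm_sq, R2.norm_sq, reVec_zero, reVec_one, imVec_zero, imVec_one]
  linarith

/-- At fixed energy |Re k| ≤ |Im k| + √|E|, so a large modulus forces a large Im k, where g is
bounded. The coefficient α/den tends to 0, trivially if α = 0 and logarithmically otherwise. -/
lemma tendsto_mu (α : ℝ) {x : R2} (hx : x ≠ 0) {E : ℝ} {ι : Type*} {l : Filter ι} {k : ι → C2}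
    (hE : ∀ᶠ i in l, k i 0 ^ 2 + k i 1 ^ 2 = E)
    (hm : Tendsto (fun i => modSum (k i)) l atTop) : Tendsto (fun i => mu α x (k i)) l (𝓝 1) := by
  obtain ⟨C, hC⟩ := exists_norm_g_le hx E
  have hg : ∀ᶠ i in l, ‖g x (k i)‖ ≤ C := by
    filter_upwards [hE, hm.eventually_ge_atTop (√|E| + 2 * √(2 * (|E| + 1)))] with i h1 h2
    refine hC _ h1 ?_
    have h3 := norm_sq_reVec h1
    have h4 : ‖reVec (k i)‖ ≤ ‖imVec (k i)‖ + √|E| := by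
      refine abs_le_of_sq_le_sq' ?_ (by positivity) |>.2
      rw [h3, add_sq, Real.sq_sqrt (abs_nonneg E)]
      nlinarith [le_abs_self E, mul_nonneg (norm_nonneg (imVec (k i))) (Real.sqrt_nonneg |E|)]
    have h5 : √(2 * (|E| + 1)) ≤ ‖imVec (k i)‖ := by unfold modSum at h2; linarith
    calc 2 * (|E| + 1) = √(2 * (|E| + 1)) ^ 2 := (Real.sq_sqrt (by positivity)).symm
      _ ≤ _ := by gcongr
  have hd : Tendsto (fun i => (α : ℂ) / ((den α (modSum (k i)) : ℝ) : ℂ)) l (𝓝 0) := by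
    rcases eq_or_ne α 0 with rfl | hα
    · simpa using tendsto_const_nhds
    have hlog := Real.tendsto_log_atTop.comp hm
    have habs : Tendsto (fun i => |den α (modSum (k i))|) l atTop := by
      have h1 : Tendsto (fun i => |α / (2 * Real.pi)| * Real.log (modSum (k i)) - 1) l atTop :=
        tendsto_atTop_add_const_right _ _ (hlog.const_mul_atTop
          (abs_pos.2 (div_ne_zero hα (by positivity))))
      refine tendsto_atTop_mono (fun i => ?_) h1
      have h2 := abs_sub_abs_le_abs_sub (α / (2 * Real.pi) * Real.log (modSum (k i))) 1
      rw [abs_mul, abs_one, abs_sub_comm] at h2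
      have h3 := mul_le_mul_of_nonneg_left (le_abs_self (Real.log (modSum (k i))))
        (abs_nonneg (α / (2 * Real.pi)))
      unfold den
      linarith
    rw [tendsto_zero_iff_norm_tendsto_zero]
    simp only [norm_div, Complex.norm_real, Real.norm_eq_abs]
    exact habs.const_div_atTop _
  have := hd.zero_mul_isBoundedUnder_le (isBoundedUnder_of_eventually_le hg)
  simpa [mu] using this.const_add 1

lemma tendsto_mu_kE (α : ℝ) {x : R2} (hx : x ≠ 0) {E : ℝ} (hE : E ≠ 0) :
    Tendsto (fun z => mu α x (kE E z)) (cocompact ℂ) (𝓝 1) := by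
  have hn := tendsto_norm_cocompact_atTop (E := ℂ)
  have h1 : ∀ᶠ z : ℂ in cocompact ℂ, 1 ≤ ‖z‖ := hn.eventually_ge_atTop 1
  have h0 : ∀ z : ℂ, 1 ≤ ‖z‖ → z ≠ 0 := fun z hz h => by rw [h, norm_zero] at hz; linarith
  refine tendsto_mu α hx (h1.mono fun z hz => sum_sq_kE E (h0 z hz)) ?_
  refine (hn.const_mul_atTop (Real.sqrt_pos.2 (abs_pos.2 hE))).congr' ?_
  filter_upwards [h1] with z hz
  rw [modSum_kE E hE (h0 z hz), if_pos hz]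

lemma tendsto_mu_kZero (α : ℝ) {x : R2} (hx : x ≠ 0) {σ : ℝ} (hσ : σ = 1 ∨ σ = -1) :
    Tendsto (fun z => mu α x (kZero σ z)) (cocompact ℂ) (𝓝 1) := by
  refine tendsto_mu α hx (Eventually.of_forall fun z => sum_sq_kZero hσ z) ?_
  simp_rw [modSum_kZero hσ]
  exact (tendsto_norm_cocompact_atTop (E := ℂ)).const_mul_atTop two_pos

/-! ### Boundary values of the Green function at real spectral parameters -/

/-- The limit of `pairTerm` as the pole parameter `S² = W` tends to the real number `w ≠ 0`: for
`w < 0` the poles that survive are selected by the rates `Q`, `Y` at which the imaginary parts of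
`k₁` and of `W / 2` vanish. -/
noncomputable def boundaryTerm (r Q w Y : ℝ) : ℂ :=
  if 0 < w then Complex.exp (-(r * (√w : ℝ))) / (√w : ℝ)
  else (if Q * √(-w) < -Y then Complex.I * Complex.exp (Complex.I * (r * (√(-w) : ℝ))) / (√(-w) : ℝ)
      else 0) -
    (if Q * √(-w) < Y then Complex.I * Complex.exp (-(Complex.I * (r * (√(-w) : ℝ)))) / (√(-w) : ℝ)
      else 0)

lemma tendsto_csqrt_of_pos {ι : Type*} {l : Filter ι} {W : ι → ℂ} {w : ℝ} (hw : 0 < w)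
    (hW : Tendsto W l (𝓝 (w : ℂ))) :
    Tendsto (fun i => Complex.sqrt (W i)) l (𝓝 ((√w : ℝ) : ℂ)) := by
  have e : Complex.sqrt (w : ℂ) = ((√w : ℝ) : ℂ) := by
    refine csqrt_eq_of_sq ?_ (by simpa using hw)
    rw [← Complex.ofReal_pow, Real.sq_sqrt hw.le]
  rw [← e]
  exact ((Complex.continuousAt_sqrt (z := (w : ℂ)) (Or.inl (by simpa using hw.le))).tendsto).comp hW

lemma tendsto_pairTerm_of_pos {ι : Type*} {l : Filter ι} (r : ℝ) {q : ι → ℝ} {W : ι → ℂ} {w : ℝ}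
    (hw : 0 < w) (hq : Tendsto q l (𝓝 0)) (hW : Tendsto W l (𝓝 (w : ℂ))) (Q Y : ℝ) :
    Tendsto (fun i => pairTerm r (q i) (Complex.sqrt (W i))) l (𝓝 (boundaryTerm r Q w Y)) := by
  have hs : 0 < √w := Real.sqrt_pos.2 hw
  have hs0 : ((√w : ℝ) : ℂ) ≠ 0 := by exact_mod_cast hs.ne'
  have h := tendsto_csqrt_of_pos hw hW
  have h1 := tendsto_poleTerm r hq h hs0 (by simp [hs.ne'])
  have h2 := tendsto_poleTerm r hq h.neg (neg_ne_zero.2 hs0) (by simp [hs.ne'])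
  have := h1.add h2
  rw [poleTerm, poleTerm, if_pos (by simpa using hs), if_neg (by simp), add_zero]
    at this
  rwa [boundaryTerm, if_pos hw]

/-- The threshold q and Re S both vanish in the limit, proportionally to ε. The limits Q and A of
the rates decide whether the pole survives. -/
lemma tendsto_poleTerm_rate {l : Filter ℝ} (hl : ∀ᶠ ε in l, 0 < ε) (r : ℝ) {q : ℝ → ℝ}
    {S : ℝ → ℂ} {S₀ : ℂ} {a : ℝ → ℝ} {A Q : ℝ} (hS : Tendsto S l (𝓝 S₀)) (h0 : S₀ ≠ 0)
    (hq : ∀ᶠ ε in l, q ε = ε * Q) (ha : ∀ᶠ ε in l, (S ε).re = ε * a ε)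
    (hA : Tendsto a l (𝓝 A)) (hne : A ≠ Q) :
    Tendsto (fun ε => poleTerm r (q ε) (S ε)) l
      (𝓝 (if Q < A then Complex.exp (-(r * S₀)) / S₀ else 0)) := by
  rcases lt_or_gt_of_ne hne with h | h
  · rw [if_neg (not_lt.2 h.le)]
    refine tendsto_poleTerm_of_le r ?_
    filter_upwards [hl, hq, ha, hA.eventually_lt_const h] with ε h1 h2 h3 h4
    rw [h2, h3]; nlinarith
  · rw [if_pos h]
    refine tendsto_poleTerm_of_lt r hS h0 ?_
    filter_upwards [hl, hq, ha, hA.eventually_const_lt h] with ε h1 h2 h3 h4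
    rw [h2, h3]; nlinarith

/-- The limit w lies on the cut of the square root, so the pair is rewritten with ∓iV, V = √(-W),
which is continuous there. From V² = -W one gets Im V = -εy/Re V, the rate at which Re(-iV)
vanishes. -/
lemma tendsto_pairTerm_of_neg {l : Filter ℝ} (hl : ∀ᶠ ε in l, 0 < ε) (r : ℝ) {q : ℝ → ℝ}
    {W : ℝ → ℂ} {y : ℝ → ℝ} {w Q Y : ℝ} (hw : w < 0) (hq : ∀ᶠ ε in l, q ε = ε * Q)
    (hW : Tendsto W l (𝓝 (w : ℂ))) (hy : ∀ᶠ ε in l, (W ε).im = 2 * ε * y ε)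
    (hY : Tendsto y l (𝓝 Y)) (h1 : -Y ≠ Q * √(-w)) (h2 : Y ≠ Q * √(-w)) :
    Tendsto (fun ε => pairTerm r (q ε) (Complex.sqrt (W ε))) l (𝓝 (boundaryTerm r Q w Y)) := by
  have hw' : 0 < -w := by linarith
  rw [boundaryTerm, if_neg (not_lt.2 hw.le)]
  have hm : 0 < √(-w) := Real.sqrt_pos.2 hw'
  have hVt : Tendsto (fun ε => Complex.sqrt (-(W ε))) l (𝓝 ((√(-w) : ℝ) : ℂ)) :=
    tendsto_csqrt_of_pos hw' (by simpa using hW.neg)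
  generalize √(-w) = m at *
  have hm0 : (m : ℂ) ≠ 0 := by exact_mod_cast hm.ne'
  set V : ℝ → ℂ := fun ε => Complex.sqrt (-(W ε)) with hV
  have hVre : Tendsto (fun ε => (V ε).re) l (𝓝 m) := by
    exact (Complex.continuous_re.tendsto _).comp hVt
  have hVpos : ∀ᶠ ε in l, 0 < (V ε).re := hVre.eventually_const_lt hm
  have hVsq : ∀ ε, V ε ^ 2 = -(W ε) := fun ε => csqrt_sq _
  have hVim : ∀ᶠ ε in l, (V ε).im = ε * (-(y ε) / (V ε).re) := by
    filter_upwards [hVpos, hy] with ε hp hyε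
    have := congrArg Complex.im (hVsq ε)
    rw [sq, Complex.mul_im, Complex.neg_im, hyε] at this
    field_simp
    linarith
  have hlim : Tendsto (fun ε => -(y ε) / (V ε).re) l (𝓝 (-Y / m)) := hY.neg.div hVre hm.ne'
  have e : (fun ε => pairTerm r (q ε) (Complex.sqrt (W ε))) = fun ε =>
      poleTerm r (q ε) (-Complex.I * V ε) + poleTerm r (q ε) (Complex.I * V ε) := by
    ext ε
    rw [pairTerm_congr r (q ε) (T := -Complex.I * V ε), pairTerm, neg_mul, neg_neg]
    rw [csqrt_sq, mul_pow, hVsq]; simp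
  rw [e]
  have t1 := tendsto_poleTerm_rate hl r (S := fun ε => -Complex.I * V ε)
    (a := fun ε => -(y ε) / (V ε).re) (hVt.const_mul (-Complex.I))
    (mul_ne_zero (neg_ne_zero.2 Complex.I_ne_zero) hm0) hq
    (hVim.mono fun ε h => by simpa using h) hlim
    (fun h => h1 (by rw [← h]; field_simp))
  have t2 := tendsto_poleTerm_rate hl r (S := fun ε => Complex.I * V ε)
    (a := fun ε => -(-(y ε) / (V ε).re)) (hVt.const_mul Complex.I)
    (mul_ne_zero Complex.I_ne_zero hm0) hq
    (hVim.mono fun ε h => by simp [h]) hlim.neg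
    (fun h => h2 (by rw [← h]; field_simp))
  have := t1.add t2
  convert this using 2
  rw [sub_eq_add_neg]
  have c1 : Q < -Y / m ↔ Q * m < -Y := lt_div_iff₀ hm
  have c2 : Q < -(-Y / m) ↔ Q * m < Y := by rw [neg_div, neg_neg, lt_div_iff₀ hm]
  simp only [c1, c2]
  congr 1
  · refine if_congr Iff.rfl ?_ rfl
    rw [show -((r : ℂ) * (-Complex.I * m)) = Complex.I * (r * m) by ring]
    generalize Complex.exp (Complex.I * (r * m)) = X
    rw [neg_mul, div_neg, eq_neg_iff_add_eq_zero]
    field_simp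
    linear_combination X * Complex.I_sq
  · split_ifs
    · rw [show -((r : ℂ) * (Complex.I * m)) = -(Complex.I * (r * m)) by ring]
      generalize Complex.exp (-(Complex.I * (r * m))) = X
      rw [neg_eq_iff_add_eq_zero]
      field_simp
      linear_combination X * Complex.I_sq
    · exact neg_zero

lemma inv_sqrt_abs_sq_sub_le {κ : ℝ} (hκ : 0 < κ) (τ : ℝ) :
    1 / √|τ ^ 2 - κ ^ 2| ≤ κ ^ (-(1 / 2) : ℝ) *
      (2 + invSqrtBump (τ - κ) + invSqrtBump (τ + κ)) := by
  have e : 1 / √|τ ^ 2 - κ ^ 2| = |τ ^ 2 - κ ^ 2| ^ (-(1 / 2) : ℝ) := by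
    rw [Real.rpow_neg (abs_nonneg _), ← Real.sqrt_eq_rpow, one_div]
  rw [e]
  have hf : |τ ^ 2 - κ ^ 2| = (|τ| + κ) * |(|τ| - κ)| := by
    rw [← abs_of_pos (by positivity : 0 < |τ| + κ), ← abs_mul, ← sq_abs τ]; ring_nf
  rw [hf, Real.mul_rpow (by positivity) (abs_nonneg _)]
  refine mul_le_mul ?_ abs_abs_sub_rpow_le (by positivity) (by positivity)
  exact Real.rpow_le_rpow_of_nonpos hκ (by linarith [abs_nonneg τ]) (by norm_num)

lemma ae_sq_ne (c : ℝ) : ∀ᵐ τ : ℝ, τ ^ 2 ≠ c := (finite_sq_eq c).countable.ae_notMem volume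

/-- Dominated convergence. The zeros of `poleSq` may move with ε; in the variable τ, with t = cτ -
b, the hypothesis `hW` bounds the slices by a fixed function whose inverse square root singularities
sit at ±κ. -/
lemma tendsto_g_of_slices {x : R2} (hx : 0 < x 0) {l : ℝ → C2} {c : ℝ → ℝ} {b κ : ℝ} {k : C2}
    (hκ : 0 < κ) {K : ℝ → ℂ} (him : ∀ᶠ ε in 𝓝[>] (0 : ℝ), imVec (l ε) ≠ 0)
    (hl : Tendsto l (𝓝[>] 0) (𝓝 k)) (hc : Tendsto c (𝓝[>] 0) (𝓝 1))
    (hW : ∀ᶠ ε in 𝓝[>] (0 : ℝ), ∀ τ, |τ ^ 2 - κ ^ 2| / 4 ≤ ‖poleSq (l ε) (c ε * τ - b : ℝ)‖)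
    (hK : ∀ᵐ τ : ℝ, Tendsto (fun ε => greenSlice x (l ε) (c ε * τ - b)) (𝓝[>] 0) (𝓝 (K τ))) :
    Integrable K ∧ Tendsto (fun ε => g x (l ε)) (𝓝[>] 0)
      (𝓝 (-(1 / (4 * (Real.pi : ℂ))) * ∫ τ, K τ)) := by
  set M := ‖k‖ + 1
  have hM : ∀ᶠ ε in 𝓝[>] (0 : ℝ), ‖l ε‖ ≤ M :=
    hl.norm.eventually_le_const (by simp only [M]; linarith)
  have hc2 : ∀ᶠ ε in 𝓝[>] (0 : ℝ), 1 / 2 ≤ c ε := hc.eventually_const_le (by norm_num)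
  set C := Real.exp (M * x 0) * (1 + Real.exp (2 * x 0 * M)) * (Real.exp (2 * M * x 0) *
    Real.exp (x 0 / 2 * |b|)) * 2 * κ ^ (-(1 / 2) : ℝ) with hC
  set B : ℝ → ℝ := fun τ => C * (2 * Real.exp (-(x 0 / 4 * |τ|)) + invSqrtBump (τ - κ) +
    invSqrtBump (τ + κ)) with hB
  have hBi : Integrable B := by
    refine Integrable.const_mul ?_ C
    exact (((integrable_exp_neg_abs (by linarith : 0 < x 0 / 4)).const_mul 2).add
      (integrable_invSqrtBump.comp_sub_right κ)).add (integrable_invSqrtBump.comp_add_right κ)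
  have hbound : ∀ᶠ ε in 𝓝[>] (0 : ℝ), ∀ᵐ τ : ℝ, ‖greenSlice x (l ε) (c ε * τ - b)‖ ≤ B τ := by
    filter_upwards [hM, hc2, hW] with ε h1 h2 h3
    filter_upwards [ae_sq_ne (κ ^ 2)] with τ hτ
    have hw : 0 < |τ ^ 2 - κ ^ 2| := abs_pos.2 (sub_ne_zero.2 hτ)
    refine (norm_greenSlice_le hx (l ε) _ h1).trans ?_
    have e1 : Real.exp (-(x 0 / 2 * |c ε * τ - b|)) ≤
        Real.exp (x 0 / 2 * |b|) * Real.exp (-(x 0 / 4 * |τ|)) := by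
      rw [← Real.exp_add]
      refine Real.exp_le_exp.2 ?_
      have := abs_sub_abs_le_abs_sub (c ε * τ) b
      rw [abs_mul, abs_of_pos (by linarith : 0 < c ε)] at this
      nlinarith [abs_nonneg τ, abs_nonneg b, mul_nonneg hx.le (abs_nonneg τ)]
    have e2 : 1 / √‖poleSq (l ε) (c ε * τ - b : ℝ)‖ ≤ 2 * (κ ^ (-(1 / 2) : ℝ) *
        (2 + invSqrtBump (τ - κ) + invSqrtBump (τ + κ))) := by
      refine le_trans ?_ (mul_le_mul_of_nonneg_left (inv_sqrt_abs_sq_sub_le hκ τ) two_pos.le)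
      have h4 : √(|τ ^ 2 - κ ^ 2| / 4) = √|τ ^ 2 - κ ^ 2| / 2 := by
        rw [Real.sqrt_div (abs_nonneg _), show (4 : ℝ) = 2 ^ 2 by norm_num,
          Real.sqrt_sq two_pos.le]
      have h5 := Real.sqrt_le_sqrt (h3 τ)
      rw [h4] at h5
      have h6 := Real.sqrt_pos.2 hw
      calc _ ≤ 1 / (√|τ ^ 2 - κ ^ 2| / 2) := by
            exact one_div_le_one_div_of_le (by positivity) h5
        _ = _ := by field_simp
    have hx1 : Real.exp (-(x 0 / 4 * |τ|)) ≤ 1 := by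
      rw [Real.exp_le_one_iff]; nlinarith [mul_nonneg hx.le (abs_nonneg τ)]
    have n1 := invSqrtBump_nonneg (τ - κ)
    have n2 := invSqrtBump_nonneg (τ + κ)
    have hprod : Real.exp (-(x 0 / 4 * |τ|)) * (2 + invSqrtBump (τ - κ) + invSqrtBump (τ + κ)) ≤
        2 * Real.exp (-(x 0 / 4 * |τ|)) + invSqrtBump (τ - κ) + invSqrtBump (τ + κ) := by
      nlinarith
    calc _ = Real.exp (M * x 0) * (1 + Real.exp (2 * x 0 * M)) * Real.exp (2 * M * x 0) *
          (Real.exp (-(x 0 / 2 * |c ε * τ - b|)) *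
            (1 / √‖poleSq (l ε) (c ε * τ - b : ℝ)‖)) := by ring
      _ ≤ Real.exp (M * x 0) * (1 + Real.exp (2 * x 0 * M)) * Real.exp (2 * M * x 0) *
          ((Real.exp (x 0 / 2 * |b|) * Real.exp (-(x 0 / 4 * |τ|))) * (2 * (κ ^ (-(1 / 2) : ℝ) *
        (2 + invSqrtBump (τ - κ) + invSqrtBump (τ + κ))))) := by gcongr
      _ = C * (Real.exp (-(x 0 / 4 * |τ|)) *
          (2 + invSqrtBump (τ - κ) + invSqrtBump (τ + κ))) := by rw [hC]; ring
      _ ≤ _ := mul_le_mul_of_nonneg_left hprod (by positivity)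
  have hslice : ∀ᶠ ε in 𝓝[>] (0 : ℝ), Integrable (fun τ => greenSlice x (l ε) (c ε * τ - b)) := by
    filter_upwards [him, hc2] with ε h1 h2
    have := (greenSlice_spec hx h1).1
    exact ((this.comp_sub_right b).comp_mul_left' (by linarith : c ε ≠ 0))
  have hmeas : ∀ᶠ ε in 𝓝[>] (0 : ℝ),
      AEStronglyMeasurable (fun τ => greenSlice x (l ε) (c ε * τ - b)) :=
    hslice.mono fun ε h => h.aestronglyMeasurable
  constructor
  -- Measurability of the limit and a bound off one null set require a sequence of values of ε.
  · obtain ⟨u, hu⟩ := exists_seq_tendsto (𝓝[>] (0 : ℝ))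
    obtain ⟨N, hN⟩ := ((hu.eventually hmeas).and (hu.eventually hbound)).exists_forall_of_atTop
    refine hBi.mono' ?_ ?_
    · refine aestronglyMeasurable_of_tendsto_ae atTop (fun n => (hN (n + N) (by omega)).1) ?_
      filter_upwards [hK] with τ hτ
      exact (tendsto_add_atTop_iff_nat N).2 (hτ.comp hu)
    · have hall : ∀ᵐ τ, ∀ n, ‖greenSlice x (l (u (n + N))) (c (u (n + N)) * τ - b)‖ ≤ B τ :=
        ae_all_iff.2 fun n => (hN (n + N) (by omega)).2
      filter_upwards [hK, hall] with τ hτ hb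
      exact le_of_tendsto ((tendsto_add_atTop_iff_nat N).2 (hτ.comp hu)).norm
        (Eventually.of_forall hb)
  · have h1 := tendsto_integral_filter_of_dominated_convergence B hmeas hbound hBi hK
    have h2 := (Complex.continuous_ofReal.tendsto 1).comp hc
    have h3 := (h2.mul h1).const_mul (-(1 / (4 * (Real.pi : ℂ))))
    rw [Complex.ofReal_one, one_mul] at h3
    refine h3.congr' ?_
    filter_upwards [him, hc2] with ε h1 h2
    rw [g_eq_integral hx h1]
    have hc0 : 0 < c ε := by linarith
    have e := Measure.integral_comp_mul_left (fun t => greenSlice x (l ε) (t - b)) (c ε)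
    rw [integral_sub_right_eq_self (fun t => greenSlice x (l ε) t) b] at e
    simp only [Function.comp_apply]
    rw [e, abs_of_pos (inv_pos.2 hc0), Complex.real_smul, ← mul_assoc ((c ε : ℝ) : ℂ)]
    rw [← Complex.ofReal_mul, mul_inv_cancel₀ hc0.ne', Complex.ofReal_one, one_mul]

lemma abs_mul_abs_le_norm_mul (u v : ℂ) {a b : ℝ} (hu : u.re = a) (hv : v.re = b) :
    |a * b| ≤ ‖u * v‖ := by
  rw [norm_mul, abs_mul, ← hu, ← hv]
  exact mul_le_mul (Complex.abs_re_le_norm u) (Complex.abs_re_le_norm v) (abs_nonneg _)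
    (norm_nonneg _)

lemma eq_ofReal_of_imVec {k : C2} (hk : imVec k = 0) :
    k 0 = ((k 0).re : ℂ) ∧ k 1 = ((k 1).re : ℂ) := by
  have i0 : (k 0).im = 0 := congrArg (fun v : R2 => v 0) hk
  have i1 : (k 1).im = 0 := congrArg (fun v : R2 => v 1) hk
  exact ⟨Complex.ext rfl (by simpa using i0), Complex.ext rfl (by simpa using i1)⟩

lemma norm_sq_of_imVec {k : C2} (hk : imVec k = 0) :
    ‖k‖ ^ 2 = (k 0).re ^ 2 + (k 1).re ^ 2 := by
  obtain ⟨h0, h1⟩ := eq_ofReal_of_imVec hk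
  rw [C2.norm_sq, h0, h1, Complex.norm_real, Complex.norm_real]
  simp

/-- `exp(ikx) g⁺(x,k)` as a function of `|x|` and `|k|`. -/
noncomputable def plusG (r κ : ℝ) : ℂ :=
  -(1 / (4 * (Real.pi : ℂ))) * ∫ τ : ℝ, boundaryTerm r 0 (τ ^ 2 - κ ^ 2) (-1)

/-- `exp(ikx) g_±(x,k)` for `x = (r,0)`, `k = (a,b)` and `|k| = κ`. -/
noncomputable def pmG (σ r κ a b : ℝ) : ℂ :=
  -(1 / (4 * (Real.pi : ℂ))) * ∫ τ : ℝ, boundaryTerm r (-(σ * b)) (τ ^ 2 - κ ^ 2) (σ * a * τ)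

/-- With m the square root, (m, τ) and (±a, b) both have length κ and are distinct because τ ≠ b.
Strict Cauchy-Schwarz gives ±am + bτ < κ². -/
lemma outgoing_rates {κ a b τ : ℝ} (h : κ ^ 2 = a ^ 2 + b ^ 2) (hτ : τ ≠ b)
    (hw : τ ^ 2 - κ ^ 2 < 0) :
    a * √(-(τ ^ 2 - κ ^ 2)) < -(b * τ - κ ^ 2) ∧ b * τ - κ ^ 2 < a * √(-(τ ^ 2 - κ ^ 2)) := by
  have hs : √(-(τ ^ 2 - κ ^ 2)) ^ 2 = -(τ ^ 2 - κ ^ 2) := Real.sq_sqrt (by linarith)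
  generalize √(-(τ ^ 2 - κ ^ 2)) = m at *
  have h1 : 0 < (τ - b) ^ 2 := by
    have := sub_ne_zero.2 hτ
    positivity
  constructor <;> nlinarith [sq_nonneg (a - m), sq_nonneg (a + m)]

lemma tendsto_boundary_slice {x : R2} (h1 : x 1 = 0) {l : ℝ → C2} {k : C2}
    (hl : Tendsto l (𝓝[>] 0) (𝓝 k)) {t : ℝ → ℝ} {y : ℝ → ℝ} {w Q Y : ℝ} (hw : w ≠ 0)
    (hq : ∀ᶠ ε in 𝓝[>] (0 : ℝ), (l ε 0).im = ε * Q)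
    (hW : Tendsto (fun ε => poleSq (l ε) (t ε)) (𝓝[>] 0) (𝓝 (w : ℂ)))
    (hy : ∀ᶠ ε in 𝓝[>] (0 : ℝ), (poleSq (l ε) (t ε)).im = 2 * ε * y ε)
    (hY : Tendsto y (𝓝[>] 0) (𝓝 Y)) (hne : w < 0 → -Y ≠ Q * √(-w) ∧ Y ≠ Q * √(-w)) :
    Tendsto (fun ε => greenSlice x (l ε) (t ε)) (𝓝[>] 0)
      (𝓝 (Complex.exp (-(Complex.I * bdot k x)) * boundaryTerm (x 0) Q w Y)) := by
  have hpos : ∀ᶠ ε in 𝓝[>] (0 : ℝ), 0 < ε := eventually_mem_nhdsWithin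
  have e : Complex.exp (-(Complex.I * bdot k x)) = Complex.exp (Complex.I * (0 - k 0 * x 0)) := by
    rw [bdot, h1]; congr 1; simp
  unfold greenSlice
  rw [e]
  simp only [h1, Complex.ofReal_zero, mul_zero]
  refine Tendsto.mul ?_ ?_
  · have hc : Continuous fun k : C2 => Complex.exp (Complex.I * (0 - k 0 * x 0)) := by fun_prop
    exact (hc.tendsto k).comp hl
  · rcases lt_or_gt_of_ne hw with h | h
    · exact tendsto_pairTerm_of_neg hpos _ h hq hW hy hY (hne h).1 (hne h).2
    · refine tendsto_pairTerm_of_pos _ h ?_ hW Q Y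
      have : Tendsto (fun ε : ℝ => ε * Q) (𝓝[>] 0) (𝓝 0) := by
        refine tendsto_nhdsWithin_of_tendsto_nhds (Continuous.tendsto' (by fun_prop) _ _ (by simp))
      exact this.congr' (hq.mono fun ε h => h.symm)

lemma integrable_of_exp_mul {u : ℂ} {f : ℝ → ℂ}
    (h : Integrable (fun τ => Complex.exp u * f τ)) : Integrable f :=
  (integrable_const_mul_iff (isUnit_iff_ne_zero.2 (Complex.exp_ne_zero u)) f).1 h

/-- For k(1 + iε) the function `poleSq` splits into two factors with real parts τ ∓ κ, and half its
imaginary part has rate bτ - κ². By `outgoing_rates` the selection is the same for almost every |τ|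
< κ: the outgoing pole only. -/
lemma tendsto_g_plus_frame {x : R2} (hx : 0 < x 0) (h1 : x 1 = 0) {k : C2} (hk : imVec k = 0)
    (hk0 : k ≠ 0) :
    Integrable (fun τ : ℝ => boundaryTerm (x 0) 0 (τ ^ 2 - ‖k‖ ^ 2) (-1)) ∧
    Tendsto (fun ε : ℝ => g x (k + ((ε : ℂ) * Complex.I) • k)) (𝓝[>] (0 : ℝ))
      (𝓝 (Complex.exp (-(Complex.I * bdot k x)) * plusG (x 0) ‖k‖)) := by
  have hκ : 0 < ‖k‖ := norm_pos_iff.2 hk0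
  obtain ⟨e0, e1⟩ := eq_ofReal_of_imVec hk
  have hn := norm_sq_of_imVec hk
  set a := (k 0).re
  set b := (k 1).re
  set κ := ‖k‖
  set l : ℝ → C2 := fun ε => k + ((ε : ℂ) * Complex.I) • k with hl
  have l0 : ∀ ε, l ε 0 = a + ε * Complex.I * a := fun ε => by simp [hl, e0]
  have l1 : ∀ ε, l ε 1 = b + ε * Complex.I * b := fun ε => by simp [hl, e1]
  have hlt : Tendsto l (𝓝[>] 0) (𝓝 k) :=
    tendsto_nhdsWithin_of_tendsto_nhds (Continuous.tendsto' (by fun_prop) _ _ (by simp [hl]))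
  have hnC : (κ : ℂ) ^ 2 = a ^ 2 + b ^ 2 := by exact_mod_cast hn
  have hfac : ∀ ε τ : ℝ, poleSq (l ε) (1 * τ - b : ℝ) =
      ((τ - κ : ℝ) + Complex.I * (ε * (b - κ) : ℝ)) *
        ((τ + κ : ℝ) + Complex.I * (ε * (b + κ) : ℝ)) := fun ε τ => by
    rw [poleSq_eq, l0, l1]
    push_cast
    linear_combination (1 + ε * Complex.I) ^ 2 * hnC
  have hfac' : ∀ ε τ : ℝ, poleSq (l ε) (1 * τ - b : ℝ) =
      ((τ ^ 2 - κ ^ 2 - ε ^ 2 * (b ^ 2 - κ ^ 2) : ℝ) : ℂ) +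
        Complex.I * (2 * ε * (b * τ - κ ^ 2) : ℝ) := fun ε τ => by
    rw [hfac]
    push_cast
    linear_combination (ε ^ 2 * (b - κ) * (b + κ) : ℂ) * Complex.I_sq
  have key : ∀ᵐ τ : ℝ, Tendsto (fun ε => greenSlice x (l ε) (1 * τ - b)) (𝓝[>] 0)
      (𝓝 (Complex.exp (-(Complex.I * bdot k x)) * boundaryTerm (x 0) 0 (τ ^ 2 - κ ^ 2) (-1))) := by
    filter_upwards [ae_sq_ne (κ ^ 2), (Set.countable_singleton b).ae_notMem volume] with τ hτ hb
    have hb' : τ ≠ b := hb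
    -- Only the outcome of the two comparisons matters for negative w; the rates 0 and -1 stand for
    -- the outgoing selection and remove the dependence on a and b.
    have heq : boundaryTerm (x 0) 0 (τ ^ 2 - κ ^ 2) (-1) =
        boundaryTerm (x 0) a (τ ^ 2 - κ ^ 2) (b * τ - κ ^ 2) := by
      unfold boundaryTerm
      by_cases hw : 0 < τ ^ 2 - κ ^ 2
      · rw [if_pos hw, if_pos hw]
      · have hw' : τ ^ 2 - κ ^ 2 < 0 := lt_of_le_of_ne (not_lt.1 hw) (sub_ne_zero.2 hτ)
        obtain ⟨c1, c2⟩ := outgoing_rates hn hb' hw'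
        rw [if_neg hw, if_neg hw, if_pos c1, if_neg (not_lt.2 c2.le), if_pos (by norm_num), if_neg (by norm_num)]
    rw [heq]
    refine tendsto_boundary_slice h1 hlt (y := fun _ => b * τ - κ ^ 2) (sub_ne_zero.2 hτ) ?_ ?_ ?_
      tendsto_const_nhds ?_
    · refine Eventually.of_forall fun ε => ?_
      rw [l0]; simp
    · simp only [hfac']
      refine tendsto_nhdsWithin_of_tendsto_nhds (Continuous.tendsto' (by fun_prop) _ _ ?_)
      simp
    · refine Eventually.of_forall fun ε => ?_
      rw [hfac', Complex.add_im, Complex.ofReal_im, Complex.I_mul_im, Complex.ofReal_re, zero_add]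
    · intro hw
      obtain ⟨c1, c2⟩ := outgoing_rates hn hb' hw
      exact ⟨c1.ne', c2.ne⟩
  have := tendsto_g_of_slices hx hκ (l := l) (c := fun _ => 1) ?_ hlt tendsto_const_nhds ?_ key
  · refine ⟨integrable_of_exp_mul this.1, ?_⟩
    have h2 := this.2
    rw [integral_const_mul] at h2
    convert h2 using 2
    rw [plusG]; ring
  · filter_upwards [self_mem_nhdsWithin] with ε hε
    have hε' : (0 : ℝ) < ε := hε
    rw [R2.ne_zero_iff, imVec_zero, imVec_one, l0, l1]
    simp
    rw [mul_pow, mul_pow, ← mul_add, ← hn]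
    positivity
  · refine Eventually.of_forall fun ε τ => ?_
    rw [hfac]
    refine le_trans ?_ (abs_mul_abs_le_norm_mul _ _ (a := τ - κ) (b := τ + κ)
      (by rw [Complex.add_re, Complex.I_mul_re]; simp)
      (by rw [Complex.add_re, Complex.I_mul_re]; simp))
    rw [show (τ - κ) * (τ + κ) = τ ^ 2 - κ ^ 2 by ring]
    linarith [abs_nonneg (τ ^ 2 - κ ^ 2)]

lemma tendsto_g_pm_frame {x : R2} (hx : 0 < x 0) (h1 : x 1 = 0) {k : C2} (hk : imVec k = 0)
    (hk0 : k ≠ 0) {σ : ℝ} (hσ : σ = 1 ∨ σ = -1) :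
    Integrable (fun τ : ℝ => boundaryTerm (x 0) (-(σ * (k 1).re)) (τ ^ 2 - ‖k‖ ^ 2)
      (σ * (k 0).re * τ)) ∧
    Tendsto (fun ε : ℝ => g x (k + ((σ : ℂ) * (ε : ℂ) * Complex.I) • perp k)) (𝓝[>] (0 : ℝ))
      (𝓝 (Complex.exp (-(Complex.I * bdot k x)) * pmG σ (x 0) ‖k‖ (k 0).re (k 1).re)) := by
  have hκ : 0 < ‖k‖ := norm_pos_iff.2 hk0
  obtain ⟨e0, e1⟩ := eq_ofReal_of_imVec hk
  have hn := norm_sq_of_imVec hk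
  have hσ2 : σ ^ 2 = 1 := by rcases hσ with rfl | rfl <;> norm_num
  have hσ2C : (σ : ℂ) ^ 2 = 1 := by exact_mod_cast hσ2
  set a := (k 0).re
  set b := (k 1).re
  set κ := ‖k‖
  set l : ℝ → C2 := fun ε => k + ((σ : ℂ) * (ε : ℂ) * Complex.I) • perp k with hl
  have l0 : ∀ ε, l ε 0 = a - σ * ε * Complex.I * b := fun ε => by
    simp only [hl, PiLp.add_apply, PiLp.smul_apply, perp_zero, smul_eq_mul, e0, e1]; ring
  have l1 : ∀ ε, l ε 1 = b + σ * ε * Complex.I * a := fun ε => by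
    simp only [hl, PiLp.add_apply, PiLp.smul_apply, perp_one, smul_eq_mul, e0, e1]
  have hlt : Tendsto l (𝓝[>] 0) (𝓝 k) :=
    tendsto_nhdsWithin_of_tendsto_nhds (Continuous.tendsto' (by fun_prop) _ _ (by simp [hl]))
  have hnC : (κ : ℂ) ^ 2 = a ^ 2 + b ^ 2 := by exact_mod_cast hn
  -- The vectors k and k_⊥ are orthogonal and equally long, so (k ± iεk_⊥)² = (1 - ε²)κ². Rescaling
  -- τ by √(1 - ε²) pins the branch points to ±κ.
  set c : ℝ → ℝ := fun ε => √(1 - ε ^ 2) with hc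
  have hct : Tendsto c (𝓝[>] 0) (𝓝 1) :=
    tendsto_nhdsWithin_of_tendsto_nhds (Continuous.tendsto' (by fun_prop) _ _ (by simp [hc]))
  have hsmall : ∀ᶠ ε in 𝓝[>] (0 : ℝ), c ε ^ 2 = 1 - ε ^ 2 := by
    have : ∀ᶠ ε in 𝓝[>] (0 : ℝ), ε < 1 := nhdsWithin_le_nhds (eventually_lt_nhds one_pos)
    filter_upwards [this, self_mem_nhdsWithin] with ε h2 h3
    have h3' : (0 : ℝ) < ε := h3
    exact Real.sq_sqrt (by nlinarith)
  have hfac : ∀ᶠ ε in 𝓝[>] (0 : ℝ), ∀ τ : ℝ, poleSq (l ε) (c ε * τ - b : ℝ) =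
      ((c ε * (τ - κ) : ℝ) + Complex.I * (σ * ε * a : ℝ)) *
        ((c ε * (τ + κ) : ℝ) + Complex.I * (σ * ε * a : ℝ)) := by
    filter_upwards [hsmall] with ε hε τ
    have hεC : (c ε : ℂ) ^ 2 = 1 - ε ^ 2 := by exact_mod_cast hε
    rw [poleSq_eq, l0, l1]
    push_cast
    linear_combination (1 - (ε : ℂ) ^ 2) * hnC + (κ : ℂ) ^ 2 * hεC -
      (ε ^ 2 * (a ^ 2 + b ^ 2) : ℂ) * σ ^ 2 * Complex.I_sq +
      (ε ^ 2 * (a ^ 2 + b ^ 2) : ℂ) * hσ2C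
  have hfac' : ∀ᶠ ε in 𝓝[>] (0 : ℝ), ∀ τ : ℝ, poleSq (l ε) (c ε * τ - b : ℝ) =
      ((c ε ^ 2 * (τ ^ 2 - κ ^ 2) - ε ^ 2 * a ^ 2 : ℝ) : ℂ) +
        Complex.I * (2 * ε * (σ * a * (c ε * τ)) : ℝ) := by
    filter_upwards [hfac] with ε hε τ
    rw [hε]
    push_cast
    linear_combination (σ ^ 2 * ε ^ 2 * a ^ 2 : ℂ) * Complex.I_sq -
      (ε ^ 2 * a ^ 2 : ℂ) * hσ2C
  have key : ∀ᵐ τ : ℝ, Tendsto (fun ε => greenSlice x (l ε) (c ε * τ - b)) (𝓝[>] 0)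
      (𝓝 (Complex.exp (-(Complex.I * bdot k x)) *
        boundaryTerm (x 0) (-(σ * b)) (τ ^ 2 - κ ^ 2) (σ * a * τ))) := by
    filter_upwards [ae_sq_ne (κ ^ 2), ae_sq_ne (b ^ 2)] with τ hτ hb
    refine tendsto_boundary_slice h1 hlt (y := fun ε => σ * a * (c ε * τ)) (sub_ne_zero.2 hτ)
      ?_ ?_ ?_ ?_ ?_
    · refine Eventually.of_forall fun ε => ?_
      rw [l0, show (a : ℂ) - σ * ε * Complex.I * b = (a : ℂ) + Complex.I * (-(σ * ε * b) : ℝ) by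
        push_cast; ring, Complex.add_im, Complex.I_mul_im, Complex.ofReal_im, Complex.ofReal_re]
      ring
    · have hcont : Tendsto (fun ε : ℝ => ((c ε ^ 2 * (τ ^ 2 - κ ^ 2) - ε ^ 2 * a ^ 2 : ℝ) : ℂ) +
          Complex.I * (2 * ε * (σ * a * (c ε * τ)) : ℝ)) (𝓝[>] 0) (𝓝 ((τ ^ 2 - κ ^ 2 : ℝ) : ℂ)) := by
        refine tendsto_nhdsWithin_of_tendsto_nhds (Continuous.tendsto' (by fun_prop) _ _ ?_)
        simp [hc]
      exact hcont.congr' (hfac'.mono fun ε h => (h τ).symm)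
    · filter_upwards [hfac'] with ε h
      rw [h, Complex.add_im, Complex.ofReal_im, Complex.I_mul_im, Complex.ofReal_re, zero_add]
    · have := (hct.mul_const τ).const_mul (σ * a)
      rwa [one_mul] at this
    · intro hw
      have hs : √(-(τ ^ 2 - κ ^ 2)) ^ 2 = -(τ ^ 2 - κ ^ 2) := Real.sq_sqrt (by linarith)
      generalize √(-(τ ^ 2 - κ ^ 2)) = m at *
      have aux : (σ * a * τ) ^ 2 ≠ (-(σ * b) * m) ^ 2 := by
        intro h
        have h5 : a ^ 2 * τ ^ 2 = b ^ 2 * m ^ 2 := by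
          linear_combination h - (a ^ 2 * τ ^ 2 - b ^ 2 * m ^ 2) * hσ2
        rw [hs] at h5
        have h6 : κ ^ 2 * (τ ^ 2 - b ^ 2) = 0 := by rw [hn] at h5 ⊢; linear_combination h5
        rcases mul_eq_zero.1 h6 with h7 | h7
        · exact absurd h7 (by positivity)
        · exact hb (by linarith)
      exact ⟨fun h => aux (by rw [← h]; ring), fun h => aux (by rw [← h])⟩
  have := tendsto_g_of_slices hx hκ (l := l) (c := c) ?_ hlt hct ?_ key
  · refine ⟨integrable_of_exp_mul this.1, ?_⟩
    have h2 := this.2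
    rw [integral_const_mul] at h2
    convert h2 using 2
    rw [pmG]; ring
  · filter_upwards [self_mem_nhdsWithin] with ε hε
    have hε' : (0 : ℝ) < ε := hε
    rw [R2.ne_zero_iff, imVec_zero, imVec_one, l0, l1]
    have q0 : ((a : ℂ) - σ * ε * Complex.I * b).im = -(σ * ε * b) := by
      rw [show (a : ℂ) - σ * ε * Complex.I * b = (a : ℂ) + Complex.I * (-(σ * ε * b) : ℝ) by
        push_cast; ring, Complex.add_im, Complex.I_mul_im, Complex.ofReal_im, Complex.ofReal_re]
      ring
    have q1 : ((b : ℂ) + σ * ε * Complex.I * a).im = σ * ε * a := by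
      rw [show (b : ℂ) + σ * ε * Complex.I * a = (b : ℂ) + Complex.I * (σ * ε * a : ℝ) by
        push_cast; ring, Complex.add_im, Complex.I_mul_im, Complex.ofReal_im, Complex.ofReal_re]
      ring
    rw [q0, q1]
    have : 0 < σ ^ 2 * ε ^ 2 * κ ^ 2 := by rw [hσ2]; positivity
    rw [hn] at this
    linarith
  · have hc2 : ∀ᶠ ε in 𝓝[>] (0 : ℝ), 1 / 2 ≤ c ε := hct.eventually_const_le (by norm_num)
    filter_upwards [hfac, hc2] with ε h h2 τ
    rw [h]
    refine le_trans ?_ (abs_mul_abs_le_norm_mul _ _ (a := c ε * (τ - κ)) (b := c ε * (τ + κ))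
      (by rw [Complex.add_re, Complex.I_mul_re]; simp)
      (by rw [Complex.add_re, Complex.I_mul_re]; simp))
    rw [show c ε * (τ - κ) * (c ε * (τ + κ)) = c ε ^ 2 * (τ ^ 2 - κ ^ 2) by ring, abs_mul,
      abs_of_nonneg (sq_nonneg (c ε))]
    have h3 : 1 / 4 ≤ c ε ^ 2 := by nlinarith
    nlinarith [abs_nonneg (τ ^ 2 - κ ^ 2)]

lemma exists_polar (x : R2) : ∃ β : ℝ, x 0 = ‖x‖ * Real.cos β ∧ x 1 = ‖x‖ * Real.sin β := by
  have hn : ‖(⟨x 0, x 1⟩ : ℂ)‖ = ‖x‖ := by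
    rw [← sq_eq_sq₀ (norm_nonneg _) (norm_nonneg _), ← Complex.normSq_eq_norm_sq,
      Complex.normSq_apply, R2.norm_sq]
    ring
  refine ⟨Complex.arg ⟨x 0, x 1⟩, ?_, ?_⟩
  · rw [← hn, Complex.norm_mul_cos_arg]
  · rw [← hn, Complex.norm_mul_sin_arg]

lemma imVec_rotC_eq_zero {c s : ℝ} {k : C2} (hk : imVec k = 0) : imVec (rotC c s k) = 0 := by
  rw [imVec_rotC, hk]
  apply R2.ext <;> simp

lemma rotC_ne_zero {c s : ℝ} (h : c ^ 2 + s ^ 2 = 1) {k : C2} (hk : k ≠ 0) : rotC c s k ≠ 0 := by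
  rw [← norm_pos_iff, norm_rotC h]
  exact norm_pos_iff.2 hk

lemma tendsto_g_plus {x : R2} (hx : x ≠ 0) {k : C2} (hk : imVec k = 0) (hk0 : k ≠ 0) :
    Integrable (fun τ : ℝ => boundaryTerm ‖x‖ 0 (τ ^ 2 - ‖k‖ ^ 2) (-1)) ∧
    Tendsto (fun ε : ℝ => g x (k + ((ε : ℂ) * Complex.I) • k)) (𝓝[>] (0 : ℝ))
      (𝓝 (Complex.exp (-(Complex.I * bdot k x)) * plusG ‖x‖ ‖k‖)) := by
  obtain ⟨c, s, hcs, h0, h1, hpos⟩ := rot_to_pos hx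
  have := tendsto_g_plus_frame hpos h1 (imVec_rotC_eq_zero hk) (rotC_ne_zero hcs hk0)
  simpa only [h0, norm_rotC hcs, bdot_rot hcs, ← rotC_smul, ← rotC_add, g_rot hcs] using this

lemma tendsto_g_pm {x : R2} (hx : x ≠ 0) {k : C2} (hk : imVec k = 0) (hk0 : k ≠ 0) {σ : ℝ}
    (hσ : σ = 1 ∨ σ = -1) {β : ℝ} (h0 : x 0 = ‖x‖ * Real.cos β) (h1 : x 1 = ‖x‖ * Real.sin β) :
    Integrable (fun τ : ℝ => boundaryTerm ‖x‖
      (-(σ * (Real.cos β * (k 1).re - Real.sin β * (k 0).re))) (τ ^ 2 - ‖k‖ ^ 2)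
      (σ * (Real.cos β * (k 0).re + Real.sin β * (k 1).re) * τ)) ∧
    Tendsto (fun ε : ℝ => g x (k + ((σ : ℂ) * (ε : ℂ) * Complex.I) • perp k)) (𝓝[>] (0 : ℝ))
      (𝓝 (Complex.exp (-(Complex.I * bdot k x)) * pmG σ ‖x‖ ‖k‖
        (Real.cos β * (k 0).re + Real.sin β * (k 1).re)
        (Real.cos β * (k 1).re - Real.sin β * (k 0).re))) := by
  have hcs : Real.cos β ^ 2 + (-Real.sin β) ^ 2 = 1 := by
    rw [neg_sq]; exact Real.cos_sq_add_sin_sq β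
  have hsc := Real.cos_sq_add_sin_sq β
  have e0 : rotR (Real.cos β) (-Real.sin β) x 0 = ‖x‖ := by
    rw [rotR_zero, h0, h1]; linear_combination ‖x‖ * hsc
  have e1 : rotR (Real.cos β) (-Real.sin β) x 1 = 0 := by
    rw [rotR_one, h0, h1]; ring
  have k0 : (rotC (Real.cos β) (-Real.sin β) k 0).re =
      Real.cos β * (k 0).re + Real.sin β * (k 1).re := by
    rw [rotC_zero, Complex.sub_re, Complex.re_ofReal_mul, Complex.re_ofReal_mul]; ring
  have k1 : (rotC (Real.cos β) (-Real.sin β) k 1).re =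
      Real.cos β * (k 1).re - Real.sin β * (k 0).re := by
    rw [rotC_one, Complex.add_re, Complex.re_ofReal_mul, Complex.re_ofReal_mul]; ring
  have := tendsto_g_pm_frame (by rw [e0]; exact norm_pos_iff.2 hx) e1 (imVec_rotC_eq_zero hk)
    (rotC_ne_zero hcs hk0) hσ
  simpa only [e0, k0, k1, norm_rotC hcs, bdot_rot hcs, ← rotC_smul, ← rotC_add, perp_rotC,
    g_rot hcs] using this

lemma gPlus_eq {x : R2} (hx : x ≠ 0) {k : C2} (hk : imVec k = 0) (hk0 : k ≠ 0) :
    gPlus x k = Complex.exp (-(Complex.I * bdot k x)) * plusG ‖x‖ ‖k‖ :=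
  (tendsto_g_plus hx hk hk0).2.limUnder_eq

/-! ### The jump of the Green function across the real energy shell -/

lemma sq_lt_sq_iff_mem_Ioo {κ : ℝ} (hκ : 0 < κ) (τ : ℝ) :
    τ ^ 2 - κ ^ 2 < 0 ↔ τ ∈ Set.Ioo (-κ) κ := by
  rw [sub_neg, sq_lt_sq, abs_of_pos hκ, abs_lt, Set.mem_Ioo]

/-- The density over `-κ < τ < κ` of the jump between `g_±` and `g⁺`. -/
noncomputable def jumpDensity (σ r κ a b τ : ℝ) : ℂ :=
  (if 0 < σ * (a * τ - b * √(-(τ ^ 2 - κ ^ 2))) then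
      Complex.exp (Complex.I * (r * (√(-(τ ^ 2 - κ ^ 2)) : ℝ))) / (√(-(τ ^ 2 - κ ^ 2)) : ℝ) else 0) +
    (if 0 < σ * (a * τ + b * √(-(τ ^ 2 - κ ^ 2))) then
      Complex.exp (-(Complex.I * (r * (√(-(τ ^ 2 - κ ^ 2)) : ℝ)))) / (√(-(τ ^ 2 - κ ^ 2)) : ℝ)
      else 0)

/-- For |τ| > κ the two integrands agree. For |τ| < κ, g⁺ keeps exactly the outgoing term; the
difference consists of the outgoing terms lost by g_± and the incoming ones gained, both with
coefficient -i. -/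
lemma pmG_eq_plusG_add {σ r κ a b : ℝ} (hσ : σ ≠ 0) (hκ : 0 < κ) (hab : κ ^ 2 = a ^ 2 + b ^ 2)
    (h1 : Integrable (fun τ : ℝ => boundaryTerm r 0 (τ ^ 2 - κ ^ 2) (-1)))
    (h2 : Integrable (fun τ : ℝ => boundaryTerm r (-(σ * b)) (τ ^ 2 - κ ^ 2) (σ * a * τ))) :
    pmG σ r κ a b = plusG r κ + Complex.I / (4 * (Real.pi : ℂ)) *
      ∫ τ in Set.Ioo (-κ) κ, jumpDensity σ r κ a b τ := by
  have hd : (fun τ : ℝ => boundaryTerm r (-(σ * b)) (τ ^ 2 - κ ^ 2) (σ * a * τ) -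
      boundaryTerm r 0 (τ ^ 2 - κ ^ 2) (-1)) =ᵐ[volume]
      (Set.Ioo (-κ) κ).indicator (fun τ => -Complex.I * jumpDensity σ r κ a b τ) := by
    filter_upwards [ae_sq_ne (κ ^ 2), ae_sq_ne (b ^ 2)] with τ hτ hb
    by_cases hw : τ ^ 2 - κ ^ 2 < 0
    · rw [Set.indicator_of_mem ((sq_lt_sq_iff_mem_Ioo hκ τ).1 hw)]
      unfold boundaryTerm jumpDensity
      have hs : √(-(τ ^ 2 - κ ^ 2)) ^ 2 = -(τ ^ 2 - κ ^ 2) := Real.sq_sqrt (by linarith)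
      rw [if_neg (not_lt.2 hw.le), if_neg (not_lt.2 hw.le)]
      generalize √(-(τ ^ 2 - κ ^ 2)) = m at *
      have hne : a * τ - b * m ≠ 0 := by
        intro h
        have h5 : a ^ 2 * τ ^ 2 = b ^ 2 * m ^ 2 := by linear_combination (a * τ + b * m) * h
        rw [hs] at h5
        have h6 : κ ^ 2 * (τ ^ 2 - b ^ 2) = 0 := by rw [hab] at h5 ⊢; linear_combination h5
        rcases mul_eq_zero.1 h6 with h7 | h7
        · exact absurd h7 (by positivity)
        · exact hb (by linarith)
      have hne' : σ * (a * τ - b * m) ≠ 0 := mul_ne_zero hσ hne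
      rw [if_pos (by norm_num : 0 * m < - -1), if_neg (by norm_num : ¬0 * m < -1)]
      have c1 : -(σ * b) * m < -(σ * a * τ) ↔ ¬ 0 < σ * (a * τ - b * m) := by
        constructor
        · intro h; nlinarith
        · intro h
          have := lt_of_le_of_ne (not_lt.1 h) hne'
          nlinarith
      have c2 : -(σ * b) * m < σ * a * τ ↔ 0 < σ * (a * τ + b * m) := by
        constructor <;> intro h <;> nlinarith
      simp only [c1, c2]
      split_ifs <;> ring
    · have h0 : 0 < τ ^ 2 - κ ^ 2 := lt_of_le_of_ne (not_lt.1 hw) (sub_ne_zero.2 hτ).symm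
      rw [Set.indicator_of_notMem (fun h => hw ((sq_lt_sq_iff_mem_Ioo hκ τ).2 h))]
      unfold boundaryTerm
      rw [if_pos h0, if_pos h0, sub_self]
  have h3 := integral_sub h2 h1
  rw [integral_congr_ae hd, integral_indicator measurableSet_Ioo, integral_const_mul] at h3
  unfold pmG plusG
  have hpi : (Real.pi : ℂ) ≠ 0 := by exact_mod_cast Real.pi_ne_zero
  linear_combination (-(1 / (4 * (Real.pi : ℂ)))) * (-h3)

/-- `exp(iκr cos φ)` on the arc `0 < σ (a sin φ - b cos φ)`. -/
noncomputable def arcWave (σ r κ a b φ : ℝ) : ℂ :=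
  if 0 < σ * (a * Real.sin φ - b * Real.cos φ) then
    Complex.exp (Complex.I * (r * (κ * Real.cos φ : ℝ))) else 0

lemma arcWave_periodic (σ r κ a b : ℝ) :
    Function.Periodic (arcWave σ r κ a b) (2 * Real.pi) := fun φ => by
  simp [arcWave]

lemma intervalIntegrable_of_bounded {f : ℝ → ℂ} (hf : Measurable f) {C : ℝ} (hC : ∀ t, ‖f t‖ ≤ C)
    (u v : ℝ) : IntervalIntegrable f volume u v :=
  (intervalIntegrable_const (c := C)).mono_fun hf.aestronglyMeasurable
    (ae_of_all _ fun t => (hC t).trans (le_abs_self C))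

lemma measurable_arcWave (σ r κ a b : ℝ) : Measurable (arcWave σ r κ a b) := by
  unfold arcWave
  refine Measurable.ite (measurableSet_lt measurable_const ?_) ?_ measurable_const
  · fun_prop
  · fun_prop

lemma norm_arcWave_le (σ r κ a b φ : ℝ) : ‖arcWave σ r κ a b φ‖ ≤ 1 := by
  unfold arcWave
  split_ifs
  · rw [← Complex.ofReal_mul, mul_comm Complex.I, Complex.norm_exp_ofReal_mul_I]
  · simp

/-- Put τ = κ sin φ with |φ| < π/2: the root is κ cos φ and cancels against dτ. The second summand
is the first one at π - φ, so the two together cover the whole circle. -/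
lemma integral_jumpDensity (σ r a b : ℝ) {κ : ℝ} (hκ : 0 < κ) :
    ∫ τ in Set.Ioo (-κ) κ, jumpDensity σ r κ a b τ =
      ∫ φ in (0 : ℝ)..(2 * Real.pi), arcWave σ r κ a b φ := by
  have hi := intervalIntegrable_of_bounded (measurable_arcWave σ r κ a b)
    (norm_arcWave_le σ r κ a b)
  have himg : (fun φ => κ * Real.sin φ) '' Set.Ioo (-(Real.pi / 2)) (Real.pi / 2) =
      Set.Ioo (-κ) κ := by
    ext τ
    constructor
    · rintro ⟨φ, hφ, rfl⟩
      have h1 : Real.sin φ ∈ Set.Ioo (-1 : ℝ) 1 := Real.mapsTo_sin_Ioo hφ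
      constructor <;> nlinarith [h1.1, h1.2]
    · intro hτ
      refine ⟨Real.arcsin (τ / κ), ⟨?_, ?_⟩, ?_⟩
      · rw [Real.neg_pi_div_two_lt_arcsin, lt_div_iff₀ hκ]; linarith [hτ.1]
      · rw [Real.arcsin_lt_pi_div_two, div_lt_one hκ]; exact hτ.2
      · change κ * _ = τ
        rw [Real.sin_arcsin]
        · field_simp
        · rw [le_div_iff₀ hκ]; linarith [hτ.1]
        · rw [div_le_one hκ]; exact hτ.2.le
  have hinj : Set.InjOn (fun φ => κ * Real.sin φ) (Set.Ioo (-(Real.pi / 2)) (Real.pi / 2)) :=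
    fun u hu v hv h => Real.injOn_sin ⟨hu.1.le, hu.2.le⟩ ⟨hv.1.le, hv.2.le⟩
      (mul_left_cancel₀ hκ.ne' h)
  rw [← himg, integral_image_eq_integral_abs_deriv_smul measurableSet_Ioo
    (f' := fun φ => κ * Real.cos φ)
    (fun φ _ => ((Real.hasDerivAt_sin φ).const_mul κ).hasDerivWithinAt) hinj]
  have e : ∀ φ ∈ Set.Ioo (-(Real.pi / 2)) (Real.pi / 2),
      |κ * Real.cos φ| • jumpDensity σ r κ a b (κ * Real.sin φ) =
        arcWave σ r κ a b φ + arcWave σ r κ a b (Real.pi - φ) := by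
    intro φ hφ
    have hc := Real.cos_pos_of_mem_Ioo hφ
    have hkc : 0 < κ * Real.cos φ := mul_pos hκ hc
    have hkc0 : ((κ * Real.cos φ : ℝ) : ℂ) ≠ 0 := by exact_mod_cast hkc.ne'
    have hm : √(-((κ * Real.sin φ) ^ 2 - κ ^ 2)) = κ * Real.cos φ := by
      rw [← Real.sqrt_sq hkc.le]
      congr 1
      linear_combination (-κ ^ 2) * Real.sin_sq_add_cos_sq φ
    unfold jumpDensity arcWave
    rw [hm, Real.sin_pi_sub, Real.cos_pi_sub, abs_of_pos hkc, Complex.real_smul, mul_add]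
    have c1 : 0 < σ * (a * (κ * Real.sin φ) - b * (κ * Real.cos φ)) ↔
        0 < σ * (a * Real.sin φ - b * Real.cos φ) := by
      rw [show σ * (a * (κ * Real.sin φ) - b * (κ * Real.cos φ)) =
        κ * (σ * (a * Real.sin φ - b * Real.cos φ)) by ring, mul_pos_iff_of_pos_left hκ]
    have c2 : 0 < σ * (a * (κ * Real.sin φ) + b * (κ * Real.cos φ)) ↔
        0 < σ * (a * Real.sin φ - b * -Real.cos φ) := by
      rw [show σ * (a * (κ * Real.sin φ) + b * (κ * Real.cos φ)) =
        κ * (σ * (a * Real.sin φ - b * -Real.cos φ)) by ring, mul_pos_iff_of_pos_left hκ]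
    simp only [c1, c2, mul_ite, mul_zero, mul_div_cancel₀ _ hkc0]
    congr 1
    refine if_congr Iff.rfl ?_ rfl
    push_cast
    congr 1; ring
  rw [setIntegral_congr_fun measurableSet_Ioo e, ← integral_Ioc_eq_integral_Ioo,
    ← intervalIntegral.integral_of_le (by linarith [Real.pi_pos])]
  have hi2 : IntervalIntegrable (fun φ => arcWave σ r κ a b (Real.pi - φ)) volume
      (-(Real.pi / 2)) (Real.pi / 2) :=
    intervalIntegrable_of_bounded ((measurable_arcWave σ r κ a b).comp (by fun_prop))
      (fun t => norm_arcWave_le σ r κ a b _) _ _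
  rw [intervalIntegral.integral_add (hi _ _) hi2, intervalIntegral.integral_comp_sub_left,
    show Real.pi - Real.pi / 2 = Real.pi / 2 by ring,
    intervalIntegral.integral_add_adjacent_intervals (hi _ _) (hi _ _)]
  have := (arcWave_periodic σ r κ a b).intervalIntegral_add_eq (-(Real.pi / 2)) 0
  rw [zero_add] at this
  rw [← this]
  congr 1; ring

/-! ### The unit circle and the real energy shell -/

lemma kE_circle {E : ℝ} (hE : 0 < E) {z : ℂ} (hz : ‖z‖ = 1) :
    (kE E z 0).re = √E * z.re ∧ (kE E z 1).re = √E * z.im ∧ imVec (kE E z) = 0 := by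
  obtain ⟨a, b, c, d⟩ := kE_coords_of_pos hE z
  rw [Complex.normSq_eq_norm_sq, hz] at a b c d
  refine ⟨by rw [a]; ring, by rw [c]; ring, ?_⟩
  apply R2.ext
  · rw [imVec_zero, b]; norm_num
  · rw [imVec_one, d]; norm_num

lemma re_sq_add_im_sq {z : ℂ} (hz : ‖z‖ = 1) : z.re ^ 2 + z.im ^ 2 = 1 := by
  have := Complex.normSq_eq_norm_sq z
  rw [hz, Complex.normSq_apply] at this
  linarith

lemma norm_kE_circle {E : ℝ} (hE : 0 < E) {z : ℂ} (hz : ‖z‖ = 1) : ‖kE E z‖ = √E := by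
  obtain ⟨h0, h1, h2⟩ := kE_circle hE hz
  rw [← sq_eq_sq₀ (norm_nonneg _) (Real.sqrt_nonneg _), norm_sq_of_imVec h2, h0, h1]
  linear_combination √E ^ 2 * re_sq_add_im_sq hz

lemma kE_circle_ne_zero {E : ℝ} (hE : 0 < E) {z : ℂ} (hz : ‖z‖ = 1) : kE E z ≠ 0 := by
  rw [← norm_pos_iff, norm_kE_circle hE hz]
  exact Real.sqrt_pos.2 hE

/-- On the unit circle division is multiplication by the conjugate, so z/w - w/z is purely imaginary
and the argument of χ₊ is twice a cross product. -/
lemma chiArc_eq (σ : ℝ) {z w : ℂ} (hz : ‖z‖ = 1) (hw : ‖w‖ = 1) :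
    chiArc σ z w = if 0 < σ * (z.re * w.im - z.im * w.re) then 1 else 0 := by
  have e : ((σ : ℂ) * Complex.I * (z / w - w / z)).re = 2 * (σ * (z.re * w.im - z.im * w.re)) := by
    have h1 : ∀ u v : ℂ, ‖v‖ = 1 → u / v = u * (starRingEnd ℂ) v := fun u v hv => by
      rw [div_eq_mul_inv, Complex.inv_def, Complex.normSq_eq_norm_sq, hv]; simp
    rw [h1 z w hw, h1 w z hz, mul_assoc, Complex.re_ofReal_mul, Complex.I_mul_re]
    simp only [Complex.sub_im, Complex.mul_im, Complex.conj_re, Complex.conj_im]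
    ring
  unfold chiArc
  rw [e]
  exact if_congr (by rw [mul_pos_iff_of_pos_left two_pos]) rfl rfl

lemma circleMap_re_im (θ : ℝ) :
    (circleMap 0 1 θ).re = Real.cos θ ∧ (circleMap 0 1 θ).im = Real.sin θ := by
  rw [circleMap, zero_add, Complex.ofReal_one, one_mul]
  exact ⟨Complex.exp_ofReal_mul_I_re θ, Complex.exp_ofReal_mul_I_im θ⟩

lemma norm_circleMap_one (θ : ℝ) : ‖circleMap 0 1 θ‖ = 1 := by simp

lemma measurable_chiArc_circleMap (σ : ℝ) {z : ℂ} (hz : ‖z‖ = 1) :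
    Measurable (fun θ => chiArc σ z (circleMap 0 1 θ)) := by
  simp only [chiArc_eq σ hz (norm_circleMap_one _), (circleMap_re_im _).1, (circleMap_re_im _).2]
  exact Measurable.ite (measurableSet_lt measurable_const (by fun_prop)) measurable_const
    measurable_const

lemma norm_chiArc_le (σ : ℝ) (z w : ℂ) : ‖chiArc σ z w‖ ≤ 1 := by
  unfold chiArc
  split_ifs <;> simp

lemma integral_sign_arc {σ : ℝ} (hσ : σ = 1 ∨ σ = -1) :
    ∫ θ in (0 : ℝ)..(2 * Real.pi), (if 0 < σ * Real.sin θ then (1 : ℂ) else 0) = Real.pi := by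
  have hpi := Real.pi_pos
  have hi : ∀ u v, IntervalIntegrable (fun θ => if 0 < σ * Real.sin θ then (1 : ℂ) else 0)
      volume u v :=
    intervalIntegrable_of_bounded (Measurable.ite
      (measurableSet_lt measurable_const (by fun_prop)) measurable_const measurable_const)
      (C := 1) (fun t => by split_ifs <;> simp)
  rw [← intervalIntegral.integral_add_adjacent_intervals (hi 0 Real.pi) (hi Real.pi _)]
  have hne : ∀ᵐ θ : ℝ, θ ≠ Real.pi ∧ θ ≠ 2 * Real.pi :=
    ((Set.countable_singleton Real.pi).ae_notMem volume).and
      ((Set.countable_singleton (2 * Real.pi)).ae_notMem volume)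
  have h1 : ∀ᵐ θ : ℝ, θ ∈ Set.uIoc 0 Real.pi →
      (if 0 < σ * Real.sin θ then (1 : ℂ) else 0) = if 0 < σ then 1 else 0 := by
    filter_upwards [hne] with θ hθ hm
    rw [Set.uIoc_of_le hpi.le] at hm
    have := Real.sin_pos_of_pos_of_lt_pi hm.1 (lt_of_le_of_ne hm.2 hθ.1)
    exact if_congr (mul_pos_iff_of_pos_right this) rfl rfl
  have h2 : ∀ᵐ θ : ℝ, θ ∈ Set.uIoc Real.pi (2 * Real.pi) →
      (if 0 < σ * Real.sin θ then (1 : ℂ) else 0) = if 0 < -σ then 1 else 0 := by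
    filter_upwards [hne] with θ hθ hm
    rw [Set.uIoc_of_le (by linarith)] at hm
    have := Real.sin_pos_of_pos_of_lt_pi (x := θ - Real.pi) (by linarith [hm.1])
      (by linarith [lt_of_le_of_ne hm.2 hθ.2])
    rw [Real.sin_sub_pi] at this
    refine if_congr ?_ rfl rfl
    rw [← mul_pos_iff_of_pos_right this (a := -σ), neg_mul_neg]
  rw [intervalIntegral.integral_congr_ae h1, intervalIntegral.integral_congr_ae h2,
    intervalIntegral.integral_const, intervalIntegral.integral_const]
  rcases hσ with rfl | rfl
  · norm_num
  · norm_num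
    ring

/-- The arc is a half circle starting at z, in the direction given by σ. -/
lemma integral_chiArc {σ : ℝ} (hσ : σ = 1 ∨ σ = -1) {z : ℂ} (hz : ‖z‖ = 1) :
    ∫ θ in (0 : ℝ)..(2 * Real.pi), chiArc σ z (circleMap 0 1 θ) = Real.pi := by
  have hre : z.re = Real.cos z.arg := by rw [← Complex.norm_mul_cos_arg, hz, one_mul]
  have him : z.im = Real.sin z.arg := by rw [← Complex.norm_mul_sin_arg, hz, one_mul]
  set B : ℝ → ℂ := fun θ => if 0 < σ * Real.sin θ then (1 : ℂ) else 0 with hB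
  have e : ∀ θ, chiArc σ z (circleMap 0 1 θ) = B (θ - z.arg) := fun θ => by
    rw [chiArc_eq σ hz (norm_circleMap_one _), (circleMap_re_im _).1, (circleMap_re_im _).2, hre,
      him]
    simp only [hB]
    rw [Real.sin_sub]
    refine if_congr ?_ rfl rfl
    rw [show Real.cos z.arg * Real.sin θ - Real.sin z.arg * Real.cos θ =
      Real.sin θ * Real.cos z.arg - Real.cos θ * Real.sin z.arg by ring]
  have hper : Function.Periodic B (2 * Real.pi) := fun θ => by simp [hB]
  simp only [e]
  rw [intervalIntegral.integral_comp_sub_right B z.arg, ← integral_sign_arc hσ]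
  have := hper.intervalIntegral_add_eq (0 - z.arg) 0
  rw [zero_add] at this
  rw [← this]
  congr 1; ring

/-- With θ - β the angle measured from the direction of x, the phase is |x|√E cos(θ - β), and the
cross product defining the arc is invariant under the rotation by β. -/
lemma chiArc_mul_exp (σ : ℝ) {x : R2} {E : ℝ} (hE : 0 < E) {β : ℝ}
    (h0 : x 0 = ‖x‖ * Real.cos β) (h1 : x 1 = ‖x‖ * Real.sin β) {z : ℂ} (hz : ‖z‖ = 1) (θ : ℝ) :
    chiArc σ z (circleMap 0 1 θ) *
        Complex.exp (Complex.I * bdot (kE E (circleMap 0 1 θ)) x) =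
      arcWave σ ‖x‖ √E (Real.cos β * (kE E z 0).re + Real.sin β * (kE E z 1).re)
        (Real.cos β * (kE E z 1).re - Real.sin β * (kE E z 0).re) (θ - β) := by
  obtain ⟨k0, k1, -⟩ := kE_circle hE hz
  obtain ⟨w0, w1, w2⟩ := kE_circle hE (norm_circleMap_one θ)
  obtain ⟨e0, e1⟩ := eq_ofReal_of_imVec w2
  obtain ⟨c0, c1⟩ := circleMap_re_im θ
  have hs := Real.sqrt_pos.2 hE
  rw [w0, c0] at e0
  rw [w1, c1] at e1
  have hb : bdot (kE E (circleMap 0 1 θ)) x = ((‖x‖ * (√E * Real.cos (θ - β)) : ℝ) : ℂ) := by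
    rw [bdot, e0, e1, h0, h1, Real.cos_sub]
    push_cast; ring
  rw [chiArc_eq σ hz (norm_circleMap_one θ), c0, c1, hb, arcWave, k0, k1]
  have hc : σ * ((Real.cos β * (√E * z.re) + Real.sin β * (√E * z.im)) * Real.sin (θ - β) -
      (Real.cos β * (√E * z.im) - Real.sin β * (√E * z.re)) * Real.cos (θ - β)) =
      √E * (σ * (z.re * Real.sin θ - z.im * Real.cos θ)) := by
    rw [Real.sin_sub, Real.cos_sub]
    linear_combination (√E * σ * (z.re * Real.sin θ - z.im * Real.cos θ)) *
      Real.sin_sq_add_cos_sq β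
  rw [hc, ite_mul, one_mul, zero_mul]
  refine if_congr (by rw [mul_pos_iff_of_pos_left hs]) ?_ rfl
  push_cast; ring_nf

/-- On the real energy shell, `g_±` and `g⁺` differ by a superposition of plane waves. -/
lemma gPM_eq {x : R2} (hx : x ≠ 0) {E : ℝ} (hE : 0 < E) {σ : ℝ} (hσ : σ = 1 ∨ σ = -1) {z : ℂ}
    (hz : ‖z‖ = 1) :
    Complex.exp (Complex.I * bdot (kE E z) x) * gPM σ x (kE E z) = plusG ‖x‖ √E +
      Complex.I / (4 * (Real.pi : ℂ)) * ∫ θ in (0 : ℝ)..(2 * Real.pi),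
        chiArc σ z (circleMap 0 1 θ) *
          Complex.exp (Complex.I * bdot (kE E (circleMap 0 1 θ)) x) := by
  obtain ⟨β, h0, h1⟩ := exists_polar x
  obtain ⟨k0, k1, k2⟩ := kE_circle hE hz
  have hκ := Real.sqrt_pos.2 hE
  have hn := norm_kE_circle hE hz
  obtain ⟨i1, l1⟩ := tendsto_g_pm hx k2 (kE_circle_ne_zero hE hz) hσ h0 h1
  obtain ⟨i2, -⟩ := tendsto_g_plus hx k2 (kE_circle_ne_zero hE hz)
  have hl : gPM σ x (kE E z) = _ := l1.limUnder_eq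
  rw [hn] at i1 i2 hl
  rw [hl, ← mul_assoc, ← Complex.exp_add, add_neg_cancel, Complex.exp_zero, one_mul]
  have hσ0 : σ ≠ 0 := by rcases hσ with rfl | rfl <;> norm_num
  rw [pmG_eq_plusG_add hσ0 hκ ?_ i2 i1, integral_jumpDensity _ _ _ _ hκ]
  · congr 2
    simp only [chiArc_mul_exp σ hE h0 h1 hz]
    rw [intervalIntegral.integral_comp_sub_right (arcWave σ ‖x‖ √E _ _) β]
    have := (arcWave_periodic σ ‖x‖ √E
      (Real.cos β * (kE E z 0).re + Real.sin β * (kE E z 1).re)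
      (Real.cos β * (kE E z 1).re - Real.sin β * (kE E z 0).re)).intervalIntegral_add_eq 0 (0 - β)
    rw [zero_add] at this
    rw [this]
    congr 1; ring
  · rw [k0, k1]
    linear_combination (-(√E ^ 2)) * re_sq_add_im_sq hz -
      √E ^ 2 * (z.re ^ 2 + z.im ^ 2) * Real.sin_sq_add_cos_sq β

lemma psiPlus_eq (α : ℝ) {x : R2} (hx : x ≠ 0) {E : ℝ} (hE : 0 < E) {w : ℂ} (hw : ‖w‖ = 1) :
    psiPlus α x (kE E w) = Complex.exp (Complex.I * bdot (kE E w) x) +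
      (α : ℂ) / denPlus α √E * plusG ‖x‖ √E := by
  obtain ⟨-, -, h2⟩ := kE_circle hE hw
  unfold psiPlus muPlus
  rw [gPlus_eq hx h2 (kE_circle_ne_zero hE hw), norm_kE_circle hE hw, mul_add, mul_one,
    mul_left_comm, ← mul_assoc (Complex.exp _) (Complex.exp _), ← Complex.exp_add, add_neg_cancel,
    Complex.exp_zero, one_mul]

/-- The difference iα/4 equals πi · α/(2π)² · π, the coefficient of the integral equations times the
length of the half circle. This coincidence closes both relations on the circle. -/
lemma denPlus_eq (α s : ℝ) : denPlus α s = (den α s : ℝ) + Complex.I * ((α / 4 : ℝ) : ℂ) := by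
  have hpi : (Real.pi : ℂ) ≠ 0 := by exact_mod_cast Real.pi_ne_zero
  unfold denPlus den
  push_cast
  field_simp
  ring

lemma denPlus_ne_zero {α s : ℝ} (h : den α s ≠ 0) : denPlus α s ≠ 0 := by
  intro h0
  have := congrArg Complex.re h0
  rw [denPlus_eq, Complex.add_re, Complex.ofReal_re, Complex.I_mul_re, Complex.ofReal_im] at this
  simp at this
  exact h this

lemma circleIntegrable_of_chiArc_mul (σ : ℝ) {z : ℂ} (hz : ‖z‖ = 1) {F : ℂ → ℂ} {f : ℝ → ℂ}
    (hf : Measurable f) {C : ℝ} (hC : ∀ θ, ‖f θ‖ ≤ C)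
    (hF : ∀ θ, F (circleMap 0 1 θ) = chiArc σ z (circleMap 0 1 θ) * f θ) :
    CircleIntegrable F 0 1 := by
  unfold CircleIntegrable
  rw [funext hF]
  refine intervalIntegrable_of_bounded ((measurable_chiArc_circleMap σ hz).mul hf) (C := C)
    (fun θ => ?_) _ _
  rw [Pi.mul_apply, norm_mul]
  exact (mul_le_of_le_one_left (norm_nonneg _) (norm_chiArc_le _ _ _)).trans (hC θ)

/-- The plane-wave parts match by `gPM_eq`. The terms proportional to G⁺ match because the arc has
length π and, by `denPlus_eq`, α/den - α/denPlus = iα²/(4 den denPlus). -/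
lemma psiPM_eq (α : ℝ) {x : R2} (hx : x ≠ 0) {E : ℝ} (hE : 0 < E) (hden : den α √E ≠ 0)
    {σ : ℝ} (hσ : σ = 1 ∨ σ = -1) {z : ℂ} (hz : ‖z‖ = 1) :
    CircleIntegrable
        (fun w => hPM α σ (kE E z) (kE E w) * chiArc σ z w * psiPlus α x (kE E w)) 0 1 ∧
      psiPM α σ x (kE E z) = psiPlus α x (kE E z) + (Real.pi : ℂ) * Complex.I *
        arcIntegral
          (fun w => hPM α σ (kE E z) (kE E w) * chiArc σ z w * psiPlus α x (kE E w)) := by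
  set H : ℂ := (1 / (2 * (Real.pi : ℂ))) ^ 2 * ((α : ℂ) / ((den α √E : ℝ) : ℂ)) with hH
  set c : ℂ := (α : ℂ) / denPlus α √E * plusG ‖x‖ √E with hc
  set e : ℝ → ℂ := fun θ => Complex.exp (Complex.I * bdot (kE E (circleMap 0 1 θ)) x) with he
  have hHe : ∀ w, hPM α σ (kE E z) (kE E w) = H := fun w => by
    rw [hPM, norm_kE_circle hE hz]
  have hF : ∀ θ, hPM α σ (kE E z) (kE E (circleMap 0 1 θ)) * chiArc σ z (circleMap 0 1 θ) *
      psiPlus α x (kE E (circleMap 0 1 θ)) = chiArc σ z (circleMap 0 1 θ) * (H * (e θ + c)) :=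
    fun θ => by rw [hHe, psiPlus_eq α hx hE (norm_circleMap_one θ)]; ring
  have hee : ∀ θ, e θ = Complex.exp
      (Complex.I * ((√E * Real.cos θ * x 0 + √E * Real.sin θ * x 1 : ℝ) : ℂ)) := fun θ => by
    obtain ⟨w0, w1, w2⟩ := kE_circle hE (norm_circleMap_one θ)
    obtain ⟨e0, e1⟩ := eq_ofReal_of_imVec w2
    rw [w0, (circleMap_re_im θ).1] at e0
    rw [w1, (circleMap_re_im θ).2] at e1
    simp only [he]
    rw [bdot, e0, e1]
    push_cast; ring_nf
  have hem : Measurable e := by rw [funext hee]; fun_prop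
  have hen : ∀ θ, ‖e θ‖ ≤ 1 := fun θ => by
    rw [hee, mul_comm Complex.I, Complex.norm_exp_ofReal_mul_I]
  refine ⟨circleIntegrable_of_chiArc_mul σ hz ((hem.add_const c).const_mul H)
    (C := ‖H‖ * (1 + ‖c‖)) (fun θ => ?_) hF, ?_⟩
  · rw [norm_mul]
    gcongr
    exact (norm_add_le _ _).trans (by gcongr; exact hen θ)
  have hD := denPlus_ne_zero hden
  have hd : ((den α √E : ℝ) : ℂ) ≠ 0 := by exact_mod_cast hden
  have hpi : (Real.pi : ℂ) ≠ 0 := by exact_mod_cast Real.pi_ne_zero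
  have i1 : IntervalIntegrable (fun θ => chiArc σ z (circleMap 0 1 θ) * e θ) volume 0
      (2 * Real.pi) := by
    refine intervalIntegrable_of_bounded ((measurable_chiArc_circleMap σ hz).mul hem) (C := 1)
      (fun θ => ?_) _ _
    rw [Pi.mul_apply, norm_mul]
    exact mul_le_one₀ (norm_chiArc_le _ _ _) (norm_nonneg _) (hen θ)
  have i2 : IntervalIntegrable (fun θ => chiArc σ z (circleMap 0 1 θ)) volume 0 (2 * Real.pi) :=
    intervalIntegrable_of_bounded (measurable_chiArc_circleMap σ hz)
      (fun θ => norm_chiArc_le _ _ _) _ _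
  have hint : arcIntegral
      (fun w => hPM α σ (kE E z) (kE E w) * chiArc σ z w * psiPlus α x (kE E w)) =
      H * ((∫ θ in (0 : ℝ)..(2 * Real.pi), chiArc σ z (circleMap 0 1 θ) * e θ) +
        Real.pi * c) := by
    unfold arcIntegral
    rw [← integral_chiArc hσ hz, ← intervalIntegral.integral_mul_const,
      ← intervalIntegral.integral_add i1 (i2.mul_const c),
      ← intervalIntegral.integral_const_mul]
    refine intervalIntegral.integral_congr fun θ _ => ?_
    simp only [hF]
    ring
  have hpm : psiPM α σ x (kE E z) = Complex.exp (Complex.I * bdot (kE E z) x) +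
      (α : ℂ) / ((den α √E : ℝ) : ℂ) * (plusG ‖x‖ √E + Complex.I / (4 * (Real.pi : ℂ)) *
        ∫ θ in (0 : ℝ)..(2 * Real.pi), chiArc σ z (circleMap 0 1 θ) * e θ) := by
    rw [← gPM_eq hx hE hσ hz, psiPM, muPM, norm_kE_circle hE hz]
    ring
  rw [hint, hpm, psiPlus_eq α hx hE hz, hH, hc]
  have hDe := denPlus_eq α √E
  push_cast at hDe
  generalize ∫ θ in (0 : ℝ)..(2 * Real.pi), chiArc σ z (circleMap 0 1 θ) * e θ = J
  field_simp
  rw [hDe]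
  ring

/-- Both h_± and f are constant on the shell, so the integral is π times their product and the
relation is again `denPlus_eq`. -/
lemma hPM_sub_arcIntegral (α : ℝ) {E : ℝ} (hE : 0 < E) (hden : den α √E ≠ 0)
    {σ : ℝ} (hσ : σ = 1 ∨ σ = -1) {z : ℂ} (hz : ‖z‖ = 1) (w : ℂ) :
    CircleIntegrable
        (fun v => hPM α σ (kE E z) (kE E v) * chiArc σ z v * fAmp α (kE E v) (kE E w)) 0 1 ∧
      hPM α σ (kE E z) (kE E w) - (Real.pi : ℂ) * Complex.I *
        arcIntegral
          (fun v => hPM α σ (kE E z) (kE E v) * chiArc σ z v * fAmp α (kE E v) (kE E w)) =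
        fAmp α (kE E z) (kE E w) := by
  set H : ℂ := (1 / (2 * (Real.pi : ℂ))) ^ 2 * ((α : ℂ) / ((den α √E : ℝ) : ℂ)) with hH
  set f : ℂ := (1 / (2 * (Real.pi : ℂ))) ^ 2 * ((α : ℂ) / denPlus α √E) with hf
  have hHe : ∀ v, hPM α σ (kE E z) (kE E v) = H := fun v => by
    rw [hPM, norm_kE_circle hE hz]
  have hfe : ∀ v : ℂ, ‖v‖ = 1 → fAmp α (kE E v) (kE E w) = f := fun v hv => by
    rw [fAmp, norm_kE_circle hE hv]
  have hF : ∀ θ, hPM α σ (kE E z) (kE E (circleMap 0 1 θ)) * chiArc σ z (circleMap 0 1 θ) *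
      fAmp α (kE E (circleMap 0 1 θ)) (kE E w) = chiArc σ z (circleMap 0 1 θ) * (H * f) :=
    fun θ => by rw [hHe, hfe _ (norm_circleMap_one θ)]; ring
  refine ⟨circleIntegrable_of_chiArc_mul σ hz measurable_const (C := ‖H * f‖)
    (fun _ => le_rfl) hF, ?_⟩
  have hint : arcIntegral
      (fun v => hPM α σ (kE E z) (kE E v) * chiArc σ z v * fAmp α (kE E v) (kE E w)) =
      Real.pi * (H * f) := by
    unfold arcIntegral
    simp only [hF]
    rw [intervalIntegral.integral_mul_const, integral_chiArc hσ hz]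
  have hD := denPlus_ne_zero hden
  have hd : ((den α √E : ℝ) : ℂ) ≠ 0 := by exact_mod_cast hden
  have hpi : (Real.pi : ℂ) ≠ 0 := by exact_mod_cast Real.pi_ne_zero
  rw [hint, hHe, hfe z hz, hH, hf]
  have hDe := denPlus_eq α √E
  push_cast at hDe
  field_simp
  rw [hDe]
  ring

end PointPotential

end

/-! ### Assembly of the proposition -/

theorem proposition1 (α : ℝ) (x : R2) (hx : x ≠ 0) :
    -- the integrals and limits that define `g`, `g⁺`, `g_±` exist
    (∀ k : C2, imVec k ≠ 0 →
      (∀ N : ℝ, IntegrableOn (greenIntegrand x k) (Metric.closedBall (0 : R2) N)) ∧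
      Tendsto (gTrunc x k) atTop (𝓝 (g x k))) ∧
    (∀ k : C2, imVec k = 0 → k ≠ 0 →
      Tendsto (fun ε : ℝ => g x (k + ((ε : ℂ) * Complex.I) • k)) (𝓝[>] (0 : ℝ))
        (𝓝 (gPlus x k)) ∧
      ∀ σ : ℝ, σ = 1 ∨ σ = -1 →
        Tendsto (fun ε : ℝ => g x (k + ((σ : ℂ) * (ε : ℂ) * Complex.I) • perp k))
          (𝓝[>] (0 : ℝ)) (𝓝 (gPM σ x k))) ∧
    -- the `∂̄`-equation at negative energy: pointwise off the unit circle, and in the sense of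
    -- distributions across it
    (∀ E : ℝ, E < 0 →
      (∀ z : ℂ, z ≠ 0 → ‖z‖ ≠ 1 → den α (modSum (kE E z)) ≠ 0 →
        HasDbarAt (fun w => psi α x (kE E w)) (dbarRHS α x E z) z) ∧
      WeakDbarOn {z : ℂ | z ≠ 0 ∧ den α (modSum (kE E z)) ≠ 0}
        (fun z => psi α x (kE E z)) (dbarRHS α x E)) ∧
    -- the `∂̄`-equation at zero energy
    (∀ σ : ℝ, σ = 1 ∨ σ = -1 →
      ∀ z : ℂ, z ≠ 0 → den α (modSum (kZero σ z)) ≠ 0 →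
        HasDbarAt (fun w => psi α x (kZero σ w))
          ((Real.pi : ℂ) / (starRingEnd ℂ) z * bData α (kZero σ z) *
            (starRingEnd ℂ) (psi α x (kZero σ z))) z) ∧
    -- the `∂̄`-equation at positive energy
    (∀ E : ℝ, 0 < E →
      ∀ z : ℂ, z ≠ 0 → ‖z‖ ≠ 1 → den α (modSum (kE E z)) ≠ 0 →
        HasDbarAt (fun w => psi α x (kE E w)) (dbarRHS α x E z) z) ∧
    -- the relation between `ψ_±`, `h_±` and `ψ⁺`
    (∀ E : ℝ, 0 < E → den α (Real.sqrt E) ≠ 0 →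
      ∀ σ : ℝ, σ = 1 ∨ σ = -1 → ∀ z : ℂ, ‖z‖ = 1 →
        CircleIntegrable
          (fun w => hPM α σ (kE E z) (kE E w) * chiArc σ z w * psiPlus α x (kE E w)) 0 1 ∧
        psiPM α σ x (kE E z) = psiPlus α x (kE E z) + (Real.pi : ℂ) * Complex.I *
          arcIntegral
            (fun w => hPM α σ (kE E z) (kE E w) * chiArc σ z w * psiPlus α x (kE E w))) ∧
    -- the relation between `h_±` and `f`
    (∀ E : ℝ, 0 < E → den α (Real.sqrt E) ≠ 0 →
      ∀ σ : ℝ, σ = 1 ∨ σ = -1 → ∀ z w : ℂ, ‖z‖ = 1 → ‖w‖ = 1 →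
        CircleIntegrable
          (fun v => hPM α σ (kE E z) (kE E v) * chiArc σ z v * fAmp α (kE E v) (kE E w)) 0 1 ∧
        hPM α σ (kE E z) (kE E w) - (Real.pi : ℂ) * Complex.I *
          arcIntegral
            (fun v => hPM α σ (kE E z) (kE E v) * chiArc σ z v * fAmp α (kE E v) (kE E w)) =
          fAmp α (kE E z) (kE E w)) ∧
    -- the normalization at infinity
    (∀ E : ℝ, E ≠ 0 →
      Tendsto (fun z => mu α x (kE E z)) (cocompact ℂ) (𝓝 1)) ∧
    (∀ σ : ℝ, σ = 1 ∨ σ = -1 →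
      Tendsto (fun z => mu α x (kZero σ z)) (cocompact ℂ) (𝓝 1)) := by
  refine ⟨fun k hk => ⟨integrableOn_greenIntegrand x hk, tendsto_gTrunc hx hk⟩,
    fun k hk hk0 => ⟨?_, fun σ hσ => ?_⟩,
    fun E hE => ⟨fun z hz h1 hd => hasDbarAt_psi_kE hx hE.ne hz h1 hd, weakDbarOn_psi_kE α hx hE⟩,
    fun σ hσ z hz hd => hasDbarAt_psi_kZero hx hσ hz hd,
    fun E hE z hz h1 hd => hasDbarAt_psi_kE hx hE.ne' hz h1 hd,
    fun E hE hd σ hσ z hz => psiPM_eq α hx hE hd hσ hz,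
    fun E hE hd σ hσ z w hz _ => hPM_sub_arcIntegral α hE hd hσ hz w,
    fun E hE => tendsto_mu_kE α hx hE, fun σ hσ => tendsto_mu_kZero α hx hσ⟩
  · exact tendsto_nhds_limUnder ⟨_, (tendsto_g_plus hx hk hk0).2⟩
  · obtain ⟨β, h0, h1⟩ := exists_polar x
    exact tendsto_nhds_limUnder ⟨_, (tendsto_g_pm hx hk hk0 hσ h0 h1).2⟩
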